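/- **Setting.** All homomorphisms of C\*-algebras are $*$-homomorphisms, and $\otimes$ denotes the minimal (spatial) tensor product of C\*-algebras. Let $\mathsf{NDM}_*$ be the set of all square matrices $A=(a_{ij})$, of any size $n\ge 1$, with entries in $\{0,1\}$ and with no zero row and no zero column. It is a monoid under the Kronecker product: for $A$ of size $n$ and $B$ of size $m$, $(A\boxtimes B)_{m(i-1)+j,\,m(i'-1)+j'}=a_{ii'}b_{jj'}$; its unit is the $1\times 1$ matrix $(1)$. For $A\in\mathsf{NDM}_*$ of size $n$ let $\mathcal O_A$ be the Cuntz–Krieger algebra, i.e. the universal unital C\*-algebra generated by partial isometries $s_1^{(A)},\dots,s_n^{(A)}$ with $s_i^*s_i=\sum_j a_{ij}s_js_j^*$ and $\sum_i s_is_i^*=1$; for $A=(1)$ one puts $\mathcal O_{(1)}=\mathbb C$, $s_1=1$. Let $\varphi_{A,B}:\mathcal O_{A\boxtimes B}\to\mathcal O_A\otimes\mathcal O_B$ be the unital $*$-homomorphism with $\varphi_{A,B}(s^{(A\boxtimes B)}_{m(i-1)+j})=s^{(A)}_i\otimes s^{(B)}_j$. Let $\mathsf{CK}_*=\bigoplus_{A\in\mathsf{NDM}_*}\mathcal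 O_A$ be the $c_0$-direct sum. Let $\Delta_\varphi:\mathsf{CK}_*\to\mathsf{CK}_*\otimes\mathsf{CK}_*$ be the $*$-homomorphism which on the summand $\mathcal O_A$ is $x\mapsto\sum_{B\boxtimes C=A}\varphi_{B,C}(x)$ (a finite sum), and let $\varepsilon:\mathsf{CK}_*\to\mathbb C$ be the identification $\mathcal O_{(1)}=\mathbb C$ on this summand and $0$ on all others. Likewise let $\mathcal O_*=\bigoplus_{n\ge 1}\mathcal O_n$ be the $c_0$-direct sum of the Cuntz algebras $\mathcal O_n$ (with isometries $s_1,\dots,s_n$, $\sum_i s_is_i^*=1$; $\mathcal O_1=\mathbb C$, $s_1=1$), with the comultiplication which on $\mathcal O_N$ is $x\mapsto \sum_{nm=N}\varphi_{n,m}(x)$, where $\varphi_{n,m}:\mathcal O_{nm}\to\mathcal O_n\otimes\mathcal O_m$, $\varphi_{n,m}(s_{m(i-1)+j})=s_i\otimes s_j$, and with the counit which is the identity on $\mathcal O_1=\mathbb C$ and $0$ on $\mathcal O_n$ for $n\ge 2$. A *strictly proper C\*-bialgebra* is a C\*-algebra $\mathcal A$ with a $*$-homomorphism $\Delta:\mathcal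 A\to\mathcal A\otimes\mathcal A$ such that $(\Delta\otimes \mathrm{id})\Delta=(\mathrm{id}\otimes\Delta)\Delta$ and such that the elements $\Delta(a)(b\otimes c)$ span a dense subspace of $\mathcal A\otimes\mathcal A$. It is *counital*, with counit $\varepsilon$, if $\varepsilon:\mathcal A\to\mathbb C$ is a $*$-homomorphism with $(\varepsilon\otimes\mathrm{id})\Delta=\mathrm{id}=(\mathrm{id}\otimes\varepsilon)\Delta$, and *unital* if $\mathcal A$ and $\Delta$ are unital. A *counital C\*-subbialgebra* of $\mathcal A$ is a C\*-subalgebra $\mathcal A_0$ such that $\Delta$ and $\varepsilon$ restrict to maps $\mathcal A_0\to\mathcal A_0\otimes\mathcal A_0$ and $\mathcal A_0\to\mathbb C$ which make $\mathcal A_0$ a counital C\*-bialgebra. A *subbialgebra* of a unital counital strictly proper C\*-bialgebra $\mathcal A$ is a (not necessarily closed or self-adjoint) unital subalgebra $\mathfrak B\subset\mathcal A$ which is a unital counital bialgebra in the algebraic sense for the restrictions of $\Delta$ and $\varepsilon$, with $\Delta(\mathfrak B)\subset\mathfrak B\odot\mathfrak B$ ($\odot$ the algebraic tensor product). An *antipode*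 of $\mathfrak B$ is a linear map $S:\mathfrak B\to\mathfrak B$ with $m(S\otimes\mathrm{id})\Delta(x)=\varepsilon(x)1=m(\mathrm{id}\otimes S)\Delta(x)$ for all $x\in\mathfrak B$, where $m$ is the multiplication. **Theorem.** Let $\widetilde{\mathsf{CK}}_*$ be the minimal unitization of $\mathsf{CK}_*$. 1. There are a comultiplication $\hat\Delta_\varphi$ and a counit $\tilde\varepsilon$ of $\widetilde{\mathsf{CK}}_*$ which extend $\Delta_\varphi$ and $\varepsilon$ and make $\widetilde{\mathsf{CK}}_*$ a unital counital strictly proper C\*-bialgebra; $\tilde\varepsilon$ is unital as well. 2. Let $\mathfrak A_0$ be the unital $*$-subalgebra of $\widetilde{\mathsf{CK}}_*$ generated algebraically by all $s_i^{(A)}$, $A\in\mathsf{NDM}_*$. Then $\mathfrak A_0$ is dense in $\widetilde{\mathsf{CK}}_*$ and is a unital counital $*$-subbialgebra of $(\widetilde{\mathsf{CK}}_*,\hat\Delta_\varphi,\tilde\varepsilon)$; in particular $\hat\Delta_\varphi(\mathfrak A_0)\subset\mathfrak A_0\odot\mathfrak A_0$. 3. No dense subbialgebra of $(\widetilde{\mathsf{CK}}_*,\hat\Delta_\varphi,\tilde\varepsilon)$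 has an antipode. 4. Let $F_n$ be the $n\times n$ matrix all of whose entries are $1$. Then $\mathsf C_*=\bigoplus_{n\ge 1}\mathcal O_{F_n}$ is a counital C\*-subbialgebra of $(\mathsf{CK}_*,\Delta_\varphi,\varepsilon)$, and there is a $*$-isomorphism of $\mathsf C_*$ onto $\mathcal O_*$ which intertwines the comultiplications and the counits. -/

import Mathlib

open scoped ENNReal TensorProduct Topology
open Filter

noncomputable section

/-! ### Completion of a `*`-algebra with respect to a C*-seminorm -/

/-- A C*-seminorm on a complex `*`-algebra. -/
structure CStarSeminorm (P : Type) [NonUnitalRing P] [StarRing P] [Module ℂ P]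
    extends Seminorm ℂ P where
  mul_le' : ∀ x y, toFun (x * y) ≤ toFun x * toFun y
  cstar_le' : ∀ x, toFun x * toFun x ≤ toFun (star x * x)

namespace CStarSeminorm

set_option linter.unusedSectionVars false

variable {P : Type} [NonUnitalRing P] [StarRing P] [Module ℂ P]

/-- The underlying `*`-algebra, regarded as a seminormed space through `p`. -/
def Pre (_p : CStarSeminorm P) : Type := P

variable (p : CStarSeminorm P)

instance : NonUnitalSeminormedRing p.Pre :=
  { (inferInstance : NonUnitalRing P), p.toSeminorm.toAddGroupSeminorm.toSeminormedAddCommGroup with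
    norm_mul_le := p.mul_le' }
instance : StarRing p.Pre := inferInstanceAs (StarRing P)
instance : NormedSpace ℂ p.Pre :=
  { (inferInstance : Module ℂ P) with
    norm_smul_le := fun c x => (map_smul_eq_mul p.toSeminorm c x).le }

theorem norm_pre (x : p.Pre) : ‖x‖ = p.toSeminorm x := rfl

theorem norm_mul_le_pre (x y : p.Pre) : ‖x * y‖ ≤ ‖x‖ * ‖y‖ := p.mul_le' x y

theorem norm_star_le_pre (x : p.Pre) : ‖star x‖ ≤ ‖x‖ := by
  have h1 : ‖star x‖ * ‖star x‖ ≤ ‖x * star x‖ := by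
    have := p.cstar_le' (star x : P)
    have key : ∀ y : P, p.toFun (star (star y) * star y) = p.toFun (y * star y) := fun y => by
      rw [star_star]
    exact this.trans_eq (key x)
  have h2 := h1.trans (p.norm_mul_le_pre x (star x))
  rcases (norm_nonneg (star x)).eq_or_lt with h | h
  · rw [← h]; exact norm_nonneg x
  · exact le_of_mul_le_mul_right h2 h

theorem norm_star_pre (x : p.Pre) : ‖star x‖ = ‖x‖ :=
  le_antisymm (p.norm_star_le_pre x) (by simpa using p.norm_star_le_pre (star x))

instance : NormedStarGroup p.Pre := ⟨p.norm_star_le_pre⟩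

/-- The C*-algebra obtained from `P` by dividing out the null space of `p` and completing. -/
def Compl : Type := UniformSpace.Completion p.Pre

namespace Compl

instance : NormedAddCommGroup p.Compl :=
  inferInstanceAs (NormedAddCommGroup (UniformSpace.Completion p.Pre))
instance : NormedSpace ℂ p.Compl :=
  inferInstanceAs (NormedSpace ℂ (UniformSpace.Completion p.Pre))
instance : CompleteSpace p.Compl :=
  inferInstanceAs (CompleteSpace (UniformSpace.Completion p.Pre))

/-- The canonical map of `P` to its completion. -/
def of (x : P) : p.Compl := UniformSpace.Completion.coe' (α := p.Pre) x

theorem norm_of (x : P) : ‖of p x‖ = p.toSeminorm x :=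
  UniformSpace.Completion.norm_coe (E := p.Pre) x

theorem continuous_of : Continuous (fun x : p.Pre => of p x) :=
  UniformSpace.Completion.continuous_coe p.Pre

theorem of_add (x y : P) : of p (x + y) = of p x + of p y :=
  UniformSpace.Completion.coe_add (α := p.Pre) x y

theorem of_smul (c : ℂ) (x : P) : of p (c • x) = c • of p x :=
  UniformSpace.Completion.coe_smul (X := p.Pre) c x

theorem isDenseInducing_of : IsDenseInducing (fun x : p.Pre => of p x) :=
  UniformSpace.Completion.isDenseInducing_coe (α := p.Pre)

theorem dense_of : DenseRange (of p) := (isDenseInducing_of p).dense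

@[elab_as_elim]
theorem ind {q : p.Compl → Prop} (a : p.Compl) (hc : IsClosed {a | q a})
    (h : ∀ x : P, q (of p x)) : q a :=
  UniformSpace.Completion.induction_on (α := p.Pre) a hc h

/-- `of` as an additive map. -/
def ofAdd : p.Pre →+ p.Compl where
  toFun := of p
  map_zero' := UniformSpace.Completion.coe_zero (α := p.Pre)
  map_add' := of_add p

instance : Mul p.Compl :=
  ⟨Function.curry <| ((isDenseInducing_of p).prodMap (isDenseInducing_of p)).extend
    (fun z : p.Pre × p.Pre => of p ((z.1 * z.2 : p.Pre)))⟩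

theorem of_mul (x y : P) : of p (x * y) = of p x * of p y :=
  (((isDenseInducing_of p).prodMap (isDenseInducing_of p)).extend_eq
    ((continuous_of p).comp (continuous_mul (M := p.Pre))) (x, y)).symm

instance : ContinuousMul p.Compl where
  continuous_mul := by
    let m := (AddMonoidHom.mul : p.Pre →+ p.Pre →+ p.Pre).compr₂ (ofAdd p)
    have : Continuous fun z : p.Pre × p.Pre => m z.1 z.2 :=
      (continuous_of p).comp (continuous_mul (M := p.Pre))
    have di : IsDenseInducing (ofAdd p) := isDenseInducing_of p
    exact (di.extend_Z_bilin di this :)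

instance : Star p.Compl :=
  ⟨UniformSpace.Completion.map (α := p.Pre) (β := p.Pre) star⟩

theorem uniformContinuous_star_pre : UniformContinuous (star : p.Pre → p.Pre) :=
  (AddMonoidHomClass.isometry_of_norm (starAddEquiv : p.Pre ≃+ p.Pre)
    p.norm_star_pre).uniformContinuous

theorem of_star (x : P) : of p (star x) = star (of p x) :=
  (UniformSpace.Completion.map_coe (uniformContinuous_star_pre p) x).symm

theorem continuous_star : Continuous (star : p.Compl → p.Compl) :=
  UniformSpace.Completion.continuous_map

theorem of_zero : of p 0 = 0 := UniformSpace.Completion.coe_zero (α := p.Pre)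

instance : ContinuousStar p.Compl := ⟨continuous_star p⟩

instance : ContinuousAdd p.Compl := inferInstance
instance : ContinuousConstSMul ℂ p.Compl := inferInstance

protected theorem zero_mul (a : p.Compl) : 0 * a = 0 := by
  refine ind p a ?_ fun a => ?_
  · exact isClosed_eq (by fun_prop) (by fun_prop)
  rw [← of_zero, ← of_mul, zero_mul]

protected theorem mul_zero (a : p.Compl) : a * 0 = 0 := by
  refine ind p a ?_ fun a => ?_
  · exact isClosed_eq (by fun_prop) (by fun_prop)
  rw [← of_zero, ← of_mul, mul_zero]

protected theorem mul_assoc (a b c : p.Compl) : a * b * c = a * (b * c) := by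
  refine ind p a ?_ fun a => ?_
  · exact isClosed_eq (((continuous_id).mul (continuous_const)).mul (continuous_const)) ((continuous_id).mul (continuous_const))
  refine ind p b ?_ fun b => ?_
  · exact isClosed_eq (((continuous_const).mul (continuous_id)).mul (continuous_const)) ((continuous_const).mul ((continuous_id).mul (continuous_const)))
  refine ind p c ?_ fun c => ?_
  · exact isClosed_eq ((continuous_const).mul (continuous_id)) ((continuous_const).mul ((continuous_const).mul (continuous_id)))
  simp only [← of_mul, mul_assoc]

protected theorem mul_add (a b c : p.Compl) : a * (b + c) = a * b + a * c := by
  refine ind p a ?_ fun a => ?_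
  · exact isClosed_eq (by fun_prop) (by fun_prop)
  refine ind p b ?_ fun b => ?_
  · exact isClosed_eq (by fun_prop) (by fun_prop)
  refine ind p c ?_ fun c => ?_
  · exact isClosed_eq (by fun_prop) (by fun_prop)
  simp only [← of_mul, ← of_add, mul_add]

protected theorem add_mul (a b c : p.Compl) : (a + b) * c = a * c + b * c := by
  refine ind p a ?_ fun a => ?_
  · exact isClosed_eq (by fun_prop) (by fun_prop)
  refine ind p b ?_ fun b => ?_
  · exact isClosed_eq (by fun_prop) (by fun_prop)
  refine ind p c ?_ fun c => ?_
  · exact isClosed_eq (by fun_prop) (by fun_prop)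
  simp only [← of_mul, ← of_add, add_mul]

protected theorem norm_mul_le (a b : p.Compl) : ‖a * b‖ ≤ ‖a‖ * ‖b‖ := by
  refine ind p a ?_ fun a => ?_
  · exact isClosed_le (by fun_prop) (by fun_prop)
  refine ind p b ?_ fun b => ?_
  · exact isClosed_le (by fun_prop) (by fun_prop)
  rw [← of_mul, norm_of, norm_of, norm_of]; exact p.mul_le' a b

protected theorem star_star (a : p.Compl) : star (star a) = a := by
  refine ind p a ?_ fun a => ?_
  · exact isClosed_eq (by fun_prop) (by fun_prop)
  rw [← of_star, ← of_star, star_star]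

protected theorem star_mul (a b : p.Compl) : star (a * b) = star b * star a := by
  refine ind p a ?_ fun a => ?_
  · exact isClosed_eq (by fun_prop) (by fun_prop)
  refine ind p b ?_ fun b => ?_
  · exact isClosed_eq (by fun_prop) (by fun_prop)
  simp only [← of_mul, ← of_star, star_mul]

protected theorem star_add (a b : p.Compl) : star (a + b) = star a + star b := by
  refine ind p a ?_ fun a => ?_
  · exact isClosed_eq (by fun_prop) (by fun_prop)
  refine ind p b ?_ fun b => ?_
  · exact isClosed_eq (by fun_prop) (by fun_prop)
  simp only [← of_add, ← of_star, star_add]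

protected theorem cstar (a : p.Compl) : ‖a‖ * ‖a‖ ≤ ‖star a * a‖ := by
  refine ind p a ?_ fun a => ?_
  · exact isClosed_le (by fun_prop) (by fun_prop)
  rw [← of_star, ← of_mul, norm_of, norm_of]; exact p.cstar_le' a

protected theorem smul_mul [IsScalarTower ℂ P P] (c : ℂ) (a b : p.Compl) : c • a * b = c • (a * b) := by
  refine ind p a ?_ fun a => ?_
  · exact isClosed_eq (((continuous_id).const_smul c).mul (continuous_const)) (((continuous_id).mul (continuous_const)).const_smul c)
  refine ind p b ?_ fun b => ?_
  · exact isClosed_eq ((continuous_const).mul (continuous_id)) (((continuous_const).mul (continuous_id)).const_smul c)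
  simp only [← of_mul, ← of_smul, smul_mul_assoc]

protected theorem mul_smul [SMulCommClass ℂ P P] (c : ℂ) (a b : p.Compl) : a * c • b = c • (a * b) := by
  refine ind p a ?_ fun a => ?_
  · exact isClosed_eq ((continuous_id).mul (continuous_const)) (((continuous_id).mul (continuous_const)).const_smul c)
  refine ind p b ?_ fun b => ?_
  · exact isClosed_eq ((continuous_const).mul ((continuous_id).const_smul c)) (((continuous_const).mul (continuous_id)).const_smul c)
  simp only [← of_mul, ← of_smul, mul_smul_comm]

protected theorem star_smul [StarModule ℂ P] (c : ℂ) (a : p.Compl) : star (c • a) = star c • star a := by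
  refine ind p a ?_ fun a => ?_
  · exact isClosed_eq (((continuous_id).const_smul c).star) ((continuous_id.star).const_smul (star c))
  simp only [← of_smul, ← of_star, star_smul]

instance : NonUnitalNormedRing p.Compl where
  __ := (inferInstance : NormedAddCommGroup p.Compl)
  __ := (inferInstance : Mul p.Compl)
  zero_mul := Compl.zero_mul p
  mul_zero := Compl.mul_zero p
  mul_assoc := Compl.mul_assoc p
  left_distrib := Compl.mul_add p
  right_distrib := Compl.add_mul p
  norm_mul_le := Compl.norm_mul_le p

instance : StarRing p.Compl where
  star_involutive := Compl.star_star p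
  star_mul := Compl.star_mul p
  star_add := Compl.star_add p

variable [IsScalarTower ℂ P P] [SMulCommClass ℂ P P] [StarModule ℂ P]

instance : NonUnitalCStarAlgebra p.Compl where
  norm_mul_self_le := Compl.cstar p
  smul_assoc := Compl.smul_mul p
  smul_comm := fun c a b => (Compl.mul_smul p c a b).symm
  star_smul := Compl.star_smul p

/-- `of` as a `*`-homomorphism. -/
def ofHom : P →⋆ₙₐ[ℂ] p.Compl where
  toFun := of p
  map_smul' := of_smul p
  map_zero' := of_zero p
  map_add' := of_add p
  map_mul' := of_mul p
  map_star' := of_star p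

/-- A `*`-homomorphism to a C*-algebra which is bounded by `p` extends to the completion. -/
def lift {D : Type} [NonUnitalCStarAlgebra D] (f : P →⋆ₙₐ[ℂ] D)
    (hf : ∀ x, ‖f x‖ ≤ p.toSeminorm x) : p.Compl →⋆ₙₐ[ℂ] D :=
  let g : p.Pre →+ D := { toFun := f, map_zero' := map_zero f, map_add' := map_add f }
  have hu : UniformContinuous g :=
    AddMonoidHomClass.uniformContinuous_of_bound g 1 fun x => by rw [one_mul]; exact hf x
  have hc : Continuous (UniformSpace.Completion.extension g : p.Compl → D) :=
    UniformSpace.Completion.continuous_extension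
  have he : ∀ x : P, UniformSpace.Completion.extension g (of p x) = f x :=
    fun x => UniformSpace.Completion.extension_coe hu x
  { toFun := UniformSpace.Completion.extension g
    map_smul' := fun c a => by
      refine ind p a ?_ fun a => ?_
      · exact isClosed_eq (hc.comp (continuous_id.const_smul c)) (hc.const_smul c)
      · rw [← of_smul, he, he, map_smul]; rfl
    map_zero' := by rw [← of_zero, he, map_zero]
    map_add' := fun a b => by
      refine ind p a ?_ fun a => ?_
      · exact isClosed_eq (hc.comp (continuous_id.add continuous_const)) (hc.add continuous_const)
      refine ind p b ?_ fun b => ?_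
      · exact isClosed_eq (hc.comp (continuous_const.add continuous_id)) (continuous_const.add hc)
      · rw [← of_add, he, he, he, map_add]
    map_mul' := fun a b => by
      refine ind p a ?_ fun a => ?_
      · exact isClosed_eq (hc.comp (continuous_id.mul continuous_const)) (hc.mul continuous_const)
      refine ind p b ?_ fun b => ?_
      · exact isClosed_eq (hc.comp (continuous_const.mul continuous_id)) (continuous_const.mul hc)
      · rw [← of_mul, he, he, he, map_mul]
    map_star' := fun a => by
      refine ind p a ?_ fun a => ?_
      · exact isClosed_eq (hc.comp continuous_id.star) hc.star
      · rw [← of_star, he, he, map_star] }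

theorem lift_of {D : Type} [NonUnitalCStarAlgebra D] (f : P →⋆ₙₐ[ℂ] D)
    (hf : ∀ x, ‖f x‖ ≤ p.toSeminorm x) (x : P) : lift p f hf (of p x) = f x :=
  let g : p.Pre →+ D := { toFun := f, map_zero' := map_zero f, map_add' := map_add f }
  have hu : UniformContinuous g :=
    AddMonoidHomClass.uniformContinuous_of_bound g 1 fun x => by rw [one_mul]; exact hf x
  UniformSpace.Completion.extension_coe hu x

end Compl

end CStarSeminorm

/-- A C*-algebra with a two-sided unit, as a unital normed ring. -/
abbrev normedRingOfUnit (D : Type) [NonUnitalCStarAlgebra D] (e : D)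
    (h1 : ∀ x, e * x = x) (h2 : ∀ x, x * e = x) : NormedRing D where
  __ := (inferInstance : NonUnitalNormedRing D)
  one := e
  one_mul := h1
  mul_one := h2

/-- A C*-algebra with a two-sided unit, as a unital C*-algebra. -/
abbrev cstarAlgebraOfUnit (D : Type) [NonUnitalCStarAlgebra D] (e : D)
    (h1 : ∀ x, e * x = x) (h2 : ∀ x, x * e = x) : CStarAlgebra D where
  __ := normedRingOfUnit D e h1 h2
  __ := (inferInstance : NonUnitalCStarAlgebra D)
  algebraMap :=
    letI := normedRingOfUnit D e h1 h2
    { toFun := fun c => c • e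
      map_one' := one_smul ℂ e
      map_mul' := fun a b => by
        rw [smul_mul_smul_comm, h1]
      map_zero' := zero_smul ℂ e
      map_add' := fun a b => add_smul a b e }
  commutes' := fun c x => by
    change c • e * x = x * c • e
    rw [smul_mul_assoc, mul_smul_comm, h1, h2]
  smul_def' := fun c x => by
    change c • x = c • e * x
    rw [smul_mul_assoc, h1]
  norm_smul_le := norm_smul_le

/-! ### The minimal tensor product -/

section MinTensor

variable {A B C D : Type} [NonUnitalCStarAlgebra A] [NonUnitalCStarAlgebra B]
  [NonUnitalCStarAlgebra C] [NonUnitalCStarAlgebra D]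

section Rep

variable {H K : Type} [NormedAddCommGroup H] [InnerProductSpace ℂ H] [CompleteSpace H]
  [NormedAddCommGroup K] [InnerProductSpace ℂ K] [CompleteSpace K]

/-- For representations `π` of `A` on `H` and `ρ` of `B` on `K`, the representation `π ⊗ ρ` of the
algebraic tensor product on the (algebraic) tensor product of Hilbert spaces, given by
`a ⊗ b ↦ π a ⊗ ρ b`. -/
def tensorRep (π : A →⋆ₙₐ[ℂ] (H →L[ℂ] H)) (ρ : B →⋆ₙₐ[ℂ] (K →L[ℂ] K)) :
    A ⊗[ℂ] B →ₗ[ℂ] (H ⊗[ℂ] K →ₗ[ℂ] H ⊗[ℂ] K) :=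
  TensorProduct.lift
    (LinearMap.mk₂ ℂ (fun a b => TensorProduct.map (π a).toLinearMap (ρ b).toLinearMap)
      (fun a a' b => by
        rw [map_add, ContinuousLinearMap.toLinearMap_add, TensorProduct.map_add_left])
      (fun c a b => by
        rw [map_smul, ContinuousLinearMap.toLinearMap_smul, TensorProduct.map_smul_left])
      (fun a b b' => by
        rw [map_add, ContinuousLinearMap.toLinearMap_add, TensorProduct.map_add_right])
      (fun c a b => by
        rw [map_smul, ContinuousLinearMap.toLinearMap_smul, TensorProduct.map_smul_right]))

variable (π : A →⋆ₙₐ[ℂ] (H →L[ℂ] H)) (ρ : B →⋆ₙₐ[ℂ] (K →L[ℂ] K))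

theorem tensorRep_tmul (a : A) (b : B) :
    tensorRep π ρ (a ⊗ₜ b) = TensorProduct.map (π a).toLinearMap (ρ b).toLinearMap := rfl

theorem tensorRep_mul (x y : A ⊗[ℂ] B) (u : H ⊗[ℂ] K) :
    tensorRep π ρ (x * y) u = tensorRep π ρ x (tensorRep π ρ y u) := by
  induction x using TensorProduct.induction_on with
  | zero => simp
  | add x x' hx hx' =>
    rw [add_mul, map_add, LinearMap.add_apply, hx, hx', map_add, LinearMap.add_apply]
  | tmul a b =>
    induction y using TensorProduct.induction_on with
    | zero => simp
    | add y y' hy hy' =>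
      rw [mul_add, map_add, LinearMap.add_apply, hy, hy', map_add, LinearMap.add_apply, map_add]
    | tmul a' b' =>
      rw [Algebra.TensorProduct.tmul_mul_tmul, tensorRep_tmul, tensorRep_tmul, tensorRep_tmul,
        map_mul, map_mul, TensorProduct.map_map]
      rfl

theorem inner_tensorRep (x : A ⊗[ℂ] B) (u v : H ⊗[ℂ] K) :
    inner ℂ (tensorRep π ρ x u) v = inner ℂ u (tensorRep π ρ (star x) v) := by
  induction x using TensorProduct.induction_on with
  | zero => simp
  | add x x' hx hx' =>
    rw [star_add, map_add, map_add, LinearMap.add_apply, LinearMap.add_apply,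
      inner_add_left, inner_add_right, hx, hx']
  | tmul a b =>
    rw [TensorProduct.star_tmul, tensorRep_tmul, tensorRep_tmul, map_star, map_star]
    induction u using TensorProduct.induction_on with
    | zero => simp
    | add u u' hu hu' => rw [map_add, inner_add_left, inner_add_left, hu, hu']
    | tmul h k =>
      induction v using TensorProduct.induction_on with
      | zero => simp
      | add v v' hv hv' => rw [map_add, inner_add_right, inner_add_right, hv, hv']
      | tmul h' k' =>
        rw [TensorProduct.map_tmul, TensorProduct.map_tmul, TensorProduct.inner_tmul,
          TensorProduct.inner_tmul, ContinuousLinearMap.star_eq_adjoint,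
          ContinuousLinearMap.star_eq_adjoint]
        simp only [ContinuousLinearMap.coe_coe]
        rw [ContinuousLinearMap.adjoint_inner_right, ContinuousLinearMap.adjoint_inner_right]

theorem norm_tensorRep_sq (x : A ⊗[ℂ] B) (u : H ⊗[ℂ] K) :
    ‖tensorRep π ρ x u‖ ^ 2 ≤ ‖u‖ * ‖tensorRep π ρ (star x * x) u‖ := by
  have h1 := inner_tensorRep π ρ x u (tensorRep π ρ x u)
  rw [← tensorRep_mul] at h1
  calc ‖tensorRep π ρ x u‖ ^ 2
      = RCLike.re (inner ℂ (tensorRep π ρ x u) (tensorRep π ρ x u)) :=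
        (inner_self_eq_norm_sq (𝕜 := ℂ) (tensorRep π ρ x u)).symm
    _ = RCLike.re (inner ℂ u (tensorRep π ρ (star x * x) u)) := by rw [h1]
    _ ≤ ‖u‖ * ‖tensorRep π ρ (star x * x) u‖ :=
        re_inner_le_norm (𝕜 := ℂ) u (tensorRep π ρ (star x * x) u)

end Rep

/-- The set of all numbers `‖(π ⊗ ρ)(x) u‖`, where `π` and `ρ` are representations of `A` and `B`
on Hilbert spaces `H` and `K` and `u` is a vector of `H ⊗ K` with `‖u‖ ≤ 1`. -/
def minNormSet (x : A ⊗[ℂ] B) : Set ℝ :=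
  {r | ∃ (H K : Type) (_ : NormedAddCommGroup H) (_ : InnerProductSpace ℂ H)
    (_ : CompleteSpace H) (_ : NormedAddCommGroup K) (_ : InnerProductSpace ℂ K)
    (_ : CompleteSpace K) (π : A →⋆ₙₐ[ℂ] (H →L[ℂ] H)) (ρ : B →⋆ₙₐ[ℂ] (K →L[ℂ] K))
    (u : H ⊗[ℂ] K), ‖u‖ ≤ 1 ∧ r = ‖tensorRep π ρ x u‖}

/-- The minimal (spatial) C*-norm of an element of the algebraic tensor product: the supremum of
the operator norms `‖(π ⊗ ρ)(x)‖` over all representations `π` of `A` and `ρ` of `B` on Hilbert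
spaces. -/
def minNorm (x : A ⊗[ℂ] B) : ℝ := sSup (minNormSet x)

theorem minNormSet_zero_mem (x : A ⊗[ℂ] B) : 0 ∈ minNormSet x :=
  ⟨ℂ, ℂ, inferInstance, inferInstance, inferInstance, inferInstance, inferInstance,
    inferInstance, 0, 0, 0, by simp, by simp⟩

theorem minNormSet_bddAbove (x : A ⊗[ℂ] B) : BddAbove (minNormSet x) := by
  induction x using TensorProduct.induction_on with
  | zero => exact ⟨0, by rintro _ ⟨H, K, _, _, _, _, _, _, π, ρ, u, hu, rfl⟩; simp⟩
  | add x y hx hy =>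
    obtain ⟨r, hr⟩ := hx
    obtain ⟨s, hs⟩ := hy
    refine ⟨r + s, ?_⟩
    rintro _ ⟨H, K, _, _, _, _, _, _, π, ρ, u, hu, rfl⟩
    rw [map_add, LinearMap.add_apply]
    exact (norm_add_le _ _).trans (add_le_add
      (hr ⟨H, K, _, _, ‹_›, _, _, ‹_›, π, ρ, u, hu, rfl⟩)
      (hs ⟨H, K, _, _, ‹_›, _, _, ‹_›, π, ρ, u, hu, rfl⟩))
  | tmul a b =>
    refine ⟨‖a‖ * ‖b‖, ?_⟩
    rintro _ ⟨H, K, _, _, _, _, _, _, π, ρ, u, hu, rfl⟩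
    rw [tensorRep_tmul, ← TensorProduct.mapL_apply]
    calc ‖TensorProduct.mapL (π a) (ρ b) u‖ ≤ ‖TensorProduct.mapL (π a) (ρ b)‖ * ‖u‖ :=
          ContinuousLinearMap.le_opNorm (TensorProduct.mapL (π a) (ρ b)) u
      _ ≤ ‖TensorProduct.mapL (π a) (ρ b)‖ * 1 :=
          mul_le_mul_of_nonneg_left hu (norm_nonneg (TensorProduct.mapL (π a) (ρ b)))
      _ = ‖TensorProduct.mapL (π a) (ρ b)‖ := mul_one _
      _ ≤ ‖π a‖ * ‖ρ b‖ := TensorProduct.norm_mapL_le (π a) (ρ b)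
      _ ≤ ‖a‖ * ‖b‖ := mul_le_mul (NonUnitalStarAlgHom.norm_apply_le π a)
          (NonUnitalStarAlgHom.norm_apply_le ρ b) (norm_nonneg _) (norm_nonneg _)

theorem minNorm_nonneg (x : A ⊗[ℂ] B) : 0 ≤ minNorm x :=
  le_csSup (minNormSet_bddAbove x) (minNormSet_zero_mem x)

theorem le_minNorm {H K : Type} [NormedAddCommGroup H] [InnerProductSpace ℂ H] [CompleteSpace H]
    [NormedAddCommGroup K] [InnerProductSpace ℂ K] [CompleteSpace K]
    (π : A →⋆ₙₐ[ℂ] (H →L[ℂ] H)) (ρ : B →⋆ₙₐ[ℂ] (K →L[ℂ] K)) (x : A ⊗[ℂ] B) (u : H ⊗[ℂ] K) :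
    ‖tensorRep π ρ x u‖ ≤ minNorm x * ‖u‖ := by
  rcases eq_or_ne u 0 with rfl | hu
  · simp
  have hu' : 0 < ‖u‖ := norm_pos_iff.mpr hu
  have h : ‖tensorRep π ρ x ((‖u‖⁻¹ : ℂ) • u)‖ ≤ minNorm x :=
    le_csSup (minNormSet_bddAbove x) ⟨H, K, _, _, ‹_›, _, _, ‹_›, π, ρ, _,
      by rw [norm_smul]; simp [hu'.ne'], rfl⟩
  rw [map_smul, norm_smul] at h
  simp only [norm_inv, Complex.norm_real, norm_norm] at h
  rwa [inv_mul_le_iff₀ hu', mul_comm] at h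

theorem minNorm_le {x : A ⊗[ℂ] B} {r : ℝ} (h : ∀ (H K : Type) [NormedAddCommGroup H]
    [InnerProductSpace ℂ H] [CompleteSpace H] [NormedAddCommGroup K] [InnerProductSpace ℂ K]
    [CompleteSpace K] (π : A →⋆ₙₐ[ℂ] (H →L[ℂ] H)) (ρ : B →⋆ₙₐ[ℂ] (K →L[ℂ] K)) (u : H ⊗[ℂ] K),
    ‖u‖ ≤ 1 → ‖tensorRep π ρ x u‖ ≤ r) : minNorm x ≤ r :=
  csSup_le ⟨0, minNormSet_zero_mem x⟩
    (by rintro _ ⟨H, K, _, _, _, _, _, _, π, ρ, u, hu, rfl⟩; exact h H K π ρ u hu)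

theorem le_minNorm_one {H K : Type} [NormedAddCommGroup H] [InnerProductSpace ℂ H]
    [CompleteSpace H] [NormedAddCommGroup K] [InnerProductSpace ℂ K] [CompleteSpace K]
    (π : A →⋆ₙₐ[ℂ] (H →L[ℂ] H)) (ρ : B →⋆ₙₐ[ℂ] (K →L[ℂ] K)) (x : A ⊗[ℂ] B) {u : H ⊗[ℂ] K}
    (hu : ‖u‖ ≤ 1) : ‖tensorRep π ρ x u‖ ≤ minNorm x :=
  (le_minNorm π ρ x u).trans (mul_le_of_le_one_right (minNorm_nonneg x) hu)

variable (A B) in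
/-- The minimal C*-norm, as a C*-seminorm. -/
def minSeminorm : CStarSeminorm (A ⊗[ℂ] B) where
  toSeminorm := Seminorm.ofSMulLE minNorm
    (le_antisymm (minNorm_le fun H K _ _ _ _ _ _ π ρ u hu => by simp) (minNorm_nonneg _))
    (fun x y => minNorm_le fun H K _ _ _ _ _ _ π ρ u hu => by
      rw [map_add, LinearMap.add_apply]
      exact (norm_add_le _ _).trans
        (add_le_add (le_minNorm_one π ρ x hu) (le_minNorm_one π ρ y hu)))
    (fun c x => minNorm_le fun H K _ _ _ _ _ _ π ρ u hu => by
      rw [map_smul, LinearMap.smul_apply, norm_smul]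
      exact mul_le_mul_of_nonneg_left (le_minNorm_one π ρ x hu) (norm_nonneg _))
  mul_le' x y := minNorm_le fun H K _ _ _ _ _ _ π ρ u hu => by
    rw [tensorRep_mul]
    exact (le_minNorm π ρ x _).trans
      (mul_le_mul_of_nonneg_left (le_minNorm_one π ρ y hu) (minNorm_nonneg x))
  cstar_le' x := by
    have h : minNorm x ≤ Real.sqrt (minNorm (star x * x)) :=
      minNorm_le fun H K _ _ _ _ _ _ π ρ u hu => Real.le_sqrt_of_sq_le <|
        (norm_tensorRep_sq π ρ x u).trans <| (mul_le_of_le_one_left (norm_nonneg _) hu).trans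
          (le_minNorm_one π ρ _ hu)
    calc minNorm x * minNorm x
        ≤ Real.sqrt (minNorm (star x * x)) * Real.sqrt (minNorm (star x * x)) :=
          mul_le_mul h h (minNorm_nonneg x) (Real.sqrt_nonneg _)
      _ = minNorm (star x * x) := Real.mul_self_sqrt (minNorm_nonneg _)

variable (A B) in
/-- The minimal tensor product `A ⊗ B` of C*-algebras: the completion of the algebraic tensor
product in the minimal C*-norm. -/
abbrev MinTensor : Type := (minSeminorm A B).Compl

namespace MinTensor

/-- The canonical `*`-homomorphism of the algebraic tensor product to the minimal one. -/
abbrev ofAlg : A ⊗[ℂ] B →⋆ₙₐ[ℂ] MinTensor A B := CStarSeminorm.Compl.ofHom (minSeminorm A B)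

/-- `ofAlg` as a linear map. -/
def ofAlgLinear : A ⊗[ℂ] B →ₗ[ℂ] MinTensor A B where
  toFun := ofAlg
  map_add' := map_add ofAlg
  map_smul' := map_smul ofAlg

/-- The elementary tensor `a ⊗ b` in the minimal tensor product. -/
abbrev tmul (a : A) (b : B) : MinTensor A B := ofAlg (a ⊗ₜ[ℂ] b)

/-- The algebraic tensor product of two `*`-homomorphisms. -/
def algMap (f : A →⋆ₙₐ[ℂ] C) (g : B →⋆ₙₐ[ℂ] D) : A ⊗[ℂ] B →⋆ₙₐ[ℂ] C ⊗[ℂ] D where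
  toFun := TensorProduct.map (f : A →ₗ[ℂ] C) (g : B →ₗ[ℂ] D)
  map_smul' := map_smul _
  map_zero' := map_zero _
  map_add' := map_add _
  map_mul' x y := by
    induction x using TensorProduct.induction_on with
    | zero => simp
    | add x x' hx hx' => rw [add_mul, map_add, hx, hx', map_add, add_mul]
    | tmul a b =>
      induction y using TensorProduct.induction_on with
      | zero => simp
      | add y y' hy hy' => rw [mul_add, map_add, hy, hy', map_add, mul_add]
      | tmul a' b' => simp
  map_star' x := by
    induction x using TensorProduct.induction_on with
    | zero => simp
    | add x x' hx hx' => rw [star_add, map_add, hx, hx', map_add, star_add]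
    | tmul a b => simp [map_star]

theorem tensorRep_algMap (f : A →⋆ₙₐ[ℂ] C) (g : B →⋆ₙₐ[ℂ] D) {H K : Type}
    [NormedAddCommGroup H] [InnerProductSpace ℂ H] [CompleteSpace H]
    [NormedAddCommGroup K] [InnerProductSpace ℂ K] [CompleteSpace K]
    (π : C →⋆ₙₐ[ℂ] (H →L[ℂ] H)) (ρ : D →⋆ₙₐ[ℂ] (K →L[ℂ] K)) (x : A ⊗[ℂ] B) :
    tensorRep π ρ (algMap f g x) = tensorRep (π.comp f) (ρ.comp g) x := by
  induction x using TensorProduct.induction_on with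
  | zero => simp
  | add x y hx hy => rw [map_add, map_add, hx, hy, map_add]
  | tmul a b =>
    rw [tensorRep_tmul]
    exact tensorRep_tmul π ρ (f a) (g b)

/-- The tensor product `f ⊗ g : A ⊗ B → C ⊗ D` of `*`-homomorphisms `f : A → C`, `g : B → D`. -/
def map (f : A →⋆ₙₐ[ℂ] C) (g : B →⋆ₙₐ[ℂ] D) : MinTensor A B →⋆ₙₐ[ℂ] MinTensor C D :=
  CStarSeminorm.Compl.lift (minSeminorm A B) (ofAlg.comp (algMap f g)) fun x => by
    refine (CStarSeminorm.Compl.norm_of (minSeminorm C D) (algMap f g x)).trans_le ?_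
    exact minNorm_le fun H K _ _ _ _ _ _ π ρ u hu => by
      rw [tensorRep_algMap]
      exact le_minNorm_one _ _ x hu

theorem map_ofAlg (f : A →⋆ₙₐ[ℂ] C) (g : B →⋆ₙₐ[ℂ] D) (x : A ⊗[ℂ] B) :
    map f g (ofAlg x) = ofAlg (algMap f g x) :=
  CStarSeminorm.Compl.lift_of _ _ _ x

theorem map_tmul (f : A →⋆ₙₐ[ℂ] C) (g : B →⋆ₙₐ[ℂ] D) (a : A) (b : B) :
    map f g (tmul a b) = tmul (f a) (g b) := map_ofAlg f g (a ⊗ₜ b)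

theorem tmul_mul_tmul (a a' : A) (b b' : B) :
    tmul a b * tmul a' b' = tmul (a * a') (b * b') := by
  rw [← map_mul, Algebra.TensorProduct.tmul_mul_tmul]

theorem star_tmul (a : A) (b : B) : star (tmul a b) = tmul (star a) (star b) := by
  rw [← map_star, TensorProduct.star_tmul]

/-- A closed additive property of elementary tensors holds on the minimal tensor product. -/
@[elab_as_elim]
theorem induction {q : MinTensor A B → Prop} (z : MinTensor A B) (hc : IsClosed {z | q z})
    (ha : ∀ x y, q x → q y → q (x + y)) (h0 : q 0) (ht : ∀ a b, q (tmul a b)) : q z := by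
  refine CStarSeminorm.Compl.ind _ z hc fun x => ?_
  change q (ofAlg x)
  induction x using TensorProduct.induction_on with
  | zero => rwa [map_zero]
  | add x y hx hy => rw [map_add]; exact ha _ _ hx hy
  | tmul a b => exact ht a b

end MinTensor

end MinTensor

/-- The minimal tensor product of unital C*-algebras is unital, with unit `1 ⊗ 1`. -/
instance {A B : Type} [CStarAlgebra A] [CStarAlgebra B] : CStarAlgebra (MinTensor A B) :=
  cstarAlgebraOfUnit (MinTensor A B) (MinTensor.tmul 1 1)
    (fun z => by
      refine MinTensor.induction z ?_ ?_ ?_ ?_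
      · exact isClosed_eq (by fun_prop) (by fun_prop)
      · intro x y hx hy; rw [mul_add, hx, hy]
      · rw [mul_zero]
      · intro a b; rw [MinTensor.tmul_mul_tmul, one_mul, one_mul])
    (fun z => by
      refine MinTensor.induction z ?_ ?_ ?_ ?_
      · exact isClosed_eq (by fun_prop) (by fun_prop)
      · intro x y hx hy; rw [add_mul, hx, hy]
      · rw [zero_mul]
      · intro a b; rw [MinTensor.tmul_mul_tmul, mul_one, mul_one])

/-! ### Universal C*-algebras given by generators and relations -/

/-- The free unital complex `*`-algebra on `X`: the free algebra on the symbols `x` (left summand)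
and `x*` (right summand). -/
def FreeStar (X : Type) : Type := FreeAlgebra ℂ (X ⊕ X)

namespace FreeStar

variable {X : Type}

instance : Ring (FreeStar X) := inferInstanceAs (Ring (FreeAlgebra ℂ (X ⊕ X)))
instance : Algebra ℂ (FreeStar X) := inferInstanceAs (Algebra ℂ (FreeAlgebra ℂ (X ⊕ X)))

/-- The generators of the free `*`-algebra and their adjoints. -/
def letter (y : X ⊕ X) : FreeStar X := FreeAlgebra.ι ℂ y

/-- The generators of the free `*`-algebra. -/
def gen (x : X) : FreeStar X := letter (Sum.inl x)

theorem ind {q : FreeStar X → Prop} (h0 : ∀ c : ℂ, q (algebraMap ℂ (FreeStar X) c))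
    (h1 : ∀ y, q (letter y)) (hm : ∀ a b, q a → q b → q (a * b))
    (ha : ∀ a b, q a → q b → q (a + b)) (a : FreeStar X) : q a :=
  FreeAlgebra.induction ℂ (X ⊕ X) h0 h1 hm ha a

/-- The opposite of the free algebra, with scalars acting through complex conjugation. -/
def ConjOp (X : Type) : Type := (FreeStar X)ᵐᵒᵖ

instance : Ring (ConjOp X) := inferInstanceAs (Ring (FreeStar X)ᵐᵒᵖ)

instance : Algebra ℂ (ConjOp X) where
  smul c a := MulOpposite.op (algebraMap ℂ (FreeStar X) (star c) * MulOpposite.unop a)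
  algebraMap :=
    ((algebraMap ℂ (FreeStar X)ᵐᵒᵖ).comp (starRingEnd ℂ) : ℂ →+* (FreeStar X)ᵐᵒᵖ)
  commutes' c a := Algebra.commutes (R := ℂ) (A := (FreeStar X)ᵐᵒᵖ) (star c) a
  smul_def' c a := MulOpposite.unop_injective (Algebra.commutes (star c) (MulOpposite.unop a))

/-- The involution of the free `*`-algebra, which is conjugate linear, reverses products and
exchanges `x` and `x*`. -/
def starAux : FreeStar X →ₐ[ℂ] ConjOp X :=
  FreeAlgebra.lift ℂ (A := ConjOp X) (fun y => MulOpposite.op (letter y.swap))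

instance : Star (FreeStar X) := ⟨fun a => MulOpposite.unop (starAux a)⟩

theorem star_letter (y : X ⊕ X) : star (letter y) = letter y.swap :=
  congrArg MulOpposite.unop (FreeAlgebra.lift_ι_apply (A := ConjOp X) _ y)

theorem star_algebraMap (c : ℂ) :
    star (algebraMap ℂ (FreeStar X) c) = algebraMap ℂ (FreeStar X) (star c) :=
  congrArg MulOpposite.unop (starAux.commutes c)

theorem star_mul_aux (a b : FreeStar X) : star (a * b) = star b * star a :=
  congrArg MulOpposite.unop (map_mul starAux a b)

theorem star_add_aux (a b : FreeStar X) : star (a + b) = star a + star b :=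
  congrArg MulOpposite.unop (map_add starAux a b)

instance : StarRing (FreeStar X) where
  star_involutive a := by
    induction a using ind with
    | h0 c => rw [star_algebraMap, star_algebraMap, star_star]
    | h1 y => rw [star_letter, star_letter, Sum.swap_swap]
    | hm a b ha hb => rw [star_mul_aux, star_mul_aux, ha, hb]
    | ha a b ha hb => rw [star_add_aux, star_add_aux, ha, hb]
  star_mul := star_mul_aux
  star_add := star_add_aux

instance : StarModule ℂ (FreeStar X) where
  star_smul c a := by
    rw [Algebra.smul_def, Algebra.smul_def, star_mul, star_algebraMap]
    exact (Algebra.commutes _ _).symm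

variable {B : Type} [CStarAlgebra B]

/-- Evaluation of `*`-polynomials at a family of elements of a unital C*-algebra. -/
def eval (s : X → B) : FreeStar X →⋆ₐ[ℂ] B :=
  let f : FreeStar X →ₐ[ℂ] B := FreeAlgebra.lift ℂ (Sum.elim s fun x => star (s x))
  have hf : ∀ y, f (letter y) = Sum.elim s (fun x => star (s x)) y :=
    fun y => FreeAlgebra.lift_ι_apply _ y
  { f with
    map_star' := fun a => by
      change f (star a) = star (f a)
      induction a using ind with
      | h0 c => rw [star_algebraMap, f.commutes, f.commutes, ← algebraMap_star_comm]
      | h1 y => rw [star_letter, hf, hf]; cases y <;> simp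
      | hm a b ha hb => rw [star_mul, map_mul, map_mul, ha, hb, star_mul]
      | ha a b ha hb => rw [star_add, map_add, map_add, ha, hb, star_add] }

theorem eval_letter (s : X → B) (y : X ⊕ X) :
    eval s (letter y) = Sum.elim s (fun x => star (s x)) y :=
  FreeAlgebra.lift_ι_apply _ y

theorem eval_gen (s : X → B) (x : X) : eval s (gen x) = s x := eval_letter s (Sum.inl x)

end FreeStar

/-- A set of `*`-polynomial relations `p = 0` on generators indexed by `X` which force the
generators to have norm at most one in every unital C*-algebra. -/
structure CStarRelations (X : Type) where
  /-- The `*`-polynomials which are required to vanish. -/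
  rel : Set (FreeStar X)
  norm_le : ∀ (B : Type) [CStarAlgebra B] (s : X → B), (∀ p ∈ rel, FreeStar.eval s p = 0) →
    ∀ x, ‖s x‖ ≤ 1

namespace CStarRelations

variable {X : Type} (R : CStarRelations X)

/-- The set of the norms `‖a(s)‖` of the `*`-polynomial `a`, for all families `s` which satisfy
the relations in some unital C*-algebra. -/
def normSet (a : FreeStar X) : Set ℝ :=
  {r | ∃ (B : Type) (_ : CStarAlgebra B) (s : X → B), (∀ p ∈ R.rel, FreeStar.eval s p = 0) ∧
    r = ‖FreeStar.eval s a‖}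

theorem normSet_bddAbove (a : FreeStar X) : BddAbove (R.normSet a) := by
  have hone : ∀ (B : Type) [CStarAlgebra B], ‖(1 : B)‖ ≤ 1 := fun B _ => by
    rcases subsingleton_or_nontrivial B with h | h
    · rw [Subsingleton.elim (1 : B) 0, norm_zero]; exact zero_le_one
    · exact CStarRing.norm_one.le
  induction a using FreeStar.ind with
  | h0 c =>
    refine ⟨‖c‖, ?_⟩
    rintro _ ⟨B, _, s, hs, rfl⟩
    rw [AlgHomClass.commutes, Algebra.algebraMap_eq_smul_one, norm_smul]
    exact mul_le_of_le_one_right (norm_nonneg c) (hone B)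
  | h1 y =>
    refine ⟨1, ?_⟩
    rintro _ ⟨B, _, s, hs, rfl⟩
    rw [FreeStar.eval_letter]
    cases y with
    | inl x => exact R.norm_le B s hs x
    | inr x => exact (norm_star (s x)).trans_le (R.norm_le B s hs x)
  | hm a b ha hb =>
    obtain ⟨r, hr⟩ := ha
    obtain ⟨t, ht⟩ := hb
    refine ⟨r * t, ?_⟩
    rintro _ ⟨B, _, s, hs, rfl⟩
    have h := hr ⟨B, _, s, hs, rfl⟩
    rw [map_mul]
    exact (norm_mul_le _ _).trans
      (mul_le_mul h (ht ⟨B, _, s, hs, rfl⟩) (norm_nonneg _) ((norm_nonneg _).trans h))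
  | ha a b ha hb =>
    obtain ⟨r, hr⟩ := ha
    obtain ⟨t, ht⟩ := hb
    refine ⟨r + t, ?_⟩
    rintro _ ⟨B, _, s, hs, rfl⟩
    rw [map_add]
    exact (norm_add_le _ _).trans (add_le_add (hr ⟨B, _, s, hs, rfl⟩) (ht ⟨B, _, s, hs, rfl⟩))

/-- The largest C*-seminorm on the free `*`-algebra for which the relations hold. -/
def univNorm (a : FreeStar X) : ℝ := sSup (R.normSet a)

theorem univNorm_nonneg (a : FreeStar X) : 0 ≤ R.univNorm a :=
  Real.sSup_nonneg (by rintro _ ⟨B, _, s, hs, rfl⟩; exact norm_nonneg _)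

theorem le_univNorm {B : Type} [CStarAlgebra B] {s : X → B}
    (hs : ∀ p ∈ R.rel, FreeStar.eval s p = 0) (a : FreeStar X) :
    ‖FreeStar.eval s a‖ ≤ R.univNorm a :=
  le_csSup (R.normSet_bddAbove a) ⟨B, _, s, hs, rfl⟩

theorem univNorm_le {a : FreeStar X} {r : ℝ} (hr : 0 ≤ r) (h : ∀ (B : Type) [CStarAlgebra B]
    (s : X → B), (∀ p ∈ R.rel, FreeStar.eval s p = 0) → ‖FreeStar.eval s a‖ ≤ r) :
    R.univNorm a ≤ r :=
  Real.sSup_le (by rintro _ ⟨B, _, s, hs, rfl⟩; exact h B s hs) hr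

/-- The largest C*-seminorm on the free `*`-algebra for which the relations hold. -/
def univSeminorm : CStarSeminorm (FreeStar X) where
  toSeminorm := Seminorm.ofSMulLE R.univNorm
    (le_antisymm (R.univNorm_le le_rfl fun B _ s hs => by rw [map_zero, norm_zero])
      (R.univNorm_nonneg 0))
    (fun a b => R.univNorm_le (add_nonneg (R.univNorm_nonneg a) (R.univNorm_nonneg b))
      fun B _ s hs => by
        rw [map_add]
        exact (norm_add_le _ _).trans (add_le_add (R.le_univNorm hs a) (R.le_univNorm hs b)))
    (fun c a => R.univNorm_le (mul_nonneg (norm_nonneg c) (R.univNorm_nonneg a))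
      fun B _ s hs => by
        rw [map_smul, norm_smul]
        exact mul_le_mul_of_nonneg_left (R.le_univNorm hs a) (norm_nonneg c))
  mul_le' a b := R.univNorm_le (mul_nonneg (R.univNorm_nonneg a) (R.univNorm_nonneg b))
    fun B _ s hs => by
      rw [map_mul]
      exact (norm_mul_le _ _).trans (mul_le_mul (R.le_univNorm hs a) (R.le_univNorm hs b)
        (norm_nonneg _) (R.univNorm_nonneg a))
  cstar_le' a := by
    have h : R.univNorm a ≤ Real.sqrt (R.univNorm (star a * a)) :=
      R.univNorm_le (Real.sqrt_nonneg _) fun B _ s hs => Real.le_sqrt_of_sq_le <| by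
        have h1 := R.le_univNorm hs (star a * a)
        rwa [map_mul, map_star, CStarRing.norm_star_mul_self, ← sq] at h1
    calc R.univNorm a * R.univNorm a
        ≤ Real.sqrt (R.univNorm (star a * a)) * Real.sqrt (R.univNorm (star a * a)) :=
          mul_le_mul h h (R.univNorm_nonneg a) (Real.sqrt_nonneg _)
      _ = R.univNorm (star a * a) := Real.mul_self_sqrt (R.univNorm_nonneg _)

/-- The universal unital C*-algebra generated by a family which satisfies the relations. -/
abbrev Univ : Type := R.univSeminorm.Compl

namespace Univ

/-- The class of a `*`-polynomial in the universal C*-algebra. -/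
abbrev ofPoly : FreeStar X →⋆ₙₐ[ℂ] R.Univ := CStarSeminorm.Compl.ofHom R.univSeminorm

theorem ofPoly_one_mul (z : R.Univ) : ofPoly R 1 * z = z := by
  refine CStarSeminorm.Compl.ind _ z (isClosed_eq (by fun_prop) (by fun_prop)) fun a => ?_
  change ofPoly R 1 * ofPoly R a = ofPoly R a
  rw [← map_mul, one_mul]

theorem ofPoly_mul_one (z : R.Univ) : z * ofPoly R 1 = z := by
  refine CStarSeminorm.Compl.ind _ z (isClosed_eq (by fun_prop) (by fun_prop)) fun a => ?_
  change ofPoly R a * ofPoly R 1 = ofPoly R a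
  rw [← map_mul, mul_one]

instance : CStarAlgebra R.Univ :=
  cstarAlgebraOfUnit R.Univ (ofPoly R 1) (ofPoly_one_mul R) (ofPoly_mul_one R)

/-- The generators of the universal C*-algebra. -/
def gen (x : X) : R.Univ := ofPoly R (FreeStar.gen x)

theorem eval_gen (a : FreeStar X) : FreeStar.eval (gen R) a = ofPoly R a := by
  induction a using FreeStar.ind with
  | h0 c =>
    rw [AlgHomClass.commutes, Algebra.algebraMap_eq_smul_one, Algebra.algebraMap_eq_smul_one,
      map_smul]
    rfl
  | h1 y =>
    rw [FreeStar.eval_letter]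
    cases y with
    | inl x => rfl
    | inr x =>
      change star (ofPoly R (FreeStar.gen x)) = _
      rw [← map_star, FreeStar.gen, FreeStar.star_letter, Sum.swap_inl]
  | hm a b ha hb => rw [map_mul, map_mul, ha, hb]
  | ha a b ha hb => rw [map_add, map_add, ha, hb]

/-- The generators of the universal C*-algebra satisfy the relations. -/
theorem gen_rel : ∀ p ∈ R.rel, FreeStar.eval (gen R) p = 0 := fun p hp => by
  rw [eval_gen, ← norm_eq_zero]
  refine le_antisymm ?_ (norm_nonneg _)
  refine (CStarSeminorm.Compl.norm_of R.univSeminorm p).trans_le ?_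
  exact R.univNorm_le le_rfl fun B _ s hs => by rw [hs p hp, norm_zero]

variable {R} {B : Type} [CStarAlgebra B] (s : X → B)
  (hs : ∀ p ∈ R.rel, FreeStar.eval s p = 0)

/-- The universal property: a family in a unital C*-algebra which satisfies the relations defines
a `*`-homomorphism of the universal C*-algebra. -/
def lift : R.Univ →⋆ₙₐ[ℂ] B :=
  CStarSeminorm.Compl.lift R.univSeminorm (FreeStar.eval s : FreeStar X →⋆ₙₐ[ℂ] B)
    (R.le_univNorm hs)

theorem lift_ofPoly (a : FreeStar X) : lift s hs (ofPoly R a) = FreeStar.eval s a :=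
  CStarSeminorm.Compl.lift_of _ _ _ a

theorem lift_gen (x : X) : lift s hs (gen R x) = s x :=
  (lift_ofPoly s hs (FreeStar.gen x)).trans (FreeStar.eval_gen s x)

theorem lift_one : lift s hs 1 = 1 := (lift_ofPoly s hs 1).trans (map_one _)

end Univ

end CStarRelations

/-! ### `c₀`-direct sums -/

section C0

variable {ι : Type} (𝒜 : ι → Type) [∀ i, NonUnitalCStarAlgebra (𝒜 i)]

/-- The bounded families whose norms tend to zero, as a `*`-subalgebra of the `ℓ^∞`-product. -/
def c0Subalgebra : NonUnitalStarSubalgebra ℂ (lp 𝒜 ∞) where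
  carrier := {f | Tendsto (fun i => ‖f i‖) cofinite (𝓝 0)}
  zero_mem' := by
    change Tendsto (fun i => ‖(0 : 𝒜 i)‖) cofinite (𝓝 0)
    simp only [norm_zero, tendsto_const_nhds]
  add_mem' {f g} hf hg := by
    refine squeeze_zero (fun i => norm_nonneg _) (fun i => norm_add_le (f i) (g i)) ?_
    simpa using Tendsto.add hf hg
  mul_mem' {f g} hf hg := by
    refine squeeze_zero (fun i => norm_nonneg _) (fun i => norm_mul_le (f i) (g i)) ?_
    simpa using Tendsto.mul hf hg
  smul_mem' c f hf := by
    refine squeeze_zero (fun i => norm_nonneg _) (fun i => (norm_smul c (f i)).le) ?_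
    simpa using Tendsto.const_mul ‖c‖ hf
  star_mem' {f} hf := by
    have h : ∀ i, ‖(star f) i‖ = ‖f i‖ := fun i => norm_star (f i)
    change Tendsto (fun i => ‖(star f) i‖) cofinite (𝓝 0)
    simp only [h]
    exact hf

instance : IsClosed (c0Subalgebra 𝒜 : Set (lp 𝒜 ∞)) := by
  rw [← isSeqClosed_iff_isClosed]
  intro u f hu hf
  have hu' : ∀ n, Tendsto (fun i => ‖u n i‖) cofinite (𝓝 0) := hu
  change Tendsto (fun i => ‖f i‖) cofinite (𝓝 0)
  rw [Metric.tendsto_nhds]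
  intro ε hε
  obtain ⟨n, hn⟩ := ((Metric.tendsto_nhds.mp hf) (ε / 2) (half_pos hε)).exists
  filter_upwards [(Metric.tendsto_nhds.mp (hu' n)) (ε / 2) (half_pos hε)] with i hi
  rw [Real.dist_eq, sub_zero, abs_norm] at hi ⊢
  have h1 : ‖(f - u n) i‖ ≤ ‖f - u n‖ := lp.norm_apply_le_norm ENNReal.top_ne_zero (f - u n) i
  rw [← dist_eq_norm, dist_comm] at h1
  have h2 : f i = (f - u n) i + u n i := by rw [lp.coeFn_sub, Pi.sub_apply, sub_add_cancel]
  calc ‖f i‖ ≤ ‖(f - u n) i‖ + ‖u n i‖ := (congrArg norm h2).trans_le (norm_add_le ((f - u n) i) (u n i))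
    _ < ε / 2 + ε / 2 := add_lt_add (h1.trans_lt hn) hi
    _ = ε := add_halves ε

/-- The direct sum of a family of C*-algebras: the families whose norms tend to zero. -/
def C0Sum : Type := c0Subalgebra 𝒜

instance : NonUnitalCStarAlgebra (C0Sum 𝒜) :=
  NonUnitalStarSubalgebra.nonUnitalCStarAlgebra (c0Subalgebra 𝒜)

namespace C0Sum

variable {𝒜}

/-- The projection of the direct sum to a summand. -/
def proj (i : ι) : C0Sum 𝒜 →⋆ₙₐ[ℂ] 𝒜 i where
  toFun x := x.1 i
  map_smul' _ _ := rfl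
  map_zero' := rfl
  map_add' _ _ := rfl
  map_mul' _ _ := rfl
  map_star' _ := rfl

theorem ext {x y : C0Sum 𝒜} (h : ∀ i, proj i x = proj i y) : x = y :=
  Subtype.ext (lp.ext (funext h))

theorem tendsto_proj (x : C0Sum 𝒜) : Tendsto (fun i => ‖proj i x‖) cofinite (𝓝 0) := x.2

theorem norm_le {x : C0Sum 𝒜} {r : ℝ} (hr : 0 ≤ r) (h : ∀ i, ‖proj i x‖ ≤ r) : ‖x‖ ≤ r :=
  lp.norm_le_of_forall_le hr h

open Classical in
/-- The inclusion of a summand into the direct sum. -/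
def single (i : ι) : 𝒜 i →⋆ₙₐ[ℂ] C0Sum 𝒜 where
  toFun a := ⟨lp.single ∞ i a, by
    change Tendsto (fun j => ‖lp.single ∞ i a j‖) cofinite (𝓝 0)
    refine tendsto_const_nhds.congr' ?_
    filter_upwards [(Set.finite_singleton i).compl_mem_cofinite] with j hj
    rw [lp.single_apply_ne _ _ _ hj, norm_zero]⟩
  map_smul' c a := Subtype.ext (lp.single_smul ∞ i c a)
  map_zero' := Subtype.ext (lp.single_zero ∞ i)
  map_add' a b := Subtype.ext (lp.single_add ∞ i a b)
  map_mul' a b := by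
    refine Subtype.ext (lp.ext (funext fun j => ?_))
    change lp.single ∞ i (a * b) j = lp.single ∞ i a j * lp.single ∞ i b j
    rcases eq_or_ne j i with rfl | h
    · rw [lp.single_apply_self, lp.single_apply_self, lp.single_apply_self]
    · rw [lp.single_apply_ne _ _ _ h, lp.single_apply_ne _ _ _ h, zero_mul]
  map_star' a := by
    refine Subtype.ext (lp.ext (funext fun j => ?_))
    change lp.single ∞ i (star a) j = star (lp.single ∞ i a j)
    rcases eq_or_ne j i with rfl | h
    · rw [lp.single_apply_self, lp.single_apply_self]
    · rw [lp.single_apply_ne _ _ _ h, lp.single_apply_ne _ _ _ h, star_zero]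

open Classical in
theorem proj_single_self (i : ι) (a : 𝒜 i) : proj i (single i a) = a :=
  lp.single_apply_self ∞ i a

open Classical in
theorem proj_single_ne {i j : ι} (h : j ≠ i) (a : 𝒜 i) : proj j (single i a) = 0 :=
  lp.single_apply_ne ∞ i a h

theorem single_mul_single_ne {i j : ι} (h : i ≠ j) (a : 𝒜 i) (b : 𝒜 j) :
    single i a * single j b = 0 := by
  refine ext fun k => ?_
  rw [map_mul, map_zero]
  rcases eq_or_ne k i with rfl | hk
  · rw [proj_single_ne h, mul_zero]
  · rw [proj_single_ne hk, zero_mul]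

/-! A family of `*`-homomorphisms of the summands with pairwise orthogonal ranges defines a
`*`-homomorphism of the direct sum. -/

section Desc

variable {P : Type} {m : P → ι} {T : Type} [NonUnitalCStarAlgebra T]
  (ψ : ∀ p, 𝒜 (m p) →⋆ₙₐ[ℂ] T)

theorem sum_mul_sum (horth : ∀ p q, p ≠ q → ∀ x y, ψ p x * ψ q y = 0)
    (s : Finset P) (x y : C0Sum 𝒜) :
    (∑ p ∈ s, ψ p (proj (m p) x)) * (∑ p ∈ s, ψ p (proj (m p) y)) =
      ∑ p ∈ s, ψ p (proj (m p) (x * y)) := by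
  classical
  rw [Finset.sum_mul_sum]
  refine Finset.sum_congr rfl fun p hp => ?_
  rw [Finset.sum_eq_single p, map_mul, map_mul]
  · exact fun q _ hq => horth p q hq.symm _ _
  · exact fun h => absurd hp h

/-- The `*`-homomorphism given by a finite part of the family. -/
def partHom (horth : ∀ p q, p ≠ q → ∀ x y, ψ p x * ψ q y = 0)
    (s : Finset P) : C0Sum 𝒜 →⋆ₙₐ[ℂ] T where
  toFun x := ∑ p ∈ s, ψ p (proj (m p) x)
  map_smul' c x := by simp only [map_smul, Finset.smul_sum, MonoidHom.id_apply]
  map_zero' := by simp only [map_zero, Finset.sum_const_zero]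
  map_add' x y := by simp only [map_add, Finset.sum_add_distrib]
  map_mul' x y := (sum_mul_sum ψ horth s x y).symm
  map_star' x := by simp only [map_star, star_sum]

theorem norm_sum_le (horth : ∀ p q, p ≠ q → ∀ x y, ψ p x * ψ q y = 0)
    (s : Finset P) (x : C0Sum 𝒜) {r : ℝ} (hr : 0 ≤ r)
    (h : ∀ p ∈ s, ‖proj (m p) x‖ ≤ r) : ‖∑ p ∈ s, ψ p (proj (m p) x)‖ ≤ r := by
  classical
  let y : C0Sum 𝒜 := ∑ i ∈ s.image m, single i (proj i x)
  have hy : ∀ i, proj i y = if i ∈ s.image m then proj i x else 0 := fun i => by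
    rw [map_sum]
    split_ifs with hi
    · rw [Finset.sum_eq_single i, proj_single_self]
      · exact fun j _ hj => proj_single_ne hj.symm _
      · exact fun h => absurd hi h
    · exact Finset.sum_eq_zero fun j hj => proj_single_ne (fun e => hi (by rwa [e])) _
  have h1 : ∑ p ∈ s, ψ p (proj (m p) x) = partHom ψ horth s y :=
    Finset.sum_congr rfl fun p hp => by rw [hy, if_pos (Finset.mem_image_of_mem m hp)]
  rw [h1]
  refine (NonUnitalStarAlgHom.norm_apply_le _ y).trans (norm_le hr fun i => ?_)
  rw [hy]
  split_ifs with hi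
  · obtain ⟨p, hp, rfl⟩ := Finset.mem_image.mp hi
    exact h p hp
  · rwa [norm_zero]

theorem summable_desc (horth : ∀ p q, p ≠ q → ∀ x y, ψ p x * ψ q y = 0)
    (hfin : ∀ i, {p | m p = i}.Finite) (x : C0Sum 𝒜) : Summable fun p => ψ p (proj (m p) x) := by
  rw [summable_iff_vanishing_norm]
  intro ε hε
  have h1 : {i | ¬ ‖proj i x‖ < ε / 2}.Finite := by
    have h := (Metric.tendsto_nhds.mp (tendsto_proj x)) (ε / 2) (half_pos hε)
    simp only [Real.dist_eq, sub_zero, abs_norm] at h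
    exact h
  have h2 : {p | ¬ ‖proj (m p) x‖ < ε / 2}.Finite :=
    h1.preimage' (f := m) fun i _ => hfin i
  refine ⟨h2.toFinset, fun t ht => ?_⟩
  refine (norm_sum_le ψ horth t x (half_pos hε).le fun p hp => ?_).trans_lt (half_lt_self hε)
  by_contra hlt
  exact Finset.disjoint_left.mp ht hp (h2.mem_toFinset.mpr fun h => hlt h.le)

/-- The `*`-homomorphism `x ↦ ∑ p, ψ p (x (m p))` of the direct sum, for `*`-homomorphisms `ψ p`
with pairwise orthogonal ranges such that every summand occurs finitely often. -/
def desc (horth : ∀ p q, p ≠ q → ∀ x y, ψ p x * ψ q y = 0)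
    (hfin : ∀ i, {p | m p = i}.Finite) : C0Sum 𝒜 →⋆ₙₐ[ℂ] T :=
  have hs : ∀ x, HasSum (fun p => ψ p (proj (m p) x)) (∑' p, ψ p (proj (m p) x)) :=
    fun x => (summable_desc ψ horth hfin x).hasSum
  { toFun := fun x => ∑' p, ψ p (proj (m p) x)
    map_smul' := fun c x => (hs _).unique <| by
      simpa only [map_smul, MonoidHom.id_apply] using (hs x).const_smul c
    map_zero' := (hs _).unique <| by simpa only [map_zero] using hasSum_zero
    map_add' := fun x y => (hs _).unique <| by simpa only [map_add] using (hs x).add (hs y)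
    map_mul' := fun x y => tendsto_nhds_unique (hs (x * y)) <|
      (Tendsto.mul (hs x) (hs y)).congr fun s => sum_mul_sum ψ horth s x y
    map_star' := fun x => (hs _).unique <| by simpa only [map_star] using (hs x).star }

theorem hasSum_desc (horth : ∀ p q, p ≠ q → ∀ x y, ψ p x * ψ q y = 0)
    (hfin : ∀ i, {p | m p = i}.Finite) (x : C0Sum 𝒜) :
    HasSum (fun p => ψ p (proj (m p) x)) (desc ψ horth hfin x) :=
  (summable_desc ψ horth hfin x).hasSum

end Desc

end C0Sum

end C0

/-! ### The comultiplication of a direct sum over a monoid -/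

section System

/-- Every element has only finitely many factorizations into two factors. -/
class FiniteFactorizations (M : Type) [Mul M] : Prop where
  finite : ∀ c : M, {p : M × M | p.1 * p.2 = c}.Finite

variable {M : Type} {𝒜 : M → Type} [∀ a, NonUnitalCStarAlgebra (𝒜 a)]

theorem map_single_mul_map_single {p q : M × M} (h : p ≠ q) (x : MinTensor (𝒜 p.1) (𝒜 p.2))
    (y : MinTensor (𝒜 q.1) (𝒜 q.2)) :
    MinTensor.map (C0Sum.single (𝒜 := 𝒜) p.1) (C0Sum.single p.2) x *
      MinTensor.map (C0Sum.single (𝒜 := 𝒜) q.1) (C0Sum.single q.2) y = 0 := by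
  have hc : ∀ r : M × M,
      Continuous (MinTensor.map (C0Sum.single (𝒜 := 𝒜) r.1) (C0Sum.single (𝒜 := 𝒜) r.2)) :=
    fun r => AddMonoidHomClass.continuous_of_bound _ 1 fun z => by
      rw [one_mul]; exact NonUnitalStarAlgHom.norm_apply_le _ z
  refine MinTensor.induction x ?_ ?_ ?_ ?_
  · exact isClosed_eq ((hc p).mul continuous_const) continuous_const
  · intro x x' hx hx'; rw [map_add, add_mul, hx, hx', add_zero]
  · rw [map_zero, zero_mul]
  intro a b
  refine MinTensor.induction y ?_ ?_ ?_ ?_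
  · exact isClosed_eq (continuous_const.mul (hc q)) continuous_const
  · intro y y' hy hy'; rw [map_add, mul_add, hy, hy', add_zero]
  · rw [map_zero, mul_zero]
  intro a' b'
  rw [MinTensor.map_tmul, MinTensor.map_tmul, MinTensor.tmul_mul_tmul]
  rcases eq_or_ne p.1 q.1 with h1 | h1
  · have h2 : p.2 ≠ q.2 := fun h2 => h (Prod.ext h1 h2)
    rw [C0Sum.single_mul_single_ne h2, MinTensor.tmul, TensorProduct.tmul_zero, map_zero]
  · rw [C0Sum.single_mul_single_ne h1, MinTensor.tmul, TensorProduct.zero_tmul, map_zero]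

variable [Mul M] [FiniteFactorizations M]
  (φ : ∀ a b, 𝒜 (a * b) →⋆ₙₐ[ℂ] MinTensor (𝒜 a) (𝒜 b))

/-- The homomorphism `φ a b`, with values in the tensor square of the direct sum. -/
def sumComulPart (p : M × M) : 𝒜 (p.1 * p.2) →⋆ₙₐ[ℂ] MinTensor (C0Sum 𝒜) (C0Sum 𝒜) :=
  (MinTensor.map (C0Sum.single p.1) (C0Sum.single p.2)).comp (φ p.1 p.2)

theorem sumComulPart_orthogonal (p q : M × M) (h : p ≠ q) (x : 𝒜 (p.1 * p.2))
    (y : 𝒜 (q.1 * q.2)) : sumComulPart φ p x * sumComulPart φ q y = 0 :=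
  map_single_mul_map_single h (φ p.1 p.2 x) (φ q.1 q.2 y)

/-- For `*`-homomorphisms `φ a b : 𝒜 (a * b) → 𝒜 a ⊗ 𝒜 b`, the `*`-homomorphism
`Δ x = ∑_{a, b} φ a b (x (a * b))` of the direct sum of the `𝒜 a` to its tensor square. -/
def sumComul : C0Sum 𝒜 →⋆ₙₐ[ℂ] MinTensor (C0Sum 𝒜) (C0Sum 𝒜) :=
  C0Sum.desc (m := fun p : M × M => p.1 * p.2) (sumComulPart φ) (sumComulPart_orthogonal φ)
    FiniteFactorizations.finite

theorem hasSum_sumComul (x : C0Sum 𝒜) :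
    HasSum (fun p : M × M => sumComulPart φ p (C0Sum.proj (p.1 * p.2) x)) (sumComul φ x) :=
  C0Sum.hasSum_desc (m := fun p : M × M => p.1 * p.2) (sumComulPart φ)
    (sumComulPart_orthogonal φ) FiniteFactorizations.finite x

end System

/-! ### C*-bialgebras -/

section Bialgebra

variable {A B : Type} [NonUnitalCStarAlgebra A] [NonUnitalCStarAlgebra B]

variable (A) in
/-- The graph of the canonical identification of `(A ⊗ A) ⊗ A` and `A ⊗ (A ⊗ A)`, which is the
closure of the graph of `(a ⊗ b) ⊗ c ↦ a ⊗ (b ⊗ c)` on the algebraic tensor product. -/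
def assocGraph :
    Set (MinTensor (MinTensor A A) A × MinTensor A (MinTensor A A)) :=
  closure (Set.range fun t : (A ⊗[ℂ] A) ⊗[ℂ] A =>
    (MinTensor.ofAlg (TensorProduct.map MinTensor.ofAlgLinear LinearMap.id t),
      MinTensor.ofAlg (TensorProduct.map LinearMap.id MinTensor.ofAlgLinear
        (TensorProduct.assoc ℂ A A A t))))

/-- A strictly proper C*-bialgebra: a coassociative `*`-homomorphism `Δ : A → A ⊗ A` such that the
elements `Δ(a)(b ⊗ c)` span a dense subspace of `A ⊗ A`. -/
structure IsCStarBialgebra (Δ : A →⋆ₙₐ[ℂ] MinTensor A A) : Prop where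
  dense : Dense (Submodule.span ℂ
    (Set.range fun t : A × A × A => Δ t.1 * MinTensor.tmul t.2.1 t.2.2) : Set (MinTensor A A))
  coassoc : ∀ a, (MinTensor.map Δ (NonUnitalStarAlgHom.id ℂ A) (Δ a),
    MinTensor.map (NonUnitalStarAlgHom.id ℂ A) Δ (Δ a)) ∈ assocGraph A

/-- A counital C*-bialgebra: the counit `ε` satisfies `(ε ⊗ id) Δ(a) = 1 ⊗ a` in `ℂ ⊗ A` and
`(id ⊗ ε) Δ(a) = a ⊗ 1` in `A ⊗ ℂ`. -/
structure IsCounitalCStarBialgebra (Δ : A →⋆ₙₐ[ℂ] MinTensor A A) (ε : A →⋆ₙₐ[ℂ] ℂ) : Prop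
    extends IsCStarBialgebra Δ where
  counit_left : ∀ a, MinTensor.map ε (NonUnitalStarAlgHom.id ℂ A) (Δ a) = MinTensor.tmul 1 a
  counit_right : ∀ a, MinTensor.map (NonUnitalStarAlgHom.id ℂ A) ε (Δ a) = MinTensor.tmul a 1

/-- `f` intertwines the comultiplications. -/
def Intertwines (f : A →⋆ₙₐ[ℂ] B) (Δ : A →⋆ₙₐ[ℂ] MinTensor A A)
    (Δ' : B →⋆ₙₐ[ℂ] MinTensor B B) : Prop :=
  ∀ a, Δ' (f a) = MinTensor.map f f (Δ a)

end Bialgebra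

section SubBialgebra

variable {A : Type} [CStarAlgebra A]

/-- A unital counital bialgebra `𝔅` (in the algebraic sense, with coproduct in the algebraic
tensor product `𝔅 ⊗ 𝔅`), which is mapped to the unital C*-bialgebra `(A, Δ, ε)` by the unital
algebra homomorphism `j` compatibly with comultiplications and counits. -/
structure IsSubbialgebra (Δ : A →⋆ₙₐ[ℂ] MinTensor A A) (ε : A →⋆ₙₐ[ℂ] ℂ)
    {𝔅 : Type} [Ring 𝔅] [Algebra ℂ 𝔅] [Coalgebra ℂ 𝔅] (j : 𝔅 →ₐ[ℂ] A) : Prop where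
  injective : Function.Injective j
  comul_one : Coalgebra.comul (R := ℂ) (1 : 𝔅) = 1
  comul_mul : ∀ x y : 𝔅, Coalgebra.comul (R := ℂ) (x * y) =
    Coalgebra.comul (R := ℂ) x * Coalgebra.comul (R := ℂ) y
  counit_one : Coalgebra.counit (R := ℂ) (1 : 𝔅) = 1
  counit_mul : ∀ x y : 𝔅, Coalgebra.counit (R := ℂ) (x * y) =
    Coalgebra.counit (R := ℂ) x * Coalgebra.counit (R := ℂ) y
  map_comul : ∀ x : 𝔅, MinTensor.ofAlg
    (TensorProduct.map j.toLinearMap j.toLinearMap (Coalgebra.comul (R := ℂ) x)) = Δ (j x)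
  map_counit : ∀ x : 𝔅, Coalgebra.counit (R := ℂ) x = ε (j x)

/-- A linear endomorphism `S` is an antipode: `m (S ⊗ id) Δ = η ε = m (id ⊗ S) Δ`. -/
def IsAntipode {𝔅 : Type} [Ring 𝔅] [Algebra ℂ 𝔅] [Coalgebra ℂ 𝔅] (S : 𝔅 →ₗ[ℂ] 𝔅) : Prop :=
  ∀ x : 𝔅, LinearMap.mul' ℂ 𝔅 (S.rTensor 𝔅 (Coalgebra.comul (R := ℂ) x)) =
      algebraMap ℂ 𝔅 (Coalgebra.counit (R := ℂ) x) ∧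
    LinearMap.mul' ℂ 𝔅 (S.lTensor 𝔅 (Coalgebra.comul (R := ℂ) x)) =
      algebraMap ℂ 𝔅 (Coalgebra.counit (R := ℂ) x)

end SubBialgebra

/-! ### Cuntz-Krieger algebras and Cuntz algebras -/

/-- Nondegenerate `0`-`1` matrices: square matrices of any positive size with entries `0` and `1`
which have neither a row nor a column equal to zero. -/
structure NDMat where
  /-- The size of the matrix. -/
  n : ℕ
  pos : 0 < n
  /-- The entries. -/
  mat : Matrix (Fin n) (Fin n) ℕ
  zero_or_one : ∀ i j, mat i j = 0 ∨ mat i j = 1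
  row_ne_zero : ∀ i, ∃ j, mat i j ≠ 0
  col_ne_zero : ∀ j, ∃ i, mat i j ≠ 0

namespace NDMat

/-- The product of the monoid is the Kronecker product of matrices: the index
`(i, j) : Fin n × Fin m` corresponds to `m * i + j : Fin (n * m)`. -/
instance : Mul NDMat where
  mul A B :=
    { n := A.n * B.n
      pos := Nat.mul_pos A.pos B.pos
      mat := Matrix.reindex finProdFinEquiv finProdFinEquiv
        (Matrix.kroneckerMap (fun a b => a * b) A.mat B.mat)
      zero_or_one := fun i j => by
        change A.mat _ _ * B.mat _ _ = 0 ∨ A.mat _ _ * B.mat _ _ = 1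
        rcases A.zero_or_one (finProdFinEquiv.symm i).1 (finProdFinEquiv.symm j).1 with h | h
        · rw [h, zero_mul]; exact Or.inl rfl
        · rw [h, one_mul]; exact B.zero_or_one _ _
      row_ne_zero := fun i => by
        obtain ⟨j, hj⟩ := A.row_ne_zero (finProdFinEquiv.symm i).1
        obtain ⟨k, hk⟩ := B.row_ne_zero (finProdFinEquiv.symm i).2
        refine ⟨finProdFinEquiv (j, k), ?_⟩
        change A.mat _ _ * B.mat _ _ ≠ 0
        rw [Equiv.symm_apply_apply]
        exact mul_ne_zero hj hk
      col_ne_zero := fun i => by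
        obtain ⟨j, hj⟩ := A.col_ne_zero (finProdFinEquiv.symm i).1
        obtain ⟨k, hk⟩ := B.col_ne_zero (finProdFinEquiv.symm i).2
        refine ⟨finProdFinEquiv (j, k), ?_⟩
        change A.mat _ _ * B.mat _ _ ≠ 0
        rw [Equiv.symm_apply_apply]
        exact mul_ne_zero hj hk }

/-- The `n × n` matrix all of whose entries are `1`. -/
def allOnes (n : ℕ+) : NDMat where
  n := n
  pos := n.pos
  mat := fun _ _ => 1
  zero_or_one := fun _ _ => Or.inr rfl
  row_ne_zero := fun i => ⟨i, one_ne_zero⟩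
  col_ne_zero := fun i => ⟨i, one_ne_zero⟩

theorem finite_n_le (N : ℕ) : {A : NDMat | A.n ≤ N}.Finite := by
  classical
  let f : {A : NDMat | A.n ≤ N} → Σ n : Fin (N + 1), (Fin n → Fin n → Bool) :=
    fun A => ⟨⟨A.1.n, Nat.lt_succ_of_le A.2⟩, fun i j => decide (A.1.mat i j = 1)⟩
  have hf : Function.Injective f := by
    rintro ⟨⟨n, hn, a, ha, ha1, ha2⟩, hA⟩ ⟨⟨m, hm, b, hb, hb1, hb2⟩, hB⟩ h
    obtain ⟨h1, h2⟩ := Sigma.mk.inj h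
    obtain rfl : n = m := congrArg Fin.val h1
    have h3 := eq_of_heq h2
    have h4 : a = b := by
      funext i j
      have h5 : decide (a i j = 1) = decide (b i j = 1) := congrFun (congrFun h3 i) j
      rw [decide_eq_decide] at h5
      rcases ha i j with h6 | h6 <;> rcases hb i j with h7 | h7 <;> simp_all
    subst h4
    rfl
  have := Finite.of_injective f hf
  exact Set.toFinite _

instance : FiniteFactorizations NDMat where
  finite C := by
    refine ((finite_n_le C.n).prod (finite_n_le C.n)).subset ?_
    rintro ⟨A, B⟩ h
    have h1 : A.n * B.n = C.n := congrArg NDMat.n h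
    exact ⟨h1 ▸ Nat.le_mul_of_pos_right A.n B.pos, h1 ▸ Nat.le_mul_of_pos_left B.n A.pos⟩

end NDMat

instance : FiniteFactorizations ℕ+ where
  finite c := by
    refine ((Set.finite_Iic c).prod (Set.finite_Iic c)).subset ?_
    rintro ⟨a, b⟩ h
    have h1 : a * b = c := h
    exact ⟨h1 ▸ le_mul_of_one_le_right' (one_le (a := b)),
      h1 ▸ le_mul_of_one_le_left' (one_le (a := a))⟩

theorem norm_le_one_of_mul_star_mul {B : Type} [CStarAlgebra B] {s : B}
    (h : s * star s * s - s = 0) : ‖s‖ ≤ 1 := by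
  have h1 : star s * s * (star s * s) = star s * s := by
    rw [sub_eq_zero] at h
    calc star s * s * (star s * s) = star s * (s * star s * s) := by simp only [mul_assoc]
      _ = star s * s := by rw [h]
  have h2 : ‖star s * s‖ * ‖star s * s‖ = ‖star s * s‖ := by
    have h3 := CStarRing.norm_star_mul_self (x := star s * s)
    rwa [star_mul, star_star, h1, eq_comm] at h3
  rw [CStarRing.norm_star_mul_self] at h2
  by_contra hlt
  push Not at hlt
  have h3 := mul_left_cancel₀ (mul_pos (zero_lt_one.trans hlt) (zero_lt_one.trans hlt)).ne'
    (h2.trans (mul_one _).symm)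
  nlinarith

/-- The relations `p = 0` of the Cuntz-Krieger algebra of `A`, for generators `s i`: every `s i` is
a partial isometry, `s i* s i = ∑ j, A i j • s j s j*`, and `∑ i, s i s i* = 1`. For `A = (1)` there
is the additional relation `s = 1`, so that the algebra is `ℂ`. -/
inductive CKRel (A : NDMat) : FreeStar (Fin A.n) → Prop
  | partialIsometry (i : Fin A.n) : CKRel A
      (FreeStar.gen i * star (FreeStar.gen i) * FreeStar.gen i - FreeStar.gen i)
  | source (i : Fin A.n) : CKRel A (star (FreeStar.gen i) * FreeStar.gen i -
      ∑ j, (A.mat i j : ℂ) • (FreeStar.gen j * star (FreeStar.gen j)))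
  | sum_range : CKRel A (∑ i, FreeStar.gen i * star (FreeStar.gen i) - 1)
  | size_one (h : A.n = 1) (i : Fin A.n) : CKRel A (FreeStar.gen i - 1)

/-- The relations of the Cuntz-Krieger algebra of `A`. -/
def ckRelations (A : NDMat) : CStarRelations (Fin A.n) where
  rel := {p | CKRel A p}
  norm_le B _ s hs i := norm_le_one_of_mul_star_mul <| by
    simpa only [map_sub, map_mul, map_star, FreeStar.eval_gen] using
      hs _ (CKRel.partialIsometry i)

/-- The Cuntz-Krieger algebra of `A`. -/
abbrev CuntzKrieger (A : NDMat) : Type := (ckRelations A).Univ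

/-- The canonical generators of the Cuntz-Krieger algebra. -/
def ckGen (A : NDMat) (i : Fin A.n) : CuntzKrieger A := CStarRelations.Univ.gen (ckRelations A) i

/-- The relations `p = 0` of the Cuntz algebra with `n` generators `s i`: every `s i` is an
isometry, and `∑ i, s i s i* = 1`. For `n = 1` there is the additional relation `s = 1`, so that the
algebra is `ℂ`. -/
inductive CuntzRel (n : ℕ+) : FreeStar (Fin n) → Prop
  | isometry (i : Fin n) : CuntzRel n (star (FreeStar.gen i) * FreeStar.gen i - 1)
  | sum_range : CuntzRel n (∑ i, FreeStar.gen i * star (FreeStar.gen i) - 1)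
  | size_one (h : n = 1) (i : Fin n) : CuntzRel n (FreeStar.gen i - 1)

/-- The relations of the Cuntz algebra. -/
def cuntzRelations (n : ℕ+) : CStarRelations (Fin n) where
  rel := {p | CuntzRel n p}
  norm_le B _ s hs i := norm_le_one_of_mul_star_mul <| by
    have h := hs _ (CuntzRel.isometry i)
    simp only [map_sub, map_mul, map_star, FreeStar.eval_gen, map_one, sub_eq_zero] at h
    rw [mul_assoc, h, mul_one, sub_self]

/-- The Cuntz algebra with `n` generators; it is `ℂ` for `n = 1`. -/
abbrev Cuntz (n : ℕ+) : Type := (cuntzRelations n).Univ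

/-- The canonical generators of the Cuntz algebra. -/
def cuntzGen (n : ℕ+) (i : Fin n) : Cuntz n := CStarRelations.Univ.gen (cuntzRelations n) i

section Phi

variable {A B : Type} [CStarAlgebra A] [CStarAlgebra B] {n m : ℕ}

theorem tmul_sum_sum {ι κ : Type} [Fintype ι] [Fintype κ] (f : ι → A) (g : κ → B) :
    MinTensor.tmul (∑ i, f i) (∑ j, g j) = ∑ i, ∑ j, MinTensor.tmul (f i) (g j) := by
  rw [MinTensor.tmul, TensorProduct.sum_tmul, map_sum]
  simp only [TensorProduct.tmul_sum, map_sum]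

theorem tmul_smul_smul (c d : ℂ) (a : A) (b : B) :
    MinTensor.tmul (c • a) (d • b) = (c * d) • MinTensor.tmul a b := by
  rw [MinTensor.tmul, TensorProduct.smul_tmul_smul, map_smul]

/-- The family of the `s i ⊗ t j`, with `(i, j)` numbered as `m * i + j`. -/
def tensorFamily (s : Fin n → A) (t : Fin m → B) (k : Fin (n * m)) : MinTensor A B :=
  MinTensor.tmul (s (finProdFinEquiv.symm k).1) (t (finProdFinEquiv.symm k).2)

theorem tensorFamily_partialIsometry {s : Fin n → A} {t : Fin m → B}
    (hs : ∀ i, s i * star (s i) * s i = s i) (ht : ∀ i, t i * star (t i) * t i = t i)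
    (k : Fin (n * m)) : tensorFamily s t k * star (tensorFamily s t k) * tensorFamily s t k =
      tensorFamily s t k := by
  simp only [tensorFamily, MinTensor.star_tmul, MinTensor.tmul_mul_tmul, hs, ht]

theorem tensorFamily_star_mul_self (s : Fin n → A) (t : Fin m → B) (k : Fin (n * m)) :
    star (tensorFamily s t k) * tensorFamily s t k =
      MinTensor.tmul (star (s (finProdFinEquiv.symm k).1) * s (finProdFinEquiv.symm k).1)
        (star (t (finProdFinEquiv.symm k).2) * t (finProdFinEquiv.symm k).2) := by
  simp only [tensorFamily, MinTensor.star_tmul, MinTensor.tmul_mul_tmul]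

theorem sum_tensorFamily (s : Fin n → A) (t : Fin m → B) (a : Fin n → ℂ) (b : Fin m → ℂ) :
    ∑ k : Fin (n * m), (a (finProdFinEquiv.symm k).1 * b (finProdFinEquiv.symm k).2) •
        (tensorFamily s t k * star (tensorFamily s t k)) =
      MinTensor.tmul (∑ i, a i • (s i * star (s i))) (∑ j, b j • (t j * star (t j))) := by
  rw [tmul_sum_sum, ← Fintype.sum_prod_type', ← finProdFinEquiv.symm.sum_comp]
  refine Finset.sum_congr rfl fun k _ => ?_
  simp only [tensorFamily, MinTensor.star_tmul, MinTensor.tmul_mul_tmul, tmul_smul_smul]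

theorem sum_tensorFamily_one {s : Fin n → A} {t : Fin m → B}
    (hs : ∑ i, s i * star (s i) = 1) (ht : ∑ i, t i * star (t i) = 1) :
    ∑ k, tensorFamily s t k * star (tensorFamily s t k) = 1 := by
  have h := sum_tensorFamily s t (fun _ => 1) (fun _ => 1)
  simp only [mul_one, one_smul, hs, ht] at h
  exact h

end Phi

section CK

theorem ckGen_partialIsometry (A : NDMat) (i : Fin A.n) :
    ckGen A i * star (ckGen A i) * ckGen A i = ckGen A i := by
  have h := CStarRelations.Univ.gen_rel (ckRelations A) _ (CKRel.partialIsometry i)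
  simp only [map_sub, map_mul, map_star, FreeStar.eval_gen, sub_eq_zero] at h
  exact h

theorem ckGen_source (A : NDMat) (i : Fin A.n) : star (ckGen A i) * ckGen A i =
    ∑ j, (A.mat i j : ℂ) • (ckGen A j * star (ckGen A j)) := by
  have h := CStarRelations.Univ.gen_rel (ckRelations A) _ (CKRel.source i)
  simp only [map_sub, map_mul, map_star, map_sum, map_smul, FreeStar.eval_gen, sub_eq_zero] at h
  exact h

theorem ckGen_sum_range (A : NDMat) : ∑ i, ckGen A i * star (ckGen A i) = 1 := by
  have h := CStarRelations.Univ.gen_rel (ckRelations A) _ CKRel.sum_range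
  simp only [map_sub, map_mul, map_star, map_sum, map_one, FreeStar.eval_gen, sub_eq_zero] at h
  exact h

theorem ckGen_size_one (A : NDMat) (h : A.n = 1) (i : Fin A.n) : ckGen A i = 1 := by
  have h := CStarRelations.Univ.gen_rel (ckRelations A) _ (CKRel.size_one h i)
  simp only [map_sub, map_one, FreeStar.eval_gen, sub_eq_zero] at h
  exact h

theorem ckPhi_rel (A B : NDMat) : ∀ p ∈ (ckRelations (A * B)).rel,
    FreeStar.eval (tensorFamily (ckGen A) (ckGen B)) p = 0 := by
  rintro _ (i | i | _ | ⟨h, i⟩)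
  · simp only [map_sub, map_mul, map_star, FreeStar.eval_gen, sub_eq_zero]
    exact tensorFamily_partialIsometry (ckGen_partialIsometry A) (ckGen_partialIsometry B) i
  · simp only [map_sub, map_mul, map_star, map_sum, map_smul, FreeStar.eval_gen, sub_eq_zero]
    refine (tensorFamily_star_mul_self _ _ i).trans ?_
    rw [ckGen_source, ckGen_source]
    refine (sum_tensorFamily _ _ _ _).symm.trans (Finset.sum_congr rfl fun k _ => ?_)
    rw [← Nat.cast_mul]
    rfl
  · simp only [map_sub, map_mul, map_star, map_sum, map_one, FreeStar.eval_gen, sub_eq_zero]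
    exact sum_tensorFamily_one (ckGen_sum_range A) (ckGen_sum_range B)
  · simp only [map_sub, map_one, FreeStar.eval_gen, sub_eq_zero]
    have hm : A.n * B.n = 1 := h
    rw [tensorFamily, ckGen_size_one A (Nat.eq_one_of_mul_eq_one_right hm),
      ckGen_size_one B (Nat.eq_one_of_mul_eq_one_left hm)]
    rfl

/-- The `*`-homomorphism `φ_{A,B} : O_{A ⊠ B} → O_A ⊗ O_B` with
`φ_{A,B}(s_{m i + j}) = s_i ⊗ s_j`. -/
def ckPhi (A B : NDMat) : CuntzKrieger (A * B) →⋆ₙₐ[ℂ] MinTensor (CuntzKrieger A) (CuntzKrieger B) :=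
  CStarRelations.Univ.lift (tensorFamily (ckGen A) (ckGen B)) (ckPhi_rel A B)

theorem ckPhi_gen (A B : NDMat) (i : Fin A.n) (j : Fin B.n) :
    ckPhi A B (ckGen (A * B) (finProdFinEquiv (i, j))) =
      MinTensor.tmul (ckGen A i) (ckGen B j) := by
  refine (CStarRelations.Univ.lift_gen _ _ _).trans ?_
  rw [tensorFamily, Equiv.symm_apply_apply]

/-- The direct sum of all Cuntz-Krieger algebras. -/
abbrev CKStar : Type := C0Sum CuntzKrieger

/-- The comultiplication of the direct sum of all Cuntz-Krieger algebras. -/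
def ckComul : CKStar →⋆ₙₐ[ℂ] MinTensor CKStar CKStar := sumComul ckPhi

theorem ckCounit_rel : ∀ p ∈ (ckRelations (NDMat.allOnes 1)).rel,
    FreeStar.eval (fun _ => (1 : ℂ)) p = 0 := by
  have hn : ∀ i j : Fin (NDMat.allOnes 1).n, (NDMat.allOnes 1).mat i j = 1 := fun _ _ => rfl
  have hc : Finset.card (Finset.univ : Finset (Fin (NDMat.allOnes 1).n)) = 1 :=
    Finset.card_fin _
  rintro _ (i | i | _ | ⟨h, i⟩)
  · simp only [map_sub, map_mul, map_star, FreeStar.eval_gen, star_one, mul_one, sub_self]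
  · simp only [map_sub, map_mul, map_star, map_sum, FreeStar.eval_gen, star_one, mul_one,
      hn, Nat.cast_one, one_smul, Finset.sum_const, hc, sub_self]
  · simp only [map_sub, map_mul, map_star, map_sum, map_one, FreeStar.eval_gen, star_one, mul_one,
      Finset.sum_const, hc, one_smul, sub_self]
  · simp only [map_sub, map_one, FreeStar.eval_gen, sub_self]

/-- The counit of the direct sum of all Cuntz-Krieger algebras: the identification of the
Cuntz-Krieger algebra of the matrix `(1)` with `ℂ`, and zero on the other summands. -/
def ckCounit : CKStar →⋆ₙₐ[ℂ] ℂ :=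
  (CStarRelations.Univ.lift (R := ckRelations (NDMat.allOnes 1)) (fun _ => (1 : ℂ))
    ckCounit_rel).comp (C0Sum.proj (NDMat.allOnes 1))

end CK

section Cuntz

theorem cuntzGen_isometry (n : ℕ+) (i : Fin n) : star (cuntzGen n i) * cuntzGen n i = 1 := by
  have h := CStarRelations.Univ.gen_rel (cuntzRelations n) _ (CuntzRel.isometry i)
  simp only [map_sub, map_mul, map_star, map_one, FreeStar.eval_gen, sub_eq_zero] at h
  exact h

theorem cuntzGen_sum_range (n : ℕ+) : ∑ i, cuntzGen n i * star (cuntzGen n i) = 1 := by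
  have h := CStarRelations.Univ.gen_rel (cuntzRelations n) _ CuntzRel.sum_range
  simp only [map_sub, map_mul, map_star, map_sum, map_one, FreeStar.eval_gen, sub_eq_zero] at h
  exact h

theorem cuntzGen_size_one (n : ℕ+) (h : n = 1) (i : Fin n) : cuntzGen n i = 1 := by
  have h := CStarRelations.Univ.gen_rel (cuntzRelations n) _ (CuntzRel.size_one h i)
  simp only [map_sub, map_one, FreeStar.eval_gen, sub_eq_zero] at h
  exact h

/-- The family of the `s i ⊗ s j` in `O_n ⊗ O_m`, with `(i, j)` numbered as `m * i + j`. -/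
def cuntzFamily (n m : ℕ+) (k : Fin (n * m : ℕ+)) : MinTensor (Cuntz n) (Cuntz m) :=
  tensorFamily (cuntzGen n) (cuntzGen m) (Fin.cast (PNat.mul_coe n m) k)

theorem cuntzPhi_rel (n m : ℕ+) : ∀ p ∈ (cuntzRelations (n * m)).rel,
    FreeStar.eval (cuntzFamily n m) p = 0 := by
  rintro _ (i | _ | ⟨h, i⟩)
  · simp only [map_sub, map_mul, map_star, map_one, FreeStar.eval_gen, sub_eq_zero]
    refine (tensorFamily_star_mul_self _ _ (Fin.cast (PNat.mul_coe n m) i)).trans ?_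
    rw [cuntzGen_isometry, cuntzGen_isometry]
    rfl
  · simp only [map_sub, map_mul, map_star, map_sum, map_one, FreeStar.eval_gen, sub_eq_zero]
    refine Eq.trans ?_ (sum_tensorFamily_one (cuntzGen_sum_range n) (cuntzGen_sum_range m))
    exact (finCongr (PNat.mul_coe n m)).sum_comp fun k =>
      tensorFamily (cuntzGen n) (cuntzGen m) k * star (tensorFamily (cuntzGen n) (cuntzGen m) k)
  · simp only [map_sub, map_one, FreeStar.eval_gen, sub_eq_zero]
    have hm : (n : ℕ) * (m : ℕ) = 1 := congrArg PNat.val h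
    rw [cuntzFamily, tensorFamily,
      cuntzGen_size_one n (PNat.eq (Nat.eq_one_of_mul_eq_one_right hm)),
      cuntzGen_size_one m (PNat.eq (Nat.eq_one_of_mul_eq_one_left hm))]
    rfl

/-- The `*`-homomorphism `φ_{n,m} : O_{nm} → O_n ⊗ O_m` with `φ_{n,m}(s_{m i + j}) = s_i ⊗ s_j`. -/
def cuntzPhi (n m : ℕ+) : Cuntz (n * m) →⋆ₙₐ[ℂ] MinTensor (Cuntz n) (Cuntz m) :=
  CStarRelations.Univ.lift (R := cuntzRelations (n * m)) (cuntzFamily n m) (cuntzPhi_rel n m)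

theorem cuntzPhi_gen (n m : ℕ+) (i : Fin n) (j : Fin m) :
    cuntzPhi n m (cuntzGen (n * m) (Fin.cast (PNat.mul_coe n m).symm (finProdFinEquiv (i, j)))) =
      MinTensor.tmul (cuntzGen n i) (cuntzGen m j) := by
  refine (CStarRelations.Univ.lift_gen _ _ _).trans ?_
  rw [cuntzFamily, Fin.cast_cast, Fin.cast_eq_self, tensorFamily, Equiv.symm_apply_apply]

/-- The direct sum of all Cuntz algebras. -/
abbrev CuntzStar : Type := C0Sum Cuntz

/-- The comultiplication of the direct sum of all Cuntz algebras. -/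
def cuntzComul : CuntzStar →⋆ₙₐ[ℂ] MinTensor CuntzStar CuntzStar := sumComul cuntzPhi

theorem cuntzCounit_rel : ∀ p ∈ (cuntzRelations 1).rel,
    FreeStar.eval (fun _ => (1 : ℂ)) p = 0 := by
  have hc : Finset.card (Finset.univ : Finset (Fin (1 : ℕ+))) = 1 := Finset.card_fin _
  rintro _ (i | _ | ⟨h, i⟩)
  · simp only [map_sub, map_mul, map_star, map_one, FreeStar.eval_gen, star_one, mul_one, sub_self]
  · simp only [map_sub, map_mul, map_star, map_sum, map_one, FreeStar.eval_gen, star_one, mul_one,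
      Finset.sum_const, hc, one_smul, sub_self]
  · simp only [map_sub, map_one, FreeStar.eval_gen, sub_self]

/-- The counit of the direct sum of all Cuntz algebras: the identification of the Cuntz algebra
with one generator with `ℂ`, and zero on the other summands. -/
def cuntzCounit : CuntzStar →⋆ₙₐ[ℂ] ℂ :=
  (CStarRelations.Univ.lift (R := cuntzRelations 1) (fun _ => (1 : ℂ))
    cuntzCounit_rel).comp (C0Sum.proj 1)

end Cuntz

/-! ### The unitization and the bialgebra of the Cuntz summands -/

/-- The minimal unitization of the direct sum of all Cuntz-Krieger algebras. -/
abbrev CKTilde : Type := Unitization ℂ CKStar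

/-- The inclusion of the direct sum of all Cuntz-Krieger algebras into its unitization. -/
def toCKTilde : CKStar →⋆ₙₐ[ℂ] CKTilde := Unitization.inrNonUnitalStarAlgHom ℂ CKStar

/-- The unital `*`-subalgebra of the unitization generated (algebraically) by the canonical
generators of all Cuntz-Krieger algebras. -/
def ckAlgebraic : StarSubalgebra ℂ CKTilde :=
  StarAlgebra.adjoin ℂ
    (Set.range fun p : Σ A : NDMat, Fin A.n => toCKTilde (C0Sum.single p.1 (ckGen p.1 p.2)))

/-- The direct sum of the Cuntz-Krieger algebras of the all-ones matrices, as a `*`-subalgebra of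
the direct sum of all Cuntz-Krieger algebras. -/
def cuntzPartSubalgebra : NonUnitalStarSubalgebra ℂ CKStar where
  carrier := {x | ∀ A : NDMat, (∀ n, A ≠ NDMat.allOnes n) → C0Sum.proj A x = 0}
  zero_mem' A _ := map_zero (C0Sum.proj A)
  add_mem' {x y} hx hy A hA := by rw [map_add, hx A hA, hy A hA, add_zero]
  mul_mem' {x y} hx hy A hA := by rw [map_mul, hx A hA, zero_mul]
  smul_mem' c x hx A hA := by rw [map_smul, hx A hA, smul_zero]
  star_mem' {x} hx A hA := by rw [map_star, hx A hA, star_zero]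

instance : IsClosed (cuntzPartSubalgebra : Set CKStar) := by
  have h : (cuntzPartSubalgebra : Set CKStar) =
      ⋂ (A : NDMat) (_ : ∀ n, A ≠ NDMat.allOnes n), {x | C0Sum.proj A x = 0} := by
    ext x
    simp only [Set.mem_iInter]
    exact Iff.rfl
  rw [h]
  refine isClosed_iInter fun A => isClosed_iInter fun _ => isClosed_eq ?_ continuous_const
  exact AddMonoidHomClass.continuous_of_bound (C0Sum.proj A) 1 fun z => by
    rw [one_mul]; exact NonUnitalStarAlgHom.norm_apply_le _ z

/-- The direct sum of the Cuntz-Krieger algebras of the all-ones matrices. -/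
def CuntzPart : Type := cuntzPartSubalgebra

instance : NonUnitalCStarAlgebra CuntzPart :=
  NonUnitalStarSubalgebra.nonUnitalCStarAlgebra cuntzPartSubalgebra

/-- The inclusion of the direct sum of the Cuntz-Krieger algebras of the all-ones matrices into the
direct sum of all Cuntz-Krieger algebras. -/
def CuntzPart.incl : CuntzPart →⋆ₙₐ[ℂ] CKStar where
  toFun x := x.1
  map_smul' _ _ := rfl
  map_zero' := rfl
  map_add' _ _ := rfl
  map_mul' _ _ := rfl
  map_star' _ := rfl

end

/-!
# The bialgebra of all Cuntz-Krieger algebras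

The pairs `(A, i)` of a matrix `A` and an index `i` of a generator form a monoid `X` with finite
factorizations, and the comultiplication of the direct sum of all Cuntz-Krieger algebras is dual to
it on generators: `Δ (s x) = ∑ s y ⊗ s z`, the sum running over all factorizations `x = y z` in `X`
(`sumComul_isFactorizationComul`). Since two `*`-homomorphisms which agree on generators are equal,
and since the graph of the associativity isomorphism is the closure of a `*`-subalgebra, the
coassociative and counital laws need only be checked on generators, where they are the
associative and unit laws of `X` (`IsFactorizationComul.coassoc`,
`IsFactorizationComul.counit_left`). The comultiplication of the unitization is the unital
extension; it is strictly proper because it is unital.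

The formula on generators and its adjoint show that the algebra generated by the `s x` is mapped to
its algebraic tensor square. This square embeds into the minimal tensor product: states separate
the points of a C*-algebra (by separating a point from the closed cone of positive elements), so
matrix coefficients of GNS representations do, and so the minimal seminorm is a norm
(`MinTensor.ofAlg_injective`). Thus the restricted comultiplication has values in the algebraic
tensor square, and again the coalgebra laws are checked on generators
(`IsFactorizationComul.bialgebra`).

The obstruction to an antipode is the character `ω (x + c 1) = c` of the unitization. It is
absorbing, `(id ⊗ ω) Δ (a) = ω (a) 1`. An antipode `S` of a dense subbialgebra would make `ω`
invertible for convolution: applying `ω` to `m (S ⊗ id) Δ (b) = ε (b) 1` gives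
`ω (b) ω (S 1) = ε (b)`, hence `ω = ε` on a dense set, hence everywhere (`eq_counit_of_antipode`).
But `ω` vanishes on the summand of the matrix `(1)`, and `ε` does not.

A Kronecker product is an all-ones matrix only if both factors are, so the all-ones indices are
closed under factors in `X`. Therefore the summands of the all-ones matrices carry the
comultiplication of the direct sum of the Cuntz algebras (`IsFactorizationComul.intertwines`); their
generators satisfy the same relations. There the density axiom holds because the unit of the summand
of `n m` is mapped to an element which acts as the identity on `O_n ⊗ O_m`.
-/


/-! ### Separation of points by states and representations -/

section Separation

open scoped ComplexOrder

/-- A nonzero positive element is not annihilated by some positive functional: a real functional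
which separates `-b` from the closed cone of positive elements, made complex linear. -/
theorem exists_positiveLinearMap_ne_zero {A : Type} [CStarAlgebra A] [PartialOrder A]
    [StarOrderedRing A] {b : A} (hb : 0 ≤ b) (hb0 : b ≠ 0) : ∃ f : A →ₚ[ℂ] ℂ, f b ≠ 0 := by
  have hnb : -b ∉ ProperCone.positive ℝ A := fun h =>
    hb0 (le_antisymm (neg_nonneg.mp (by simpa using h)) hb)
  obtain ⟨f, hf, hfb⟩ := (ProperCone.positive ℝ A).hyperplane_separation_point hnb
  have hf' : ∀ x : A, 0 ≤ x → 0 ≤ f x := fun x hx => hf x (by simpa using hx)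
  have hfb' : 0 < f b := by simpa using hfb
  -- replacing `x` by its real part makes `g` vanish on `i x` for self-adjoint `x`
  let g : A →ₗ[ℝ] ℝ := f.toLinearMap ∘ₗ (selfAdjoint.submodule ℝ A).subtype ∘ₗ realPart
  have hg : ∀ x : A, 0 ≤ x →
      Module.Dual.extendRCLike (𝕜 := ℂ) g x = (f x : ℂ) := fun x hx => by
    have hx' : IsSelfAdjoint x := IsSelfAdjoint.of_nonneg hx
    have h1 : g x = f x := congrArg f (hx'.coe_realPart)
    have h2 : g (Complex.I • x) = 0 := by
      have h3 : (realPart (Complex.I • x) : A) = 0 := by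
        rw [realPart_I_smul, hx'.imaginaryPart, neg_zero]
        rfl
      exact (congrArg f h3).trans (map_zero f)
    rw [Module.Dual.extendRCLike_apply]
    simp [h1, h2]
  refine ⟨PositiveLinearMap.mk₀ (Module.Dual.extendRCLike (𝕜 := ℂ) g) fun x hx => ?_, ?_⟩
  · rw [hg x hx]
    exact_mod_cast hf' x hx
  · change Module.Dual.extendRCLike (𝕜 := ℂ) g b ≠ 0
    rw [hg b hb]
    exact_mod_cast hfb'.ne'

/-- The GNS representations separate points: in the representation of `f`, the image of the class of
`1` under `a` has squared norm `f (star a * a)`. -/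
theorem exists_representation_ne_zero {A : Type} [CStarAlgebra A] {a : A} (ha : a ≠ 0) :
    ∃ (H : Type) (_ : NormedAddCommGroup H) (_ : InnerProductSpace ℂ H) (_ : CompleteSpace H)
      (π : A →⋆ₙₐ[ℂ] (H →L[ℂ] H)), π a ≠ 0 := by
  let _ := CStarAlgebra.spectralOrder A
  have := CStarAlgebra.spectralOrderedRing A
  have hb0 : star a * a ≠ 0 := fun h => ha (CStarRing.star_mul_self_eq_zero_iff a |>.mp h)
  obtain ⟨f, hf⟩ := exists_positiveLinearMap_ne_zero (star_mul_self_nonneg a) hb0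
  refine ⟨f.GNS, inferInstance, inferInstance, inferInstance, f.gnsNonUnitalStarAlgHom,
    fun h => hf ?_⟩
  have h1 : ((f.leftMulMapPreGNS a (f.toPreGNS 1) : f.PreGNS) : f.GNS) = 0 := by
    rw [← f.gnsNonUnitalStarAlgHom_apply_coe, h]
    rfl
  have h2 : ‖f.leftMulMapPreGNS a (f.toPreGNS 1)‖ = 0 := by
    rw [← UniformSpace.Completion.norm_coe, h1, norm_zero]
  have h3 := f.preGNS_norm_sq (f.leftMulMapPreGNS a (f.toPreGNS 1))
  rw [h2] at h3
  simpa using h3.symm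

/-- The functionals `a ↦ ⟪h', π a h⟫` of all representations `π` separate the points of `A`. -/
theorem exists_inner_representation_ne_zero {A : Type} [CStarAlgebra A] {a : A} (ha : a ≠ 0) :
    ∃ (H : Type) (_ : NormedAddCommGroup H) (_ : InnerProductSpace ℂ H) (_ : CompleteSpace H)
      (π : A →⋆ₙₐ[ℂ] (H →L[ℂ] H)) (h h' : H), inner ℂ h' (π a h) ≠ 0 := by
  obtain ⟨H, i1, i2, i3, π, hπ⟩ := exists_representation_ne_zero ha
  obtain ⟨h, hh⟩ : ∃ h, π a h ≠ 0 := by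
    by_contra! hc
    exact hπ (ContinuousLinearMap.ext hc)
  exact ⟨H, i1, i2, i3, π, h, π a h, by simpa using hh⟩

end Separation

namespace MinTensor

variable {A B : Type} [CStarAlgebra A] [CStarAlgebra B]

/-- The matrix coefficient `a ↦ ⟪h', π a h⟫` of a representation. -/
noncomputable def matrixCoeff {A : Type} [NonUnitalCStarAlgebra A] {H : Type} [NormedAddCommGroup H]
    [InnerProductSpace ℂ H] [CompleteSpace H] (π : A →⋆ₙₐ[ℂ] (H →L[ℂ] H)) (h h' : H) :
    A →ₗ[ℂ] ℂ where
  toFun a := inner ℂ h' (π a h)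
  map_add' a b := by rw [map_add, _root_.add_apply, inner_add_right]
  map_smul' c a := by rw [map_smul, _root_.smul_apply, inner_smul_right]; rfl

theorem inner_tensorRep_tmul {H K : Type} [NormedAddCommGroup H] [InnerProductSpace ℂ H]
    [CompleteSpace H] [NormedAddCommGroup K] [InnerProductSpace ℂ K] [CompleteSpace K]
    (π : A →⋆ₙₐ[ℂ] (H →L[ℂ] H)) (ρ : B →⋆ₙₐ[ℂ] (K →L[ℂ] K)) (h h' : H) (k k' : K)
    (t : A ⊗[ℂ] B) : inner ℂ (h' ⊗ₜ[ℂ] k') (tensorRep π ρ t (h ⊗ₜ k)) =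
      TensorProduct.lid ℂ ℂ (TensorProduct.map (matrixCoeff π h h') (matrixCoeff ρ k k') t) := by
  induction t using TensorProduct.induction_on with
  | zero => simp
  | add x y hx hy => rw [map_add, LinearMap.add_apply, inner_add_right, hx, hy, map_add, map_add]
  | tmul a b =>
    rw [tensorRep_tmul, TensorProduct.map_tmul, TensorProduct.inner_tmul, TensorProduct.map_tmul,
      TensorProduct.lid_tmul]
    rfl

/-- The algebraic tensor product of unital C*-algebras embeds into the minimal one: the minimal
C*-seminorm is a norm, because matrix coefficients of representations separate points. -/
theorem ofAlg_injective : Function.Injective (ofAlg : A ⊗[ℂ] B → MinTensor A B) := by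
  rw [injective_iff_map_eq_zero (ofAlg : A ⊗[ℂ] B →⋆ₙₐ[ℂ] MinTensor A B)]
  intro t ht
  have h0 : minNorm t = 0 := by
    have h := CStarSeminorm.Compl.norm_of (minSeminorm A B) t
    exact h.symm.trans (norm_eq_zero.mpr ht)
  -- expand `t` with the second factors running through a basis of `B`; some coefficient is not
  -- annihilated by a matrix coefficient of `A`, unless all are zero
  classical
  let b := Module.Basis.ofVectorSpace ℂ B
  rw [← (TensorProduct.equivFinsuppOfBasisRight (M := A) b).map_eq_zero_iff]
  ext i
  rw [Finsupp.zero_apply]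
  by_contra hne
  obtain ⟨H, _, _, _, π, h, h', hπ⟩ := exists_inner_representation_ne_zero hne
  -- the slice of `t` by a matrix coefficient vanishes, since all matrix coefficients of it do
  have hslice : TensorProduct.lid ℂ B ((matrixCoeff π h h').rTensor B t) = 0 := by
    by_contra hne'
    obtain ⟨K, _, _, _, ρ, k, k', hρ⟩ := exists_inner_representation_ne_zero hne'
    refine hρ ?_
    have h1 : tensorRep π ρ t (h ⊗ₜ k) = 0 := by
      rw [← norm_le_zero_iff]
      exact (le_minNorm π ρ t _).trans_eq (by rw [h0, zero_mul])
    have h2 := inner_tensorRep_tmul π ρ h h' k k' t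
    rw [h1, inner_zero_right] at h2
    refine Eq.trans ?_ h2.symm
    generalize t = t
    change matrixCoeff ρ k k' _ = _
    induction t using TensorProduct.induction_on with
    | zero => simp
    | add x y hx hy => simp only [map_add, hx, hy]
    | tmul a b => simp
  refine hπ ?_
  have h3 := congrArg (fun z => b.repr z i) hslice
  simp only [map_zero, Finsupp.zero_apply] at h3
  refine Eq.trans ?_ h3
  generalize t = t
  change matrixCoeff π h h' _ = _
  induction t using TensorProduct.induction_on with
  | zero => simp
  | add x y hx hy => simp only [map_add, Finsupp.add_apply, hx, hy]
  | tmul a b => simp [mul_comm]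

theorem tmul_one_injective {A : Type} [CStarAlgebra A] :
    Function.Injective fun a : A => (tmul a 1 : MinTensor A ℂ) := fun a b h => by
  have h1 := congrArg (TensorProduct.rid ℂ A) (ofAlg_injective h)
  simpa using h1

end MinTensor

/-! ### Checking identities of `*`-homomorphisms on generators -/

section Generators

variable {A B : Type} [NonUnitalCStarAlgebra A] [NonUnitalCStarAlgebra B]

theorem continuous_starHom (f : A →⋆ₙₐ[ℂ] B) : Continuous f :=
  AddMonoidHomClass.continuous_of_bound f 1 fun z => by
    rw [one_mul]; exact NonUnitalStarAlgHom.norm_apply_le f z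

/-- The set `S` generates `A` as a C*-algebra. -/
def CStarGenerates (S : Set A) : Prop :=
  Dense (NonUnitalStarAlgebra.adjoin ℂ S : Set A)

theorem CStarGenerates.mem_of_isClosed {S : Set A} (hS : CStarGenerates S)
    (T : NonUnitalStarSubalgebra ℂ A) (hT : IsClosed (T : Set A)) (h : S ⊆ T) (a : A) : a ∈ T :=
  closure_minimal (NonUnitalStarAlgebra.adjoin_le h) hT (hS a)

theorem CStarGenerates.of_closed {S : Set A}
    (h : ∀ T : NonUnitalStarSubalgebra ℂ A, IsClosed (T : Set A) → S ⊆ T → ∀ a, a ∈ T) :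
    CStarGenerates S := fun a => by
  have h1 := h (NonUnitalStarAlgebra.adjoin ℂ S).topologicalClosure
    (NonUnitalStarSubalgebra.isClosed_topologicalClosure _)
    ((NonUnitalStarAlgebra.subset_adjoin ℂ S).trans
      (NonUnitalStarSubalgebra.le_topologicalClosure _)) a
  exact h1

/-- Two `*`-homomorphisms which agree on generators are equal. -/
theorem CStarGenerates.hom_ext {S : Set A} (hS : CStarGenerates S) {f g : A →⋆ₙₐ[ℂ] B}
    (h : ∀ x ∈ S, f x = g x) (a : A) : f a = g a :=
  hS.mem_of_isClosed (NonUnitalStarAlgHom.equalizer f g)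
    (isClosed_eq (continuous_starHom f) (continuous_starHom g)) h a

/-- The pairs `(f a, g a)` lie in the closure of a `*`-closed subspace `P` which is closed under
products if this holds for `a` in a generating set. -/
theorem CStarGenerates.prod_mem_closure {C : Type} [NonUnitalCStarAlgebra C] {S : Set A}
    (hS : CStarGenerates S) {f : A →⋆ₙₐ[ℂ] B} {g : A →⋆ₙₐ[ℂ] C} (P : Submodule ℂ (B × C))
    (hmul : ∀ x ∈ P, ∀ y ∈ P, x * y ∈ P) (hstar : ∀ x ∈ P, star x ∈ P)
    (h : ∀ a ∈ S, (f a, g a) ∈ closure (P : Set (B × C))) (a : A) :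
    (f a, g a) ∈ closure (P : Set (B × C)) :=
  let T : NonUnitalStarSubalgebra ℂ (B × C) :=
    { P.topologicalClosure with
      mul_mem' := fun hx hy => map_mem_closure₂ continuous_mul hx hy hmul
      star_mem' := fun hx => map_mem_closure continuous_star hx hstar }
  hS.mem_of_isClosed (T.comap (f.prod g))
    (isClosed_closure.preimage ((continuous_starHom f).prodMk (continuous_starHom g))) h a

theorem CStarGenerates.image {S : Set A} (hS : CStarGenerates S) (f : A →⋆ₙₐ[ℂ] B)
    (hf : Function.Surjective f) : CStarGenerates (f '' S) :=
  CStarGenerates.of_closed fun T hT h b => by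
    obtain ⟨a, rfl⟩ := hf b
    exact hS.mem_of_isClosed (T.comap f) (hT.preimage (continuous_starHom f))
      (fun s hs => h ⟨s, hs, rfl⟩) a

end Generators

namespace MinTensor

variable {A B C D E F : Type} [NonUnitalCStarAlgebra A] [NonUnitalCStarAlgebra B]
  [NonUnitalCStarAlgebra C] [NonUnitalCStarAlgebra D] [NonUnitalCStarAlgebra E]
  [NonUnitalCStarAlgebra F]

theorem tmul_add (a : A) (b b' : B) : tmul a (b + b') = tmul a b + tmul a b' := by
  rw [tmul, TensorProduct.tmul_add, map_add]

theorem add_tmul (a a' : A) (b : B) : tmul (a + a') b = tmul a b + tmul a' b := by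
  rw [tmul, TensorProduct.add_tmul, map_add]

theorem tmul_zero (a : A) : tmul a (0 : B) = 0 := by
  rw [tmul, TensorProduct.tmul_zero, map_zero]

theorem zero_tmul (b : B) : tmul (0 : A) b = 0 := by
  rw [tmul, TensorProduct.zero_tmul, map_zero]

theorem smul_tmul (c : ℂ) (a : A) (b : B) : tmul (c • a) b = c • tmul a b := by
  rw [tmul, ← TensorProduct.smul_tmul', map_smul]

theorem tmul_smul (c : ℂ) (a : A) (b : B) : tmul a (c • b) = c • tmul a b := by
  rw [tmul, TensorProduct.tmul_smul, map_smul]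

theorem sum_tmul {ι : Type*} (s : Finset ι) (f : ι → A) (b : B) :
    tmul (∑ i ∈ s, f i) b = ∑ i ∈ s, tmul (f i) b := by
  rw [tmul, TensorProduct.sum_tmul, map_sum]

theorem tmul_sum {ι : Type*} (s : Finset ι) (a : A) (f : ι → B) :
    tmul a (∑ i ∈ s, f i) = ∑ i ∈ s, tmul a (f i) := by
  rw [tmul, TensorProduct.tmul_sum, map_sum]

theorem hom_ext {f g : MinTensor A B →⋆ₙₐ[ℂ] C} (h : ∀ a b, f (tmul a b) = g (tmul a b))
    (z : MinTensor A B) : f z = g z := by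
  refine MinTensor.induction z ?_ ?_ ?_ h
  · exact isClosed_eq (continuous_starHom f) (continuous_starHom g)
  · intro x y hx hy; rw [map_add, map_add, hx, hy]
  · rw [map_zero, map_zero]

theorem map_map (f : A →⋆ₙₐ[ℂ] C) (g : B →⋆ₙₐ[ℂ] D) (f' : C →⋆ₙₐ[ℂ] E) (g' : D →⋆ₙₐ[ℂ] F)
    (z : MinTensor A B) : map f' g' (map f g z) = map (f'.comp f) (g'.comp g) z :=
  hom_ext (f := (map f' g').comp (map f g)) (fun a b => by
    rw [NonUnitalStarAlgHom.comp_apply, map_tmul, map_tmul, map_tmul,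
      NonUnitalStarAlgHom.comp_apply, NonUnitalStarAlgHom.comp_apply]) z

theorem map_id (z : MinTensor A B) :
    map (NonUnitalStarAlgHom.id ℂ A) (NonUnitalStarAlgHom.id ℂ B) z = z :=
  hom_ext (g := NonUnitalStarAlgHom.id ℂ (MinTensor A B)) (fun a b => map_tmul _ _ a b) z

theorem norm_tmul_le (a : A) (b : B) : ‖tmul a b‖ ≤ ‖a‖ * ‖b‖ := by
  refine (CStarSeminorm.Compl.norm_of (minSeminorm A B) (a ⊗ₜ b)).trans_le ?_
  refine minNorm_le fun H K _ _ _ _ _ _ π ρ u hu => ?_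
  rw [tensorRep_tmul, ← TensorProduct.mapL_apply]
  refine ((TensorProduct.mapL (π a) (ρ b)).le_opNorm u).trans ?_
  refine (mul_le_of_le_one_right (norm_nonneg _) hu).trans ?_
  exact (TensorProduct.norm_mapL_le (π a) (ρ b)).trans
    (mul_le_mul (NonUnitalStarAlgHom.norm_apply_le π a)
      (NonUnitalStarAlgHom.norm_apply_le ρ b) (norm_nonneg _) (norm_nonneg _))

theorem continuous_tmul_left (a : A) : Continuous fun b : B => tmul a b :=
  AddMonoidHomClass.continuous_of_bound
    (⟨⟨fun b => tmul a b, tmul_zero a⟩, tmul_add a⟩ : B →+ MinTensor A B) ‖a‖ (norm_tmul_le a)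

theorem continuous_tmul_right (b : B) : Continuous fun a : A => tmul a b :=
  AddMonoidHomClass.continuous_of_bound
    (⟨⟨fun a => tmul a b, zero_tmul b⟩, fun a a' => add_tmul a a' b⟩ : A →+ MinTensor A B) ‖b‖
    fun a => (norm_tmul_le a b).trans_eq (mul_comm _ _)

/-- A closed subspace of `A ⊗ B` which contains `a ⊗ b` for `a`, `b` in total sets is everything. -/
theorem mem_of_dense_span {S : Set A} {T : Set B} (hS : Dense (Submodule.span ℂ S : Set A))
    (hT : Dense (Submodule.span ℂ T : Set B)) (V : Submodule ℂ (MinTensor A B))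
    (hV : IsClosed (V : Set (MinTensor A B))) (h : ∀ a ∈ S, ∀ b ∈ T, tmul a b ∈ V)
    (z : MinTensor A B) : z ∈ V := by
  have h1 : ∀ a ∈ S, ∀ b, tmul a b ∈ V := fun a ha b => by
    refine closure_minimal (s := (Submodule.span ℂ T : Set B))
      (t := {b | tmul a b ∈ V}) ?_ (hV.preimage (continuous_tmul_left a)) (hT b)
    intro b hb
    change tmul a b ∈ V
    induction hb using Submodule.span_induction with
    | mem b hb => exact h a ha b hb
    | zero => rw [tmul_zero]; exact V.zero_mem
    | add x y _ _ hx hy => rw [tmul_add]; exact V.add_mem hx hy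
    | smul c x _ hx => rw [tmul_smul]; exact V.smul_mem c hx
  refine MinTensor.induction z hV (fun x y hx hy => V.add_mem hx hy) V.zero_mem fun a b => ?_
  refine closure_minimal (s := (Submodule.span ℂ S : Set A))
    (t := {a | tmul a b ∈ V}) ?_ (hV.preimage (continuous_tmul_right b)) (hS a)
  intro a ha
  change tmul a b ∈ V
  induction ha using Submodule.span_induction with
  | mem a ha => exact h1 a ha b
  | zero => rw [zero_tmul]; exact V.zero_mem
  | add x y _ _ hx hy => rw [add_tmul]; exact V.add_mem hx hy
  | smul c x _ hx => rw [smul_tmul]; exact V.smul_mem c hx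

end MinTensor

/-! ### Coassociativity on generators -/

section AssocGraph

open MinTensor

variable {A : Type} [NonUnitalCStarAlgebra A]

variable (A) in
/-- The pairs `((a ⊗ b) ⊗ c, a ⊗ (b ⊗ c))`, and their linear combinations, as a linear map on the
algebraic tensor product. -/
noncomputable def assocPair : (A ⊗[ℂ] A) ⊗[ℂ] A →ₗ[ℂ]
    MinTensor (MinTensor A A) A × MinTensor A (MinTensor A A) :=
  (ofAlgLinear ∘ₗ TensorProduct.map ofAlgLinear LinearMap.id).prod
    (ofAlgLinear ∘ₗ TensorProduct.map LinearMap.id ofAlgLinear ∘ₗ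
      (TensorProduct.assoc ℂ A A A).toLinearMap)

theorem assocPair_tmul (a b c : A) :
    assocPair A ((a ⊗ₜ b) ⊗ₜ c) = (tmul (tmul a b) c, tmul a (tmul b c)) := rfl

theorem assocGraph_eq : assocGraph A = closure (Set.range (assocPair A)) := rfl

@[elab_as_elim]
theorem tripleTensor_induction {q : (A ⊗[ℂ] A) ⊗[ℂ] A → Prop} (t : (A ⊗[ℂ] A) ⊗[ℂ] A)
    (h0 : q 0) (ha : ∀ x y, q x → q y → q (x + y)) (ht : ∀ a b c, q ((a ⊗ₜ b) ⊗ₜ c)) : q t := by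
  induction t using TensorProduct.induction_on with
  | zero => exact h0
  | add x y hx hy => exact ha x y hx hy
  | tmul u c =>
    induction u using TensorProduct.induction_on with
    | zero => rwa [TensorProduct.zero_tmul]
    | add x y hx hy => rw [TensorProduct.add_tmul]; exact ha _ _ hx hy
    | tmul a b => exact ht a b c

theorem assocPair_mul_mem (t t' : (A ⊗[ℂ] A) ⊗[ℂ] A) :
    assocPair A t * assocPair A t' ∈ LinearMap.range (assocPair A) := by
  induction t using tripleTensor_induction with
  | h0 => rw [map_zero, zero_mul]; exact Submodule.zero_mem _
  | ha x y hx hy => rw [map_add, add_mul]; exact Submodule.add_mem _ hx hy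
  | ht a b c =>
    induction t' using tripleTensor_induction with
    | h0 => rw [map_zero, mul_zero]; exact Submodule.zero_mem _
    | ha x y hx hy => rw [map_add, mul_add]; exact Submodule.add_mem _ hx hy
    | ht a' b' c' =>
      refine ⟨((a * a') ⊗ₜ (b * b')) ⊗ₜ (c * c'), ?_⟩
      rw [assocPair_tmul, assocPair_tmul, assocPair_tmul, Prod.mk_mul_mk]
      simp only [tmul_mul_tmul]

theorem star_assocPair_mem (t : (A ⊗[ℂ] A) ⊗[ℂ] A) :
    star (assocPair A t) ∈ LinearMap.range (assocPair A) := by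
  induction t using tripleTensor_induction with
  | h0 => rw [map_zero, star_zero]; exact Submodule.zero_mem _
  | ha x y hx hy => rw [map_add, star_add]; exact Submodule.add_mem _ hx hy
  | ht a b c =>
    refine ⟨((star a) ⊗ₜ (star b)) ⊗ₜ (star c), ?_⟩
    rw [assocPair_tmul, assocPair_tmul, Prod.star_def]
    simp only [star_tmul]

theorem tmul_mem_assocGraph (a b c : A) :
    (tmul (tmul a b) c, tmul a (tmul b c)) ∈ assocGraph A :=
  subset_closure ⟨(a ⊗ₜ b) ⊗ₜ c, assocPair_tmul a b c⟩

/-- Coassociativity holds if it holds on generators. -/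
theorem coassoc_of_generates {Δ : A →⋆ₙₐ[ℂ] MinTensor A A} {S : Set A} (hS : CStarGenerates S)
    (h : ∀ a ∈ S, (map Δ (NonUnitalStarAlgHom.id ℂ A) (Δ a),
      map (NonUnitalStarAlgHom.id ℂ A) Δ (Δ a)) ∈ assocGraph A) (a : A) :
    (map Δ (NonUnitalStarAlgHom.id ℂ A) (Δ a),
      map (NonUnitalStarAlgHom.id ℂ A) Δ (Δ a)) ∈ assocGraph A := by
  have h1 := fun P hmul hstar => hS.prod_mem_closure (B := MinTensor (MinTensor A A) A)
    (C := MinTensor A (MinTensor A A)) (f := (map Δ (NonUnitalStarAlgHom.id ℂ A)).comp Δ)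
    (g := (map (NonUnitalStarAlgHom.id ℂ A) Δ).comp Δ) P hmul hstar
  have h2 := h1 (LinearMap.range (assocPair A))
    (by rintro _ ⟨x, rfl⟩ _ ⟨y, rfl⟩; exact assocPair_mul_mem x y)
    (by rintro _ ⟨x, rfl⟩; exact star_assocPair_mem x)
  exact h2 h a

theorem counit_left_of_generates {Δ : A →⋆ₙₐ[ℂ] MinTensor A A} {ε : A →⋆ₙₐ[ℂ] ℂ} {S : Set A}
    (hS : CStarGenerates S)
    (h : ∀ a ∈ S, map ε (NonUnitalStarAlgHom.id ℂ A) (Δ a) = tmul 1 a) (a : A) :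
    map ε (NonUnitalStarAlgHom.id ℂ A) (Δ a) = tmul 1 a :=
  let oneTmul : A →⋆ₙₐ[ℂ] MinTensor ℂ A :=
    { toFun := fun a => tmul 1 a
      map_smul' := fun c a => tmul_smul c 1 a
      map_zero' := tmul_zero 1
      map_add' := tmul_add 1
      map_mul' := fun a b => by rw [tmul_mul_tmul, one_mul]
      map_star' := fun a => by rw [star_tmul, star_one] }
  hS.hom_ext (f := (map ε (NonUnitalStarAlgHom.id ℂ A)).comp Δ) (g := oneTmul) h a

theorem counit_right_of_generates {Δ : A →⋆ₙₐ[ℂ] MinTensor A A} {ε : A →⋆ₙₐ[ℂ] ℂ} {S : Set A}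
    (hS : CStarGenerates S)
    (h : ∀ a ∈ S, map (NonUnitalStarAlgHom.id ℂ A) ε (Δ a) = tmul a 1) (a : A) :
    map (NonUnitalStarAlgHom.id ℂ A) ε (Δ a) = tmul a 1 :=
  let tmulOne : A →⋆ₙₐ[ℂ] MinTensor A ℂ :=
    { toFun := fun a => tmul a 1
      map_smul' := fun c a => smul_tmul c a 1
      map_zero' := zero_tmul 1
      map_add' := fun a b => add_tmul a b 1
      map_mul' := fun a b => by rw [tmul_mul_tmul, one_mul]
      map_star' := fun a => by rw [star_tmul, star_one] }
  hS.hom_ext (f := (map (NonUnitalStarAlgHom.id ℂ A) ε).comp Δ) (g := tmulOne) h a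

/-- The density axiom holds if there is a total set of elements `b` such that every `b ⊗ c` is of
the form `Δ(a)(b ⊗ c)`. -/
theorem dense_comul_of_total {Δ : A →⋆ₙₐ[ℂ] MinTensor A A} {S : Set A}
    (hS : Dense (Submodule.span ℂ S : Set A))
    (h : ∀ b ∈ S, ∀ c ∈ S, ∃ a, Δ a * tmul b c = tmul b c) :
    Dense (Submodule.span ℂ
      (Set.range fun t : A × A × A => Δ t.1 * tmul t.2.1 t.2.2) : Set (MinTensor A A)) := fun z => by
  refine mem_of_dense_span hS hS (Submodule.topologicalClosure _)
    (Submodule.isClosed_topologicalClosure _) (fun b hb c hc => ?_) z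
  obtain ⟨a, ha⟩ := h b hb c hc
  exact subset_closure (Submodule.subset_span ⟨(a, b, c), ha⟩)

end AssocGraph

/-! ### Comultiplications dual to a monoid with finite factorizations -/

section MonoidComul

open MinTensor

/-- The finite set of all factorizations of `x` into two factors. -/
noncomputable def factorizations {X : Type} [Mul X] [FiniteFactorizations X] (x : X) :
    Finset (X × X) :=
  (FiniteFactorizations.finite x).toFinset

theorem mem_factorizations {X : Type} [Mul X] [FiniteFactorizations X] {x : X} {p : X × X} :
    p ∈ factorizations x ↔ p.1 * p.2 = x :=
  Set.Finite.mem_toFinset _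

/-- Both iterated sums run over all factorizations of `x` into three factors. -/
theorem sum_factorizations_assoc {X T : Type} [Semigroup X] [FiniteFactorizations X]
    [AddCommMonoid T] (x : X) (f : X → X → X → T) :
    ∑ p ∈ factorizations x, ∑ q ∈ factorizations p.1, f q.1 q.2 p.2 =
      ∑ p ∈ factorizations x, ∑ q ∈ factorizations p.2, f p.1 q.1 q.2 := by
  rw [Finset.sum_sigma', Finset.sum_sigma']
  refine Finset.sum_bij' (fun s _ => ⟨(s.2.1, s.2.2 * s.1.2), (s.2.2, s.1.2)⟩)
    (fun s _ => ⟨(s.1.1 * s.2.1, s.2.2), (s.1.1, s.2.1)⟩) ?_ ?_ ?_ ?_ ?_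
  · rintro ⟨⟨a, b⟩, ⟨c, d⟩⟩ h
    simp only [Finset.mem_sigma, mem_factorizations] at h ⊢
    exact ⟨by rw [← mul_assoc, h.2, h.1], trivial⟩
  · rintro ⟨⟨a, b⟩, ⟨c, d⟩⟩ h
    simp only [Finset.mem_sigma, mem_factorizations] at h ⊢
    exact ⟨by rw [mul_assoc, h.2, h.1], trivial⟩
  · rintro ⟨⟨a, b⟩, ⟨c, d⟩⟩ h
    simp only [Finset.mem_sigma, mem_factorizations] at h
    simp only [h.2]
  · rintro ⟨⟨a, b⟩, ⟨c, d⟩⟩ h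
    simp only [Finset.mem_sigma, mem_factorizations] at h
    simp only [h.2]
  · rintro ⟨⟨a, b⟩, ⟨c, d⟩⟩ h
    rfl

/-- `Δ (G x) = ∑ G y ⊗ G z`, the sum running over all factorizations `x = y z`. -/
def IsFactorizationComul {X A : Type} [Mul X] [FiniteFactorizations X] [NonUnitalCStarAlgebra A]
    (Δ : A →⋆ₙₐ[ℂ] MinTensor A A) (G : X → A) : Prop :=
  ∀ x, Δ (G x) = ∑ p ∈ factorizations x, tmul (G p.1) (G p.2)

variable {X A B : Type} [Monoid X] [FiniteFactorizations X] [NonUnitalCStarAlgebra A]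
  [NonUnitalCStarAlgebra B] {Δ : A →⋆ₙₐ[ℂ] MinTensor A A} {G : X → A}

theorem IsFactorizationComul.coassoc (h : IsFactorizationComul Δ G) (x : X) :
    (map Δ (NonUnitalStarAlgHom.id ℂ A) (Δ (G x)),
      map (NonUnitalStarAlgHom.id ℂ A) Δ (Δ (G x))) ∈ assocGraph A := by
  have h1 : map Δ (NonUnitalStarAlgHom.id ℂ A) (Δ (G x)) =
      ∑ p ∈ factorizations x, ∑ q ∈ factorizations p.1, tmul (tmul (G q.1) (G q.2)) (G p.2) := by
    rw [h x, map_sum]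
    refine Finset.sum_congr rfl fun p _ => ?_
    rw [map_tmul, h p.1, sum_tmul]
    rfl
  have h2 : map (NonUnitalStarAlgHom.id ℂ A) Δ (Δ (G x)) =
      ∑ p ∈ factorizations x, ∑ q ∈ factorizations p.2, tmul (G p.1) (tmul (G q.1) (G q.2)) := by
    rw [h x, map_sum]
    refine Finset.sum_congr rfl fun p _ => ?_
    rw [map_tmul, h p.2, tmul_sum]
    rfl
  rw [h1, h2, ← sum_factorizations_assoc x fun a b c => tmul (G a) (tmul (G b) (G c)),
    assocGraph_eq]
  refine subset_closure (s := Set.range (assocPair A)) ⟨∑ p ∈ factorizations x,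
    ∑ q ∈ factorizations p.1, (G q.1 ⊗ₜ G q.2) ⊗ₜ G p.2, ?_⟩
  simp only [map_sum, assocPair_tmul]
  refine Prod.ext ?_ ?_
  · simp only [Prod.fst_sum]
  · simp only [Prod.snd_sum]

/-- The only factorization `x = y z` with `y = 1` is `x = 1 x`. -/
theorem sum_factorizations_eq_left {T : Type} [AddCommMonoid T] (x : X)
    (f : X × X → T) (hf : ∀ p : X × X, p.1 ≠ 1 → f p = 0) :
    ∑ p ∈ factorizations x, f p = f (1, x) := by
  refine Finset.sum_eq_single (1, x) (fun p hp hne => hf p fun h1 => hne ?_) fun h => ?_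
  · rw [mem_factorizations, h1, one_mul] at hp
    exact Prod.ext h1 hp
  · exact absurd (mem_factorizations.mpr (one_mul x)) h

/-- The only factorization `x = y z` with `z = 1` is `x = x 1`. -/
theorem sum_factorizations_eq_right {T : Type} [AddCommMonoid T] (x : X)
    (f : X × X → T) (hf : ∀ p : X × X, p.2 ≠ 1 → f p = 0) :
    ∑ p ∈ factorizations x, f p = f (x, 1) := by
  refine Finset.sum_eq_single (x, 1) (fun p hp hne => hf p fun h1 => hne ?_) fun h => ?_
  · rw [mem_factorizations, h1, mul_one] at hp
    exact Prod.ext hp h1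
  · exact absurd (mem_factorizations.mpr (mul_one x)) h

theorem IsFactorizationComul.counit_left {ε : A →⋆ₙₐ[ℂ] ℂ} (h : IsFactorizationComul Δ G)
    (h1 : ε (G 1) = 1) (h0 : ∀ x ≠ 1, ε (G x) = 0) (x : X) :
    map ε (NonUnitalStarAlgHom.id ℂ A) (Δ (G x)) = tmul 1 (G x) := by
  rw [h x, map_sum]
  simp only [map_tmul]
  refine (sum_factorizations_eq_left x
    (fun p => tmul (ε (G p.1)) (NonUnitalStarAlgHom.id ℂ A (G p.2))) fun p hp => by rw [h0 _ hp, zero_tmul]).trans ?_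
  rw [h1]
  rfl

theorem IsFactorizationComul.counit_right {ε : A →⋆ₙₐ[ℂ] ℂ} (h : IsFactorizationComul Δ G)
    (h1 : ε (G 1) = 1) (h0 : ∀ x ≠ 1, ε (G x) = 0) (x : X) :
    map (NonUnitalStarAlgHom.id ℂ A) ε (Δ (G x)) = tmul (G x) 1 := by
  rw [h x, map_sum]
  simp only [map_tmul]
  refine (sum_factorizations_eq_right x
    (fun p => tmul (NonUnitalStarAlgHom.id ℂ A (G p.1)) (ε (G p.2))) fun p hp => by rw [h0 _ hp, tmul_zero]).trans ?_
  rw [h1]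
  rfl

theorem IsFactorizationComul.image (h : IsFactorizationComul Δ G) (f : A →⋆ₙₐ[ℂ] B)
    {Δ' : B →⋆ₙₐ[ℂ] MinTensor B B} (hf : Intertwines f Δ Δ') :
    IsFactorizationComul Δ' fun x => f (G x) := fun x => by
  rw [hf, h x, map_sum]
  simp only [map_tmul]

/-- Injectivity on the index monoid and closedness of its image under taking factors let a
homomorphism which matches generators intertwine factorization comultiplications. -/
theorem IsFactorizationComul.intertwines {Y : Type} [Monoid Y] [FiniteFactorizations Y]
    {Δ' : B →⋆ₙₐ[ℂ] MinTensor B B} {G' : Y → B} (h : IsFactorizationComul Δ G)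
    (h' : IsFactorizationComul Δ' G') (hG : CStarGenerates (Set.range G)) (f : A →⋆ₙₐ[ℂ] B)
    (u : X → Y) (hfu : ∀ x, f (G x) = G' (u x)) (hu : Function.Injective u)
    (hmul : ∀ x y, u (x * y) = u x * u y)
    (hfac : ∀ x y z, y * z = u x → y ∈ Set.range u ∧ z ∈ Set.range u) :
    Intertwines f Δ Δ' := by
  refine hG.hom_ext (f := Δ'.comp f) (g := (map f f).comp Δ) ?_
  rintro _ ⟨x, rfl⟩
  rw [NonUnitalStarAlgHom.comp_apply, NonUnitalStarAlgHom.comp_apply, hfu, h' (u x), h x, map_sum]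
  simp only [map_tmul, hfu]
  symm
  refine Finset.sum_bij (fun p _ => (u p.1, u p.2)) ?_ ?_ ?_ fun _ _ => rfl
  · intro p hp
    rw [mem_factorizations] at hp ⊢
    rw [← hp, hmul]
  · intro p _ q _ hpq
    exact Prod.ext (hu (congrArg Prod.fst hpq)) (hu (congrArg Prod.snd hpq))
  · rintro ⟨y, z⟩ hp
    rw [mem_factorizations] at hp
    obtain ⟨⟨a, rfl⟩, ⟨b, rfl⟩⟩ := hfac x y z hp
    exact ⟨(a, b), mem_factorizations.mpr (hu ((hmul a b).trans hp)), rfl⟩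

end MonoidComul

/-! ### The generators of a direct sum of C*-algebras over a monoid -/

section GradedGenerators

open MinTensor

/-- An identification of the index sets `I (a * b)` with the products `I a × I b` which makes the
set of all pairs `(a, i)` with `a` in `M` and `i` in `I a` a monoid. -/
class IndexMonoid (M : Type) [Monoid M] (I : M → Type) where
  /-- The numbering of pairs of indices. -/
  pairing : ∀ a b : M, I a × I b ≃ I (a * b)
  /-- The index over the unit of `M`. -/
  unit : I 1
  pairing_assoc : ∀ (a b c : M) (i : I a) (j : I b) (k : I c),
    (⟨a * b * c, pairing _ _ (pairing _ _ (i, j), k)⟩ : Sigma I) =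
      ⟨a * (b * c), pairing _ _ (i, pairing _ _ (j, k))⟩
  unit_pairing : ∀ (a : M) (i : I a), (⟨1 * a, pairing _ _ (unit, i)⟩ : Sigma I) = ⟨a, i⟩
  pairing_unit : ∀ (a : M) (i : I a), (⟨a * 1, pairing _ _ (i, unit)⟩ : Sigma I) = ⟨a, i⟩

variable {M : Type} [Monoid M] {I : M → Type} [IndexMonoid M I]

instance : Monoid (Sigma I) where
  mul x y := ⟨x.1 * y.1, IndexMonoid.pairing _ _ (x.2, y.2)⟩
  one := ⟨1, IndexMonoid.unit⟩
  mul_assoc x y z := IndexMonoid.pairing_assoc x.1 y.1 z.1 x.2 y.2 z.2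
  one_mul x := IndexMonoid.unit_pairing x.1 x.2
  mul_one x := IndexMonoid.pairing_unit x.1 x.2

/-- A factorization of a pair is determined by the factorization of its first component. -/
theorem sigma_eq_of_mul_eq {x y x' y' : Sigma I} (h : x * y = x' * y') (h1 : x.1 = x'.1)
    (h2 : y.1 = y'.1) : x = x' ∧ y = y' := by
  obtain ⟨a, i⟩ := x
  obtain ⟨b, j⟩ := y
  obtain ⟨a', i'⟩ := x'
  obtain ⟨b', j'⟩ := y'
  obtain rfl : a = a' := h1
  obtain rfl : b = b' := h2
  have h3 := (IndexMonoid.pairing a b).injective (eq_of_heq (Sigma.mk.inj h).2)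
  obtain ⟨rfl, rfl⟩ := Prod.mk.inj h3
  exact ⟨rfl, rfl⟩

variable [FiniteFactorizations M]

instance : FiniteFactorizations (Sigma I) where
  finite z := by
    refine Set.Finite.of_finite_image (f := fun p : Sigma I × Sigma I => (p.1.1, p.2.1))
      ((FiniteFactorizations.finite z.1).subset ?_) ?_
    · rintro _ ⟨p, hp, rfl⟩
      exact congrArg Sigma.fst hp
    · intro p hp q hq hpq
      have h := sigma_eq_of_mul_eq (Eq.trans hp (Eq.symm hq)) (congrArg Prod.fst hpq)
        (congrArg Prod.snd hpq)
      exact Prod.ext h.1 h.2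

variable {𝒜 : M → Type} [∀ a, NonUnitalCStarAlgebra (𝒜 a)]
  (φ : ∀ a b, 𝒜 (a * b) →⋆ₙₐ[ℂ] MinTensor (𝒜 a) (𝒜 b)) (g : ∀ a, I a → 𝒜 a)

/-- The generator of the direct sum with index `x`. -/
noncomputable def sumGen (x : Sigma I) : C0Sum 𝒜 := C0Sum.single x.1 (g x.1 x.2)

/-- If every `φ a b` maps the generator with index `(i, j)` to `g a i ⊗ g b j`, then the
comultiplication of the direct sum is dual to the monoid of all indices of generators. -/
theorem sumComul_isFactorizationComul
    (hφ : ∀ a b i j, φ a b (g (a * b) (IndexMonoid.pairing a b (i, j))) = tmul (g a i) (g b j)) :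
    IsFactorizationComul (sumComul φ) (sumGen g) := fun x => by
  have hs := hasSum_sumComul φ (sumGen g x)
  -- factorizations of `x.1` correspond to those of `x`
  let u : factorizations x → M × M := fun p => (p.1.1.1, p.1.2.1)
  have hu : Function.Injective u := fun p q hpq => by
    have h := sigma_eq_of_mul_eq
      ((mem_factorizations.mp p.2).trans (mem_factorizations.mp q.2).symm)
      (congrArg Prod.fst hpq) (congrArg Prod.snd hpq)
    exact Subtype.ext (Prod.ext h.1 h.2)
  have hzero : ∀ p ∉ Set.range u,
      sumComulPart φ p (C0Sum.proj (p.1 * p.2) (sumGen g x)) = 0 := by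
    rintro ⟨a, b⟩ hp
    have hne : a * b ≠ x.1 := by
      rintro h
      obtain ⟨c, k⟩ := x
      obtain rfl : a * b = c := h
      obtain ⟨⟨i, j⟩, rfl⟩ := (IndexMonoid.pairing a b).surjective k
      exact hp ⟨⟨(⟨a, i⟩, ⟨b, j⟩), mem_factorizations.mpr rfl⟩, rfl⟩
    rw [sumGen, C0Sum.proj_single_ne hne, map_zero]
  have hval : ∀ p : factorizations x,
      sumComulPart φ (u p) (C0Sum.proj ((u p).1 * (u p).2) (sumGen g x)) =
        tmul (sumGen g p.1.1) (sumGen g p.1.2) := by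
    rintro ⟨⟨y, z⟩, hp⟩
    obtain rfl := mem_factorizations.mp hp
    change sumComulPart φ (y.1, z.1) (C0Sum.proj (y.1 * z.1) (C0Sum.single (y.1 * z.1)
      (g (y.1 * z.1) (IndexMonoid.pairing _ _ (y.2, z.2))))) = _
    rw [C0Sum.proj_single_self]
    change MinTensor.map _ _ (φ y.1 z.1 _) = _
    rw [hφ, map_tmul]
    rfl
  rw [← hu.hasSum_iff hzero] at hs
  have h2 := hs.unique (hasSum_fintype _)
  rw [h2, ← Finset.sum_coe_sort (factorizations x)]
  exact Finset.sum_congr rfl fun p _ => hval p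

end GradedGenerators

namespace C0Sum

variable {ι : Type} {𝒜 : ι → Type} [∀ i, NonUnitalCStarAlgebra (𝒜 i)]

theorem hasSum_single (x : C0Sum 𝒜) : HasSum (fun i => single i (proj i x)) x := by
  have hfin : ∀ i : ι, {p : ι | id p = i}.Finite := fun i => Set.finite_singleton i
  have h := hasSum_desc (m := id) (T := C0Sum 𝒜) (fun i => single i)
    (fun i j h x y => single_mul_single_ne h x y) hfin x
  have he : desc (m := id) (T := C0Sum 𝒜) (fun i => single i)
      (fun i j h x y => single_mul_single_ne h x y) hfin x = x := ext fun i => by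
    have h1 := h.map (proj i) (continuous_starHom (proj i))
    have h2 := _root_.hasSum_single (f := fun j => proj i (single (𝒜 := 𝒜) j (proj j x))) i
      fun j hj => proj_single_ne hj.symm (proj j x)
    rw [proj_single_self] at h2
    exact h1.unique h2
  rwa [he] at h

theorem dense_span_single :
    Dense (Submodule.span ℂ {x : C0Sum 𝒜 | ∃ i a, x = single i a} : Set (C0Sum 𝒜)) := fun x =>
  mem_closure_of_tendsto (hasSum_single x) <| Eventually.of_forall fun _ =>
    Submodule.sum_mem _ fun i _ => Submodule.subset_span ⟨i, _, rfl⟩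

/-- The direct sum is generated by generators of its summands. -/
theorem cstarGenerates {S : ∀ i, Set (𝒜 i)} (hS : ∀ i, CStarGenerates (S i)) :
    CStarGenerates {x : C0Sum 𝒜 | ∃ i, ∃ a ∈ S i, x = single i a} :=
  CStarGenerates.of_closed fun T hT h x => by
    have h1 : ∀ i a, single i a ∈ T := fun i a =>
      (hS i).mem_of_isClosed (T.comap (single i)) (hT.preimage (continuous_starHom (single i)))
        (fun b hb => h ⟨i, b, hb, rfl⟩) a
    exact hT.mem_of_tendsto (hasSum_single x) <| Eventually.of_forall fun s =>
      sum_mem fun i _ => h1 i _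

end C0Sum

/-! ### The monoids of generators of the Cuntz-Krieger algebras and of the Cuntz algebras -/

namespace NDMat

/-- Equality of pairs of a matrix and an index, compared entrywise along an equality of sizes. -/
theorem sigma_ext {x y : Σ A : NDMat, Fin A.n} (h : x.1.n = y.1.n)
    (hm : ∀ i j, x.1.mat i j = y.1.mat (Fin.cast h i) (Fin.cast h j))
    (hi : (x.2 : ℕ) = y.2) : x = y := by
  obtain ⟨⟨n, hn, a, ha, ha1, ha2⟩, i⟩ := x
  obtain ⟨⟨m, hm', b, hb, hb1, hb2⟩, j⟩ := y
  obtain rfl : n = m := h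
  obtain rfl : a = b := funext fun i => funext fun j => hm i j
  obtain rfl : i = j := Fin.ext hi
  rfl

theorem mul_mat_apply (A B : NDMat) (p q : Fin A.n × Fin B.n) :
    (A * B).mat (finProdFinEquiv p) (finProdFinEquiv q) = A.mat p.1 q.1 * B.mat p.2 q.2 := by
  change A.mat (finProdFinEquiv.symm (finProdFinEquiv p)).1 _ * B.mat _ _ = _
  rw [Equiv.symm_apply_apply, Equiv.symm_apply_apply]

/-- The numbering of pairs of indices in a Kronecker product. -/
def pairing (A B : NDMat) : Fin A.n × Fin B.n ≃ Fin (A * B).n := finProdFinEquiv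

theorem pairing_val (A B : NDMat) (p : Fin A.n × Fin B.n) :
    (pairing A B p : ℕ) = p.2 + B.n * p.1 := rfl

theorem pairing_mat (A B : NDMat) (p q : Fin A.n × Fin B.n) :
    (A * B).mat (pairing A B p) (pairing A B q) = A.mat p.1 q.1 * B.mat p.2 q.2 :=
  mul_mat_apply A B p q

theorem sigma_mul_assoc (A B C : NDMat) (i : Fin A.n) (j : Fin B.n) (k : Fin C.n) :
    (⟨A * B * C, pairing _ _ (pairing _ _ (i, j), k)⟩ : Σ A : NDMat, Fin A.n) =
      ⟨A * (B * C), pairing _ _ (i, pairing _ _ (j, k))⟩ := by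
  have hn : (A * B * C).n = (A * (B * C)).n := mul_assoc A.n B.n C.n
  have hc : ∀ i j k, Fin.cast hn (pairing (A * B) C (pairing A B (i, j), k)) =
      pairing A (B * C) (i, pairing B C (j, k)) := fun i j k => Fin.ext <| by
    change (k : ℕ) + C.n * (j + B.n * i) = k + C.n * j + B.n * C.n * i
    ring
  refine sigma_ext hn (fun r s => ?_) (congrArg Fin.val (hc i j k))
  obtain ⟨⟨r', k⟩, rfl⟩ := (pairing (A * B) C).surjective r
  obtain ⟨⟨i, j⟩, rfl⟩ := (pairing A B).surjective r'
  obtain ⟨⟨s', k'⟩, rfl⟩ := (pairing (A * B) C).surjective s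
  obtain ⟨⟨i', j'⟩, rfl⟩ := (pairing A B).surjective s'
  dsimp only
  rw [hc, hc]
  simp only [pairing_mat, mul_assoc]

theorem allOnes_one_index (i : Fin (allOnes 1).n) : (i : ℕ) = 0 :=
  Nat.lt_one_iff.mp i.2

theorem sigma_one_mul (A : NDMat) (u : Fin (allOnes 1).n) (i : Fin A.n) :
    (⟨allOnes 1 * A, pairing _ _ (u, i)⟩ : Σ A : NDMat, Fin A.n) = ⟨A, i⟩ := by
  have hn : (allOnes 1 * A).n = A.n := one_mul A.n
  have hc : ∀ u i, Fin.cast hn (pairing (allOnes 1) A (u, i)) = i := fun u i => Fin.ext <| by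
    rw [Fin.val_cast, pairing_val, allOnes_one_index, mul_zero, add_zero]
  refine sigma_ext hn (fun r s => ?_) (congrArg Fin.val (hc u i))
  obtain ⟨⟨v, i⟩, rfl⟩ := (pairing (allOnes 1) A).surjective r
  obtain ⟨⟨v', i'⟩, rfl⟩ := (pairing (allOnes 1) A).surjective s
  dsimp only
  rw [hc, hc, pairing_mat]
  exact one_mul _

theorem sigma_mul_one (A : NDMat) (u : Fin (allOnes 1).n) (i : Fin A.n) :
    (⟨A * allOnes 1, pairing _ _ (i, u)⟩ : Σ A : NDMat, Fin A.n) = ⟨A, i⟩ := by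
  have hn : (A * allOnes 1).n = A.n := mul_one A.n
  have hc : ∀ i u, Fin.cast hn (pairing A (allOnes 1) (i, u)) = i := fun i u => Fin.ext <| by
    rw [Fin.val_cast, pairing_val, allOnes_one_index, zero_add]
    exact one_mul _
  refine sigma_ext hn (fun r s => ?_) (congrArg Fin.val (hc i u))
  obtain ⟨⟨i, v⟩, rfl⟩ := (pairing A (allOnes 1)).surjective r
  obtain ⟨⟨i', v'⟩, rfl⟩ := (pairing A (allOnes 1)).surjective s
  dsimp only
  rw [hc, hc, pairing_mat]
  exact mul_one _

instance : Monoid NDMat where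
  one := allOnes 1
  mul_assoc A B C := congrArg Sigma.fst
    (sigma_mul_assoc A B C ⟨0, A.pos⟩ ⟨0, B.pos⟩ ⟨0, C.pos⟩)
  one_mul A := congrArg Sigma.fst (sigma_one_mul A ⟨0, one_pos⟩ ⟨0, A.pos⟩)
  mul_one A := congrArg Sigma.fst (sigma_mul_one A ⟨0, one_pos⟩ ⟨0, A.pos⟩)

instance : IndexMonoid NDMat fun A => Fin A.n where
  pairing := pairing
  unit := (⟨0, one_pos⟩ : Fin (allOnes 1).n)
  pairing_assoc := sigma_mul_assoc
  unit_pairing A i := sigma_one_mul A _ i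
  pairing_unit A i := sigma_mul_one A _ i

theorem allOnes_injective : Function.Injective allOnes := fun _ _ h =>
  PNat.eq (congrArg NDMat.n h)

/-- A Kronecker factor of an all-ones matrix is an all-ones matrix. -/
theorem eq_allOnes_of_mul_eq {A B : NDMat} {n : ℕ+} (h : A * B = allOnes n) :
    A = allOnes ⟨A.n, A.pos⟩ ∧ B = allOnes ⟨B.n, B.pos⟩ := by
  have h1 : ∀ i j, (A * B).mat i j = 1 := by
    rw [h]
    exact fun _ _ => rfl
  have h2 : ∀ p q : Fin A.n × Fin B.n, A.mat p.1 q.1 * B.mat p.2 q.2 = 1 := fun p q =>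
    (pairing_mat A B p q).symm.trans (h1 _ _)
  have hA : ∀ i j, A.mat i j = 1 := fun i j =>
    Nat.eq_one_of_mul_eq_one_right (h2 (i, ⟨0, B.pos⟩) (j, ⟨0, B.pos⟩))
  have hB : ∀ i j, B.mat i j = 1 := fun i j =>
    Nat.eq_one_of_mul_eq_one_left (h2 (⟨0, A.pos⟩, i) (⟨0, A.pos⟩, j))
  have key : ∀ C : NDMat, (∀ i j, C.mat i j = 1) → C = allOnes ⟨C.n, C.pos⟩ := fun C hC =>
    congrArg Sigma.fst (sigma_ext (x := ⟨C, ⟨0, C.pos⟩⟩) (y := ⟨allOnes ⟨C.n, C.pos⟩, ⟨0, C.pos⟩⟩)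
      rfl hC rfl)
  exact ⟨key A hA, key B hB⟩

end NDMat

namespace PNat

theorem sigma_fin_ext {x y : Σ n : ℕ+, Fin n} (h : x.1 = y.1) (hi : (x.2 : ℕ) = y.2) : x = y := by
  obtain ⟨n, i⟩ := x
  obtain ⟨m, j⟩ := y
  obtain rfl : n = m := h
  obtain rfl : i = j := Fin.ext hi
  rfl

/-- The numbering of pairs of indices of Cuntz algebras. -/
def pairing (n m : ℕ+) : Fin n × Fin m ≃ Fin (n * m : ℕ+) :=
  finProdFinEquiv.trans (finCongr (PNat.mul_coe n m).symm)

theorem pairing_val (n m : ℕ+) (p : Fin n × Fin m) : (pairing n m p : ℕ) = p.2 + m * p.1 := rfl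

theorem index_one (i : Fin (1 : ℕ+)) : (i : ℕ) = 0 := Nat.lt_one_iff.mp i.2

end PNat

instance : IndexMonoid ℕ+ fun n => Fin n where
  pairing := PNat.pairing
  unit := (⟨0, one_pos⟩ : Fin (1 : ℕ+))
  pairing_assoc a b c i j k := PNat.sigma_fin_ext (mul_assoc a b c) <| by
    change (k : ℕ) + c * (j + b * i) = k + c * j + (b * c : ℕ) * i
    ring
  unit_pairing a i := PNat.sigma_fin_ext (one_mul a) <| by
    rw [PNat.pairing_val]
    exact (congrArg ((i : ℕ) + ·) (mul_zero (a : ℕ))).trans (add_zero _)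
  pairing_unit a i := PNat.sigma_fin_ext (mul_one a) <| by
    rw [PNat.pairing_val]
    exact (zero_add _).trans (one_mul _)

/-! ### The direct sums of Cuntz-Krieger algebras and of Cuntz algebras -/

/-- A universal C*-algebra is generated by its unit and its generators. -/
theorem CStarRelations.Univ.mem_of_isClosed {X : Type} {R : CStarRelations X}
    (T : NonUnitalStarSubalgebra ℂ R.Univ) (hT : IsClosed (T : Set R.Univ)) (h1 : 1 ∈ T)
    (h : ∀ x, gen R x ∈ T) (a : R.Univ) : a ∈ T := by
  refine CStarSeminorm.Compl.ind _ a hT fun p => ?_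
  change ofPoly R p ∈ T
  induction p using FreeStar.ind with
  | h0 c =>
    rw [Algebra.algebraMap_eq_smul_one, map_smul]
    exact SMulMemClass.smul_mem c h1
  | h1 y =>
    rcases y with x | x
    · exact h x
    · have h2 : ofPoly R (FreeStar.letter (Sum.inr x)) = star (gen R x) := by
        rw [gen, ← map_star, FreeStar.gen, FreeStar.star_letter, Sum.swap_inl]
      rw [h2]
      exact star_mem (h x)
  | hm a b ha hb => rw [map_mul]; exact mul_mem ha hb
  | ha a b ha hb => rw [map_add]; exact add_mem ha hb

/-- The unit need not be added to the generators, because it is the sum of the range projections. -/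
theorem cstarGenerates_ckGen (A : NDMat) : CStarGenerates (Set.range (ckGen A)) :=
  CStarGenerates.of_closed fun T hT h a => by
    refine CStarRelations.Univ.mem_of_isClosed T hT ?_ (fun i => h ⟨i, rfl⟩) a
    rw [← ckGen_sum_range A]
    exact sum_mem fun i _ => mul_mem (h ⟨i, rfl⟩) (star_mem (h ⟨i, rfl⟩))

theorem cstarGenerates_cuntzGen (n : ℕ+) : CStarGenerates (Set.range (cuntzGen n)) :=
  CStarGenerates.of_closed fun T hT h a => by
    refine CStarRelations.Univ.mem_of_isClosed T hT ?_ (fun i => h ⟨i, rfl⟩) a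
    rw [← cuntzGen_sum_range n]
    exact sum_mem fun i _ => mul_mem (h ⟨i, rfl⟩) (star_mem (h ⟨i, rfl⟩))

/-- The generator `s_i^{(A)}` of the direct sum of all Cuntz-Krieger algebras. -/
noncomputable abbrev ckStarGen : (Σ A : NDMat, Fin A.n) → CKStar := sumGen ckGen

/-- The generator `s_i` of the summand `O_n` of the direct sum of all Cuntz algebras. -/
noncomputable abbrev cuntzStarGen : (Σ n : ℕ+, Fin n) → CuntzStar := sumGen cuntzGen

theorem cstarGenerates_sumGen {M : Type} {I : M → Type} {𝒜 : M → Type}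
    [∀ a, NonUnitalCStarAlgebra (𝒜 a)] (g : ∀ a, I a → 𝒜 a)
    (h : ∀ a, CStarGenerates (Set.range (g a))) : CStarGenerates (Set.range (sumGen g)) := by
  have h1 := C0Sum.cstarGenerates h
  convert h1 using 1
  ext x
  constructor
  · rintro ⟨⟨a, i⟩, rfl⟩
    exact ⟨a, g a i, ⟨i, rfl⟩, rfl⟩
  · rintro ⟨a, _, ⟨i, rfl⟩, rfl⟩
    exact ⟨⟨a, i⟩, rfl⟩

theorem cstarGenerates_ckStarGen : CStarGenerates (Set.range ckStarGen) :=
  cstarGenerates_sumGen ckGen cstarGenerates_ckGen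

theorem cstarGenerates_cuntzStarGen : CStarGenerates (Set.range cuntzStarGen) :=
  cstarGenerates_sumGen cuntzGen cstarGenerates_cuntzGen

theorem ckComul_isFactorizationComul : IsFactorizationComul ckComul ckStarGen :=
  sumComul_isFactorizationComul ckPhi ckGen ckPhi_gen

theorem cuntzComul_isFactorizationComul : IsFactorizationComul cuntzComul cuntzStarGen :=
  sumComul_isFactorizationComul cuntzPhi cuntzGen cuntzPhi_gen

theorem ckCounit_gen_one : ckCounit (ckStarGen 1) = 1 := by
  change CStarRelations.Univ.lift _ ckCounit_rel (C0Sum.proj (NDMat.allOnes 1)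
    (C0Sum.single (NDMat.allOnes 1) (ckGen _ _))) = 1
  rw [C0Sum.proj_single_self]
  exact CStarRelations.Univ.lift_gen _ _ _

theorem ckCounit_gen_ne_one (x : Σ A : NDMat, Fin A.n) (hx : x ≠ 1) :
    ckCounit (ckStarGen x) = 0 := by
  have hne : NDMat.allOnes 1 ≠ x.1 := by
    rintro h
    refine hx ?_
    obtain ⟨A, i⟩ := x
    obtain rfl : NDMat.allOnes 1 = A := h
    exact NDMat.sigma_ext rfl (fun _ _ => rfl) (NDMat.allOnes_one_index i)
  change CStarRelations.Univ.lift _ ckCounit_rel (C0Sum.proj (NDMat.allOnes 1)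
    (C0Sum.single x.1 (ckGen _ _))) = 0
  rw [C0Sum.proj_single_ne hne, map_zero]

theorem cuntzCounit_gen_one : cuntzCounit (cuntzStarGen 1) = 1 := by
  change CStarRelations.Univ.lift _ cuntzCounit_rel (C0Sum.proj (1 : ℕ+)
    (C0Sum.single (1 : ℕ+) (cuntzGen _ _))) = 1
  rw [C0Sum.proj_single_self]
  exact CStarRelations.Univ.lift_gen _ _ _

theorem cuntzCounit_gen_ne_one (x : Σ n : ℕ+, Fin n) (hx : x ≠ 1) :
    cuntzCounit (cuntzStarGen x) = 0 := by
  have hne : 1 ≠ x.1 := by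
    rintro h
    refine hx ?_
    obtain ⟨n, i⟩ := x
    obtain rfl : 1 = n := h
    exact PNat.sigma_fin_ext rfl (PNat.index_one i)
  change CStarRelations.Univ.lift _ cuntzCounit_rel (C0Sum.proj (1 : ℕ+)
    (C0Sum.single x.1 (cuntzGen _ _))) = 0
  rw [C0Sum.proj_single_ne hne, map_zero]

/-! ### The algebraic bialgebra spanned by generators -/

section AlgebraicBialgebra

open MinTensor

/-- A `*`-homomorphism of unital C*-algebras which maps the unit to the unit. -/
def NonUnitalStarAlgHom.toUnital {A B : Type} [CStarAlgebra A] [CStarAlgebra B]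
    (f : A →⋆ₙₐ[ℂ] B) (h : f 1 = 1) : A →⋆ₐ[ℂ] B where
  __ := f
  map_one' := h
  commutes' c := by
    rw [Algebra.algebraMap_eq_smul_one, Algebra.algebraMap_eq_smul_one]
    exact (map_smul f c 1).trans (congrArg _ h)

/-- The inclusion of the algebraic tensor product of unital C*-algebras, as a unital
homomorphism. -/
noncomputable def MinTensor.ofAlgHom (A B : Type) [CStarAlgebra A] [CStarAlgebra B] :
    A ⊗[ℂ] B →ₐ[ℂ] MinTensor A B :=
  AlgHom.ofLinearMap ofAlgLinear rfl (map_mul ofAlg)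

variable {A : Type} [CStarAlgebra A] {X : Type}

/-- The inclusion of the algebraic tensor square of a `*`-subalgebra into the minimal tensor
square. -/
noncomputable def subalgebraTensorHom (K : StarSubalgebra ℂ A) : K ⊗[ℂ] K →ₐ[ℂ] MinTensor A A :=
  (MinTensor.ofAlgHom A A).comp
    (Algebra.TensorProduct.map K.subtype.toAlgHom K.subtype.toAlgHom)

theorem subalgebraTensorHom_tmul (K : StarSubalgebra ℂ A) (a b : K) :
    subalgebraTensorHom K (a ⊗ₜ b) = tmul (a : A) (b : A) := rfl

theorem subalgebraTensorHom_injective (K : StarSubalgebra ℂ A) :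
    Function.Injective (subalgebraTensorHom K) := by
  have h : Function.Injective
      (TensorProduct.map K.subtype.toAlgHom.toLinearMap K.subtype.toAlgHom.toLinearMap) :=
    TensorProduct.map_injective_of_flat_flat _ _ Subtype.val_injective Subtype.val_injective
  exact MinTensor.ofAlg_injective.comp h

theorem subalgebraTensorHom_star (K : StarSubalgebra ℂ A) (t : K ⊗[ℂ] K) :
    subalgebraTensorHom K (star t) = star (subalgebraTensorHom K t) := by
  induction t using TensorProduct.induction_on with
  | zero => rw [star_zero, map_zero, star_zero]
  | add x y hx hy => rw [star_add, map_add, map_add, star_add, hx, hy]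
  | tmul a b => exact (MinTensor.star_tmul (a : A) (b : A)).symm

/-- The unital `*`-subalgebra generated algebraically by a family. -/
abbrev starAdjoinRange (G : X → A) : StarSubalgebra ℂ A := StarAlgebra.adjoin ℂ (Set.range G)

/-- Algebra homomorphisms on the generated `*`-subalgebra, which need not respect the involution, are
determined by the values on the generators and on their adjoints. -/
theorem starAdjoinRange_hom_ext {G : X → A} {T : Type} [Semiring T] [Algebra ℂ T]
    {f g : starAdjoinRange G →ₐ[ℂ] T}
    (h : ∀ a : starAdjoinRange G, (a : A) ∈ Set.range G ∪ star (Set.range G) → f a = g a) :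
    f = g := by
  refine AlgHom.ext ?_
  rintro ⟨a, ha⟩
  change a ∈ Algebra.adjoin ℂ (Set.range G ∪ star (Set.range G)) at ha
  induction ha using Algebra.adjoin_induction with
  | mem x hx => exact h ⟨x, Algebra.subset_adjoin hx⟩ hx
  | algebraMap r => exact (f.commutes r).trans (g.commutes r).symm
  | add x y hx hy h1 h2 =>
    exact (map_add f ⟨x, hx⟩ ⟨y, hy⟩).trans
      ((congrArg₂ (· + ·) h1 h2).trans (map_add g ⟨x, hx⟩ ⟨y, hy⟩).symm)
  | mul x y hx hy h1 h2 =>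
    exact (map_mul f ⟨x, hx⟩ ⟨y, hy⟩).trans
      ((congrArg₂ (· * ·) h1 h2).trans (map_mul g ⟨x, hx⟩ ⟨y, hy⟩).symm)

variable [Monoid X] [FiniteFactorizations X] {G : X → A} {Δ : A →⋆ₙₐ[ℂ] MinTensor A A}
  {ε : A →⋆ₙₐ[ℂ] ℂ}

/-- The comultiplication maps the generated `*`-algebra to its algebraic tensor square. -/
theorem IsFactorizationComul.mem_range (h : IsFactorizationComul Δ G) (h1 : Δ 1 = 1)
    (a : starAdjoinRange G) :
    Δ a ∈ (subalgebraTensorHom (starAdjoinRange G)).range := by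
  obtain ⟨a, ha⟩ := a
  change Δ a ∈ _
  induction ha using StarAlgebra.adjoin_induction with
  | mem x hx =>
    obtain ⟨x, rfl⟩ := hx
    rw [h x]
    refine sum_mem fun p _ => ?_
    exact ⟨(⟨G p.1, StarAlgebra.subset_adjoin ℂ _ ⟨_, rfl⟩⟩ : starAdjoinRange G) ⊗ₜ[ℂ]
      (⟨G p.2, StarAlgebra.subset_adjoin ℂ _ ⟨_, rfl⟩⟩ : starAdjoinRange G), rfl⟩
  | algebraMap r =>
    rw [Algebra.algebraMap_eq_smul_one, map_smul, h1]
    exact Subalgebra.smul_mem _ (one_mem _) r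
  | add x y _ _ hx hy => rw [map_add]; exact add_mem hx hy
  | mul x y _ _ hx hy => rw [map_mul]; exact mul_mem hx hy
  | star x _ hx =>
    obtain ⟨t, ht⟩ := hx
    rw [map_star]
    exact ⟨star t, (subalgebraTensorHom_star _ t).trans (congrArg star ht)⟩

/-- The comultiplication of the algebra generated by a family, with values in the algebraic tensor
product. -/
noncomputable def IsFactorizationComul.algComul (h : IsFactorizationComul Δ G) (h1 : Δ 1 = 1) :
    starAdjoinRange G →ₐ[ℂ] starAdjoinRange G ⊗[ℂ] starAdjoinRange G :=
  let Ψ := subalgebraTensorHom (starAdjoinRange G)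
  (AlgEquiv.ofInjective Ψ (subalgebraTensorHom_injective _)).symm.toAlgHom.comp
    (((Δ.toUnital h1).toAlgHom.comp (starAdjoinRange G).subtype.toAlgHom).codRestrict
      Ψ.range fun a => h.mem_range h1 a)

theorem IsFactorizationComul.tensorHom_algComul (h : IsFactorizationComul Δ G) (h1 : Δ 1 = 1)
    (a : starAdjoinRange G) :
    subalgebraTensorHom (starAdjoinRange G) (h.algComul h1 a) = Δ a :=
  congrArg Subtype.val ((AlgEquiv.ofInjective
    (subalgebraTensorHom (starAdjoinRange G))
    (subalgebraTensorHom_injective _)).apply_symm_apply ⟨Δ a, h.mem_range h1 a⟩)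

theorem IsFactorizationComul.algComul_star (h : IsFactorizationComul Δ G) (h1 : Δ 1 = 1)
    (a : starAdjoinRange G) : h.algComul h1 (star a) = star (h.algComul h1 a) := by
  refine subalgebraTensorHom_injective (starAdjoinRange G) ?_
  refine (h.tensorHom_algComul h1 (star a)).trans ?_
  refine Eq.trans ?_ (subalgebraTensorHom_star _ _).symm
  rw [h.tensorHom_algComul h1 a]
  exact map_star Δ (a : A)

/-- The counit of the algebra generated by a family. -/
noncomputable def algCounit (ε : A →⋆ₙₐ[ℂ] ℂ) (h1 : ε 1 = 1) (K : StarSubalgebra ℂ A) :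
    K →ₐ[ℂ] ℂ :=
  (ε.toUnital h1).toAlgHom.comp K.subtype.toAlgHom

theorem IsFactorizationComul.algComul_apply (h : IsFactorizationComul Δ G) (h1 : Δ 1 = 1)
    {k : X → starAdjoinRange G}
    (hk : ∀ x, Δ (k x) = ∑ p ∈ factorizations x, tmul (k p.1 : A) (k p.2 : A)) (x : X) :
    h.algComul h1 (k x) = ∑ p ∈ factorizations x, k p.1 ⊗ₜ k p.2 := by
  refine subalgebraTensorHom_injective (starAdjoinRange G) ?_
  refine (h.tensorHom_algComul h1 (k x)).trans ?_
  rw [hk x, map_sum]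
  exact Finset.sum_congr rfl fun p _ => (subalgebraTensorHom_tmul _ (k p.1) (k p.2)).symm

/-- The generators and their adjoints are families with a factorization comultiplication. -/
theorem IsFactorizationComul.exists_family (h : IsFactorizationComul Δ G) (h1 : Δ 1 = 1)
    (hε : ε (G 1) = 1) (hε0 : ∀ x ≠ 1, ε (G x) = 0) (a : starAdjoinRange G)
    (ha : (a : A) ∈ Set.range G ∪ star (Set.range G)) :
    ∃ (k : X → starAdjoinRange G) (x : X), a = k x ∧
      (∀ x, h.algComul h1 (k x) = ∑ p ∈ factorizations x, k p.1 ⊗ₜ k p.2) ∧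
      ε (k 1) = 1 ∧ ∀ x ≠ 1, ε (k x) = 0 := by
  rcases ha with ⟨x, hx⟩ | ⟨x, hx⟩
  · exact ⟨fun x => ⟨G x, StarAlgebra.subset_adjoin ℂ _ ⟨_, rfl⟩⟩, x, Subtype.ext hx.symm,
      h.algComul_apply h1 fun x => h x, hε, hε0⟩
  · refine ⟨fun x => star ⟨G x, StarAlgebra.subset_adjoin ℂ _ ⟨_, rfl⟩⟩, x,
      Subtype.ext ((star_star (a : A)).symm.trans (congrArg star hx.symm)),
      h.algComul_apply h1 fun x => ?_, ?_, fun x hx => ?_⟩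
    · change Δ (star (G x)) = ∑ p ∈ factorizations x, tmul (star (G p.1)) (star (G p.2))
      rw [map_star, h x, star_sum]
      simp only [star_tmul]
    · change ε (star (G 1)) = 1
      rw [map_star, hε, star_one]
    · change ε (star (G x)) = 0
      rw [map_star, hε0 x hx, star_zero]

/-- The algebraic bialgebra generated by a family with a factorization comultiplication. -/
noncomputable abbrev IsFactorizationComul.bialgebra (h : IsFactorizationComul Δ G) (h1 : Δ 1 = 1)
    (hε1 : ε 1 = 1) (hε : ε (G 1) = 1) (hε0 : ∀ x ≠ 1, ε (G x) = 0) :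
    Bialgebra ℂ (starAdjoinRange G) :=
  Bialgebra.ofAlgHom (h.algComul h1) (algCounit ε hε1 (starAdjoinRange G))
    (starAdjoinRange_hom_ext fun a ha => by
      obtain ⟨k, x, rfl, hk, -, -⟩ := h.exists_family h1 hε hε0 a ha
      simp only [AlgHom.comp_apply, hk, map_sum, Algebra.TensorProduct.map_tmul, AlgHom.id_apply,
        TensorProduct.sum_tmul, TensorProduct.tmul_sum]
      exact sum_factorizations_assoc x fun a b c => k a ⊗ₜ[ℂ] (k b ⊗ₜ[ℂ] k c))
    (starAdjoinRange_hom_ext fun a ha => by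
      obtain ⟨k, x, rfl, hk, hk1, hk0⟩ := h.exists_family h1 hε hε0 a ha
      simp only [AlgHom.comp_apply, hk, map_sum, Algebra.TensorProduct.map_tmul, AlgHom.id_apply]
      refine (sum_factorizations_eq_left x
        (fun p => algCounit ε hε1 (starAdjoinRange G) (k p.1) ⊗ₜ[ℂ] k p.2) fun p hp => ?_).trans ?_
      · exact (congrArg (· ⊗ₜ[ℂ] k p.2) (hk0 _ hp)).trans (TensorProduct.zero_tmul _ _)
      · exact congrArg (· ⊗ₜ[ℂ] k x) hk1)
    (starAdjoinRange_hom_ext fun a ha => by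
      obtain ⟨k, x, rfl, hk, hk1, hk0⟩ := h.exists_family h1 hε hε0 a ha
      simp only [AlgHom.comp_apply, hk, map_sum, Algebra.TensorProduct.map_tmul, AlgHom.id_apply]
      refine (sum_factorizations_eq_right x
        (fun p => k p.1 ⊗ₜ[ℂ] algCounit ε hε1 (starAdjoinRange G) (k p.2)) fun p hp => ?_).trans ?_
      · exact (congrArg (k p.1 ⊗ₜ[ℂ] ·) (hk0 _ hp)).trans (TensorProduct.tmul_zero _ _)
      · exact congrArg (k x ⊗ₜ[ℂ] ·) hk1)

theorem IsFactorizationComul.isSubbialgebra (h : IsFactorizationComul Δ G) (h1 : Δ 1 = 1)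
    (hε1 : ε 1 = 1) (hε : ε (G 1) = 1) (hε0 : ∀ x ≠ 1, ε (G x) = 0) :
    letI := (h.bialgebra h1 hε1 hε hε0).toCoalgebra
    IsSubbialgebra Δ ε
      ((starAdjoinRange G).toSubalgebra.val : starAdjoinRange G →ₐ[ℂ] A) :=
  letI := (h.bialgebra h1 hε1 hε hε0).toCoalgebra
  { injective := Subtype.val_injective
    comul_one := map_one (h.algComul h1)
    comul_mul := map_mul (h.algComul h1)
    counit_one := map_one (algCounit ε hε1 (starAdjoinRange G))
    counit_mul := map_mul (algCounit ε hε1 (starAdjoinRange G))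
    map_comul := h.tensorHom_algComul h1
    map_counit := fun _ => rfl }

end AlgebraicBialgebra

/-! ### Characters at infinity and antipodes -/

section Antipode

open MinTensor

variable {A : Type} [CStarAlgebra A] {Δ : A →⋆ₙₐ[ℂ] MinTensor A A} {ε : A →⋆ₙₐ[ℂ] ℂ}

/-- If a character `ω` is absorbing for the convolution product, `(id ⊗ ω) Δ = ω(·) 1`, then a
dense subbialgebra can have an antipode only if `ω` is the counit. -/
theorem eq_counit_of_antipode {ω : A →⋆ₙₐ[ℂ] ℂ}
    (hω1 : ω 1 = 1) (hω : ∀ a, map (NonUnitalStarAlgHom.id ℂ A) ω (Δ a) = tmul (ω a • 1) 1)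
    (K : Subalgebra ℂ A) (hK : Dense (K : Set A)) [Coalgebra ℂ K] (hsub : IsSubbialgebra Δ ε K.val)
    (S : K →ₗ[ℂ] K) (hS : IsAntipode S) (a : A) : ω a = ε a := by
  let η : K →ₐ[ℂ] ℂ := (ω.toUnital hω1).toAlgHom.comp K.val
  let slice : K ⊗[ℂ] K →ₗ[ℂ] K := (TensorProduct.rid ℂ K).toLinearMap ∘ₗ η.toLinearMap.lTensor K
  -- the slice `(id ⊗ ω)` of an element of the algebraic tensor square of `K` stays in `K`
  have hslice : ∀ b : K, slice (Coalgebra.comul (R := ℂ) b) = η b • 1 := fun b => by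
    refine Subtype.ext (tmul_one_injective ?_)
    refine Eq.trans ?_ (hω b)
    have hb : Δ (b : A) = _ := (hsub.map_comul b).symm
    rw [hb, map_ofAlg]
    refine congrArg ofAlg ?_
    generalize Coalgebra.comul (R := ℂ) b = t
    induction t using TensorProduct.induction_on with
    | zero => simp only [map_zero, ZeroMemClass.coe_zero, TensorProduct.zero_tmul]
    | add x y hx hy => simp only [map_add, Subalgebra.coe_add, TensorProduct.add_tmul, hx, hy]
    | tmul c d =>
      change ((η d • c : K) : A) ⊗ₜ[ℂ] (1 : ℂ) = (c : A) ⊗ₜ[ℂ] η d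
      rw [Subalgebra.coe_smul, TensorProduct.smul_tmul, smul_eq_mul, mul_one]
  have hconv : ∀ t : K ⊗[ℂ] K, η (LinearMap.mul' ℂ K (S.rTensor K t)) = η (S (slice t)) :=
    fun t => by
      induction t using TensorProduct.induction_on with
      | zero => simp only [map_zero]
      | add x y hx hy => simp only [map_add, hx, hy]
      | tmul c d =>
        change η (S c * d) = η (S (η d • c))
        rw [map_mul, map_smul, map_smul, smul_eq_mul, mul_comm]
  -- apply `ω` to `m (S ⊗ id) Δ (b) = ε (b) 1`
  have hmain : ∀ b : K, ε b = η b * η (S 1) := fun b => by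
    have h1 := congrArg η (hS b).1
    rw [hconv, hslice, map_smul, map_smul, smul_eq_mul, AlgHom.commutes, hsub.map_counit] at h1
    exact h1.symm
  have hone : η (S 1) = 1 := by
    have h1 := hmain 1
    rw [map_one, one_mul] at h1
    rw [← h1, ← hsub.counit_one, hsub.map_counit]
    rfl
  exact closure_minimal (s := (K : Set A)) (t := {a | ω a = ε a})
    (fun b hb => ((hmain ⟨b, hb⟩).trans ((congrArg _ hone).trans (mul_one _))).symm)
    (isClosed_eq (continuous_starHom ω) (continuous_starHom ε)) (hK a)

end Antipode

/-! ### Homomorphisms of direct sums given by homomorphisms of summands -/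

namespace C0Sum

variable {P ι κ : Type} {𝒜 : ι → Type} {ℬ : κ → Type} [∀ i, NonUnitalCStarAlgebra (𝒜 i)]
  [∀ i, NonUnitalCStarAlgebra (ℬ i)] {m : P → ι} {k : P → κ} (hm : Function.Injective m)
  (hk : Function.Injective k) (f : ∀ p, 𝒜 (m p) →⋆ₙₐ[ℂ] ℬ (k p))

/-- The homomorphism of direct sums which maps the summand `m p` to the summand `k p` by `f p`, and
all summands without such an index `p` to zero. -/
noncomputable def mapAlong : C0Sum 𝒜 →⋆ₙₐ[ℂ] C0Sum ℬ :=
  desc (m := m) (fun p => (single (𝒜 := ℬ) (k p)).comp (f p))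
    (fun _ _ h _ _ => single_mul_single_ne (hk.ne h) _ _)
    (fun i => (Set.subsingleton_singleton (a := i)).preimage hm |>.finite)

theorem hasSum_proj_mapAlong (x : C0Sum 𝒜) (j : κ) :
    HasSum (fun p => proj j (single (𝒜 := ℬ) (k p) (f p (proj (m p) x))))
      (proj j (mapAlong hm hk f x)) :=
  (hasSum_desc (m := m) (fun p => (single (𝒜 := ℬ) (k p)).comp (f p))
    (fun _ _ h _ _ => single_mul_single_ne (hk.ne h) _ _)
    (fun i => (Set.subsingleton_singleton (a := i)).preimage hm |>.finite) x).map (proj j)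
      (continuous_starHom (proj j))

theorem proj_mapAlong (x : C0Sum 𝒜) (p : P) :
    proj (k p) (mapAlong hm hk f x) = f p (proj (m p) x) := by
  refine (hasSum_proj_mapAlong hm hk f x (k p)).unique ?_
  have h := _root_.hasSum_single
    (f := fun q => proj (k p) (single (𝒜 := ℬ) (k q) (f q (proj (m q) x)))) p
    fun q hq => proj_single_ne (hk.ne hq.symm) _
  rwa [proj_single_self] at h

theorem proj_mapAlong_of_notMem (x : C0Sum 𝒜) {j : κ} (hj : ∀ p, j ≠ k p) :
    proj j (mapAlong hm hk f x) = 0 := by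
  refine (hasSum_proj_mapAlong hm hk f x j).unique ?_
  convert hasSum_zero (α := ℬ j) (β := P) using 2 with p
  exact proj_single_ne (hj p) _

theorem mapAlong_single (p : P) (a : 𝒜 (m p)) :
    mapAlong hm hk f (single (m p) a) = single (k p) (f p a) := by
  refine ext fun j => ?_
  by_cases hj : ∃ q, j = k q
  · obtain ⟨q, rfl⟩ := hj
    rw [proj_mapAlong]
    rcases eq_or_ne q p with rfl | hq
    · rw [proj_single_self, proj_single_self]
    · rw [proj_single_ne (hm.ne hq), proj_single_ne (hk.ne hq), map_zero]
  · rw [proj_mapAlong_of_notMem hm hk f _ fun q h => hj ⟨q, h⟩,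
      proj_single_ne fun h => hj ⟨p, h⟩]

end C0Sum

/-- Multiplication by `Δ x` on the summand `𝒜 a ⊗ 𝒜 b` of the tensor square only sees the term
`φ a b`, as the ranges of the other terms are orthogonal to it. -/
theorem sumComul_mul_map_single {M : Type} {𝒜 : M → Type} [∀ a, NonUnitalCStarAlgebra (𝒜 a)]
    [Mul M] [FiniteFactorizations M] (φ : ∀ a b, 𝒜 (a * b) →⋆ₙₐ[ℂ] MinTensor (𝒜 a) (𝒜 b))
    (x : C0Sum 𝒜) (a b : M) (w : MinTensor (𝒜 a) (𝒜 b)) :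
    sumComul φ x * MinTensor.map (C0Sum.single a) (C0Sum.single b) w =
      MinTensor.map (C0Sum.single a) (C0Sum.single b) (φ a b (C0Sum.proj (a * b) x) * w) := by
  have h := (hasSum_sumComul φ x).mul_right
    (MinTensor.map (C0Sum.single (𝒜 := 𝒜) a) (C0Sum.single b) w)
  refine h.unique ?_
  rw [map_mul]
  exact hasSum_single (a, b) fun p hp => map_single_mul_map_single hp _ w

/-! ### The Cuntz summands -/

section Cuntz

open MinTensor

/-- The generators of the Cuntz algebra, indexed as those of the Cuntz-Krieger algebra. -/
noncomputable def cuntzGenAllOnes (n : ℕ+) (i : Fin (NDMat.allOnes n).n) : Cuntz n := cuntzGen n i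

/-- The generators of the Cuntz-Krieger algebra, indexed as those of the Cuntz algebra. -/
noncomputable def ckGenAllOnes (n : ℕ+) (i : Fin n) : CuntzKrieger (NDMat.allOnes n) :=
  ckGen (NDMat.allOnes n) i

theorem cuntzGen_ckRel (n : ℕ+) : ∀ p ∈ (ckRelations (NDMat.allOnes n)).rel,
    FreeStar.eval (cuntzGenAllOnes n) p = 0 := by
  rintro _ (i | i | _ | ⟨h, i⟩)
  · simp only [map_sub, map_mul, map_star, FreeStar.eval_gen, sub_eq_zero]
    rw [mul_assoc]
    exact (congrArg (cuntzGen n i * ·) (cuntzGen_isometry n i)).trans (mul_one _)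
  · simp only [map_sub, map_mul, map_star, map_sum, map_smul, FreeStar.eval_gen, sub_eq_zero]
    refine (cuntzGen_isometry n i).trans ((cuntzGen_sum_range n).symm.trans ?_)
    refine Finset.sum_congr rfl fun j _ => ?_
    change _ = ((1 : ℕ) : ℂ) • _
    rw [Nat.cast_one, one_smul]
    rfl
  · simp only [map_sub, map_mul, map_star, map_sum, map_one, FreeStar.eval_gen, sub_eq_zero]
    exact cuntzGen_sum_range n
  · simp only [map_sub, map_one, FreeStar.eval_gen, sub_eq_zero]
    exact cuntzGen_size_one n (PNat.eq h) i

theorem ckGen_cuntzRel (n : ℕ+) : ∀ p ∈ (cuntzRelations n).rel,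
    FreeStar.eval (ckGenAllOnes n) p = 0 := by
  rintro _ (i | _ | ⟨h, i⟩)
  · simp only [map_sub, map_mul, map_star, map_one, FreeStar.eval_gen, sub_eq_zero]
    refine (ckGen_source (NDMat.allOnes n) i).trans (Eq.trans ?_ (ckGen_sum_range _))
    refine Finset.sum_congr rfl fun j _ => ?_
    change ((1 : ℕ) : ℂ) • _ = _
    rw [Nat.cast_one, one_smul]
  · simp only [map_sub, map_mul, map_star, map_sum, map_one, FreeStar.eval_gen, sub_eq_zero]
    exact ckGen_sum_range (NDMat.allOnes n)
  · simp only [map_sub, map_one, FreeStar.eval_gen, sub_eq_zero]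
    exact ckGen_size_one (NDMat.allOnes n) (congrArg PNat.val h) i

/-- The homomorphism of the Cuntz-Krieger algebra of the all-ones matrix to the Cuntz algebra. -/
noncomputable def ckToCuntz (n : ℕ+) : CuntzKrieger (NDMat.allOnes n) →⋆ₙₐ[ℂ] Cuntz n :=
  CStarRelations.Univ.lift (R := ckRelations (NDMat.allOnes n)) (cuntzGenAllOnes n)
    (cuntzGen_ckRel n)

/-- The homomorphism of the Cuntz algebra to the Cuntz-Krieger algebra of the all-ones matrix. -/
noncomputable def cuntzToCK (n : ℕ+) : Cuntz n →⋆ₙₐ[ℂ] CuntzKrieger (NDMat.allOnes n) :=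
  CStarRelations.Univ.lift (R := cuntzRelations n) (ckGenAllOnes n) (ckGen_cuntzRel n)

theorem ckToCuntz_gen (n : ℕ+) (i : Fin n) :
    ckToCuntz n (ckGen (NDMat.allOnes n) i) = cuntzGen n i :=
  CStarRelations.Univ.lift_gen _ _ _

theorem cuntzToCK_gen (n : ℕ+) (i : Fin n) :
    cuntzToCK n (cuntzGen n i) = ckGen (NDMat.allOnes n) i :=
  CStarRelations.Univ.lift_gen _ _ _

theorem ckToCuntz_cuntzToCK (n : ℕ+) (a : Cuntz n) : ckToCuntz n (cuntzToCK n a) = a :=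
  (cstarGenerates_cuntzGen n).hom_ext (f := (ckToCuntz n).comp (cuntzToCK n))
    (g := NonUnitalStarAlgHom.id ℂ _) (by
      rintro _ ⟨i, rfl⟩
      exact (congrArg (ckToCuntz n) (cuntzToCK_gen n i)).trans (ckToCuntz_gen n i)) a

theorem cuntzToCK_ckToCuntz (n : ℕ+) (a : CuntzKrieger (NDMat.allOnes n)) :
    cuntzToCK n (ckToCuntz n a) = a :=
  (cstarGenerates_ckGen (NDMat.allOnes n)).hom_ext (f := (cuntzToCK n).comp (ckToCuntz n))
    (g := NonUnitalStarAlgHom.id ℂ _) (by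
      rintro _ ⟨i, rfl⟩
      exact (congrArg (cuntzToCK n) (ckToCuntz_gen n i)).trans (cuntzToCK_gen n i)) a

/-- The projection of the direct sum of all Cuntz-Krieger algebras to its Cuntz summands. -/
noncomputable def ckStarToCuntzStar : CKStar →⋆ₙₐ[ℂ] CuntzStar :=
  C0Sum.mapAlong (m := NDMat.allOnes) (k := id) NDMat.allOnes_injective Function.injective_id
    ckToCuntz

/-- The inclusion of the direct sum of all Cuntz algebras into that of all Cuntz-Krieger
algebras. -/
noncomputable def cuntzStarToCKStar : CuntzStar →⋆ₙₐ[ℂ] CKStar :=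
  C0Sum.mapAlong (m := id) (k := NDMat.allOnes) Function.injective_id NDMat.allOnes_injective
    cuntzToCK

theorem cuntzStarToCKStar_mem (y : CuntzStar) : cuntzStarToCKStar y ∈ cuntzPartSubalgebra :=
  fun _ hA => C0Sum.proj_mapAlong_of_notMem (m := id) (k := NDMat.allOnes) Function.injective_id
    NDMat.allOnes_injective cuntzToCK y hA

/-- The inclusion of the direct sum of all Cuntz algebras, with values in `CuntzPart`. -/
noncomputable def cuntzStarToPart : CuntzStar →⋆ₙₐ[ℂ] CuntzPart where
  toFun y := ⟨cuntzStarToCKStar y, cuntzStarToCKStar_mem y⟩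
  map_smul' c x := Subtype.ext (map_smul cuntzStarToCKStar c x)
  map_zero' := Subtype.ext (map_zero cuntzStarToCKStar)
  map_add' x y := Subtype.ext (map_add cuntzStarToCKStar x y)
  map_mul' x y := Subtype.ext (map_mul cuntzStarToCKStar x y)
  map_star' x := Subtype.ext (map_star cuntzStarToCKStar x)

/-- The projection of `CuntzPart` to the direct sum of all Cuntz algebras. -/
noncomputable abbrev partToCuntzStar : CuntzPart →⋆ₙₐ[ℂ] CuntzStar :=
  ckStarToCuntzStar.comp CuntzPart.incl

theorem partToCuntzStar_cuntzStarToPart (y : CuntzStar) :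
    partToCuntzStar (cuntzStarToPart y) = y := C0Sum.ext fun n => by
  refine (C0Sum.proj_mapAlong (m := NDMat.allOnes) (k := id) NDMat.allOnes_injective
    Function.injective_id ckToCuntz _ n).trans ?_
  refine (congrArg (ckToCuntz n) (C0Sum.proj_mapAlong (m := id) (k := NDMat.allOnes)
    Function.injective_id NDMat.allOnes_injective cuntzToCK y n)).trans ?_
  exact ckToCuntz_cuntzToCK n _

theorem cuntzStarToPart_partToCuntzStar (x : CuntzPart) :
    cuntzStarToPart (partToCuntzStar x) = x := Subtype.ext <| C0Sum.ext fun A => by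
  by_cases hA : ∃ n, A = NDMat.allOnes n
  · obtain ⟨n, rfl⟩ := hA
    refine (C0Sum.proj_mapAlong (m := id) (k := NDMat.allOnes)
      Function.injective_id NDMat.allOnes_injective cuntzToCK _ n).trans ?_
    refine (congrArg (cuntzToCK n) (C0Sum.proj_mapAlong (m := NDMat.allOnes) (k := id)
      NDMat.allOnes_injective Function.injective_id ckToCuntz _ n)).trans ?_
    exact cuntzToCK_ckToCuntz n _
  · have hA' : ∀ n, A ≠ NDMat.allOnes n := fun n h => hA ⟨n, h⟩
    exact ((cuntzStarToPart (partToCuntzStar x)).2 A hA').trans (x.2 A hA').symm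

/-- The isomorphism of the direct sum of the Cuntz-Krieger algebras of the all-ones matrices onto
the direct sum of the Cuntz algebras. -/
noncomputable def cuntzPartEquiv : CuntzPart ≃⋆ₐ[ℂ] CuntzStar :=
  { partToCuntzStar with
    invFun := cuntzStarToPart
    left_inv := cuntzStarToPart_partToCuntzStar
    right_inv := partToCuntzStar_cuntzStarToPart }

/-- The comultiplication of `CuntzPart`, transported from the direct sum of the Cuntz algebras. -/
noncomputable def partComul : CuntzPart →⋆ₙₐ[ℂ] MinTensor CuntzPart CuntzPart :=
  (map cuntzStarToPart cuntzStarToPart).comp (cuntzComul.comp partToCuntzStar)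

theorem partComul_intertwines : Intertwines cuntzStarToPart cuntzComul partComul := fun y =>
  congrArg (fun z => map cuntzStarToPart cuntzStarToPart (cuntzComul z))
    (partToCuntzStar_cuntzStarToPart y)

/-- The generators of `CuntzPart`. -/
noncomputable def partGen (x : Σ n : ℕ+, Fin n) : CuntzPart := cuntzStarToPart (cuntzStarGen x)

/-- The index of a generator of a Cuntz algebra among those of Cuntz-Krieger algebras. -/
def allOnesIndex (x : Σ n : ℕ+, Fin n) : Σ A : NDMat, Fin A.n := ⟨NDMat.allOnes x.1, x.2⟩

theorem incl_partGen (x : Σ n : ℕ+, Fin n) :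
    CuntzPart.incl (partGen x) = ckStarGen (allOnesIndex x) :=
  (C0Sum.mapAlong_single (m := id) (k := NDMat.allOnes) Function.injective_id
    NDMat.allOnes_injective cuntzToCK x.1 (cuntzGen x.1 x.2)).trans
    (congrArg (C0Sum.single (NDMat.allOnes x.1)) (cuntzToCK_gen x.1 x.2))

theorem cstarGenerates_partGen : CStarGenerates (Set.range partGen) := by
  have h := cstarGenerates_cuntzStarGen.image cuntzStarToPart
    fun x => ⟨partToCuntzStar x, cuntzStarToPart_partToCuntzStar x⟩
  rwa [← Set.range_comp] at h

theorem partComul_isFactorizationComul : IsFactorizationComul partComul partGen :=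
  cuntzComul_isFactorizationComul.image cuntzStarToPart partComul_intertwines

theorem allOnesIndex_injective : Function.Injective allOnesIndex := fun x y h => by
  have h1 : x.1 = y.1 := NDMat.allOnes_injective (congrArg Sigma.fst h)
  refine PNat.sigma_fin_ext h1 ?_
  exact congrArg (fun z : Σ A : NDMat, Fin A.n => (z.2 : ℕ)) h

theorem allOnesIndex_mul (x y : Σ n : ℕ+, Fin n) :
    allOnesIndex (x * y) = allOnesIndex x * allOnesIndex y := rfl

theorem allOnesIndex_one : allOnesIndex 1 = 1 := rfl

theorem mem_range_allOnesIndex {x : Σ A : NDMat, Fin A.n} {n : ℕ+} (h : x.1 = NDMat.allOnes n) :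
    x ∈ Set.range allOnesIndex := by
  obtain ⟨A, i⟩ := x
  obtain rfl : A = NDMat.allOnes n := h
  exact ⟨⟨n, i⟩, rfl⟩

theorem incl_intertwines : Intertwines CuntzPart.incl partComul ckComul :=
  partComul_isFactorizationComul.intertwines ckComul_isFactorizationComul cstarGenerates_partGen
    CuntzPart.incl allOnesIndex incl_partGen allOnesIndex_injective allOnesIndex_mul
    fun x y z h => by
      have h1 := NDMat.eq_allOnes_of_mul_eq (congrArg Sigma.fst h : y.1 * z.1 = _)
      exact ⟨mem_range_allOnesIndex h1.1, mem_range_allOnesIndex h1.2⟩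

theorem ckCounit_partGen_one : (ckCounit.comp CuntzPart.incl) (partGen 1) = 1 := by
  rw [NonUnitalStarAlgHom.comp_apply, incl_partGen, allOnesIndex_one, ckCounit_gen_one]

theorem ckCounit_partGen_ne_one (x : Σ n : ℕ+, Fin n) (hx : x ≠ 1) :
    (ckCounit.comp CuntzPart.incl) (partGen x) = 0 := by
  rw [NonUnitalStarAlgHom.comp_apply, incl_partGen, ckCounit_gen_ne_one]
  exact allOnesIndex_injective.ne hx

theorem dense_span_part : Dense (Submodule.span ℂ
    {x : CuntzPart | ∃ n a, x = cuntzStarToPart (C0Sum.single n a)} : Set CuntzPart) := fun x => by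
  rw [← cuntzStarToPart_partToCuntzStar x]
  refine map_mem_closure (continuous_starHom cuntzStarToPart)
    (C0Sum.dense_span_single (partToCuntzStar x)) fun y hy => ?_
  induction hy using Submodule.span_induction with
  | mem y hy =>
    obtain ⟨n, a, rfl⟩ := hy
    exact Submodule.subset_span ⟨n, a, rfl⟩
  | zero => rw [map_zero]; exact Submodule.zero_mem _
  | add y z _ _ hy hz => rw [map_add]; exact Submodule.add_mem _ hy hz
  | smul c y _ hy => rw [map_smul]; exact Submodule.smul_mem _ c hy

theorem partComul_dense : Dense (Submodule.span ℂ (Set.range fun t :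
    CuntzPart × CuntzPart × CuntzPart => partComul t.1 * tmul t.2.1 t.2.2) :
      Set (MinTensor CuntzPart CuntzPart)) := by
  refine dense_comul_of_total dense_span_part ?_
  rintro _ ⟨n, x, rfl⟩ _ ⟨m, y, rfl⟩
  -- the unit of the summand with index `n * m` acts as `1 ⊗ 1` on the summand `O_n ⊗ O_m`
  refine ⟨cuntzStarToPart (C0Sum.single (n * m) 1), ?_⟩
  rw [partComul_intertwines, ← map_tmul, ← map_mul]
  refine congrArg _ ?_
  rw [← map_tmul, cuntzComul, sumComul_mul_map_single, C0Sum.proj_single_self]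
  refine congrArg _ ?_
  have h1 : cuntzPhi n m 1 = 1 := CStarRelations.Univ.lift_one _ _
  rw [h1]
  exact one_mul (M := MinTensor (Cuntz n) (Cuntz m)) _

theorem partComul_isCounitalCStarBialgebra :
    IsCounitalCStarBialgebra partComul (ckCounit.comp CuntzPart.incl) where
  dense := partComul_dense
  coassoc := coassoc_of_generates cstarGenerates_partGen <| by
    rintro _ ⟨x, rfl⟩
    exact partComul_isFactorizationComul.coassoc x
  counit_left := counit_left_of_generates cstarGenerates_partGen <| by
    rintro _ ⟨x, rfl⟩
    exact partComul_isFactorizationComul.counit_left ckCounit_partGen_one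
      ckCounit_partGen_ne_one x
  counit_right := counit_right_of_generates cstarGenerates_partGen <| by
    rintro _ ⟨x, rfl⟩
    exact partComul_isFactorizationComul.counit_right ckCounit_partGen_one
      ckCounit_partGen_ne_one x

theorem cuntzPartEquiv_intertwines :
    Intertwines (cuntzPartEquiv : CuntzPart →⋆ₙₐ[ℂ] CuntzStar) partComul cuntzComul := fun x => by
  change cuntzComul (partToCuntzStar x) = map partToCuntzStar partToCuntzStar
    (map cuntzStarToPart cuntzStarToPart (cuntzComul (partToCuntzStar x)))
  rw [MinTensor.map_map]
  have h : partToCuntzStar.comp cuntzStarToPart = NonUnitalStarAlgHom.id ℂ CuntzStar :=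
    NonUnitalStarAlgHom.ext partToCuntzStar_cuntzStarToPart
  rw [h, MinTensor.map_id]

theorem cuntzCounit_cuntzPartEquiv (x : CuntzPart) :
    cuntzCounit (cuntzPartEquiv x) = ckCounit (CuntzPart.incl x) := by
  refine cstarGenerates_partGen.hom_ext (f := cuntzCounit.comp partToCuntzStar)
    (g := ckCounit.comp CuntzPart.incl) ?_ x
  rintro _ ⟨y, rfl⟩
  have h : partToCuntzStar (partGen y) = cuntzStarGen y := partToCuntzStar_cuntzStarToPart _
  rw [NonUnitalStarAlgHom.comp_apply (g := partToCuntzStar) (f := cuntzCounit), h]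
  rcases eq_or_ne y 1 with rfl | hy
  · rw [cuntzCounit_gen_one, ckCounit_partGen_one]
  · rw [cuntzCounit_gen_ne_one y hy, ckCounit_partGen_ne_one y hy]

end Cuntz

/-! ### The unitization -/

section Tilde

open MinTensor

/-- A homomorphism to a unital C*-algebra, extended to the unitization as a unital one. -/
noncomputable def extendUnitization {A B : Type} [NonUnitalCStarAlgebra A] [CStarAlgebra B]
    (f : A →⋆ₙₐ[ℂ] B) : Unitization ℂ A →⋆ₙₐ[ℂ] B :=
  (Unitization.starLift f).toNonUnitalStarAlgHom

theorem extendUnitization_one {A B : Type} [NonUnitalCStarAlgebra A] [CStarAlgebra B]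
    (f : A →⋆ₙₐ[ℂ] B) : extendUnitization f 1 = 1 :=
  map_one (Unitization.starLift f)

theorem extendUnitization_inr {A B : Type} [NonUnitalCStarAlgebra A] [CStarAlgebra B]
    (f : A →⋆ₙₐ[ℂ] B) (a : A) : extendUnitization f (Unitization.inr a) = f a :=
  DFunLike.congr_fun (Unitization.starLift.symm_apply_apply f) a

/-- The comultiplication of the unitization. -/
noncomputable def tildeComul : CKTilde →⋆ₙₐ[ℂ] MinTensor CKTilde CKTilde :=
  extendUnitization ((map toCKTilde toCKTilde).comp ckComul)

/-- The counit of the unitization. -/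
noncomputable def tildeCounit : CKTilde →⋆ₙₐ[ℂ] ℂ := extendUnitization ckCounit

/-- The character `x + c 1 ↦ c` of the unitization. -/
noncomputable def tildeInfinity : CKTilde →⋆ₙₐ[ℂ] ℂ := extendUnitization (0 : CKStar →⋆ₙₐ[ℂ] ℂ)

theorem tildeComul_one : tildeComul 1 = 1 := extendUnitization_one _

theorem tildeCounit_one : tildeCounit 1 = 1 := extendUnitization_one _

theorem tildeInfinity_one : tildeInfinity 1 = 1 := extendUnitization_one _

theorem tildeComul_intertwines : Intertwines toCKTilde ckComul tildeComul := fun a =>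
  extendUnitization_inr _ a

theorem tildeCounit_toCKTilde (a : CKStar) : tildeCounit (toCKTilde a) = ckCounit a :=
  extendUnitization_inr _ a

theorem tildeInfinity_toCKTilde (a : CKStar) : tildeInfinity (toCKTilde a) = 0 :=
  extendUnitization_inr _ a

/-- The generators `s_i^{(A)}`, in the unitization. -/
noncomputable def tildeGen (x : Σ A : NDMat, Fin A.n) : CKTilde := toCKTilde (ckStarGen x)

theorem tildeComul_isFactorizationComul : IsFactorizationComul tildeComul tildeGen :=
  ckComul_isFactorizationComul.image toCKTilde tildeComul_intertwines

theorem tildeCounit_gen_one : tildeCounit (tildeGen 1) = 1 :=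
  (tildeCounit_toCKTilde _).trans ckCounit_gen_one

theorem tildeCounit_gen_ne_one (x : Σ A : NDMat, Fin A.n) (hx : x ≠ 1) :
    tildeCounit (tildeGen x) = 0 :=
  (tildeCounit_toCKTilde _).trans (ckCounit_gen_ne_one x hx)

theorem cstarGenerates_tildeGen : CStarGenerates (insert 1 (Set.range tildeGen)) :=
  CStarGenerates.of_closed fun T hT h a => by
    have h1 : ∀ x, toCKTilde x ∈ T := fun x =>
      cstarGenerates_ckStarGen.mem_of_isClosed (T.comap toCKTilde)
        (hT.preimage (continuous_starHom toCKTilde))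
        (by rintro _ ⟨y, rfl⟩; exact h (Or.inr ⟨y, rfl⟩)) x
    induction a using Unitization.ind with
    | inl_add_inr c x =>
      refine add_mem ?_ (h1 x)
      have h2 : (Unitization.inl c : CKTilde) = c • 1 :=
        Algebra.algebraMap_eq_smul_one (A := CKTilde) c
      rw [h2]
      exact SMulMemClass.smul_mem c (h (Or.inl rfl))

theorem tildeComul_isCounitalCStarBialgebra :
    IsCounitalCStarBialgebra tildeComul tildeCounit where
  dense := dense_comul_of_total (S := Set.univ)
    (by rw [Submodule.span_univ]; exact dense_univ) fun b _ c _ => ⟨1, by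
      rw [tildeComul_one]
      exact one_mul (M := MinTensor CKTilde CKTilde) _⟩
  coassoc := coassoc_of_generates cstarGenerates_tildeGen <| by
    rintro _ (rfl | ⟨x, rfl⟩)
    · have h2 : tildeComul 1 = tmul 1 1 := tildeComul_one
      rw [h2, map_tmul, map_tmul, h2]
      exact tmul_mem_assocGraph 1 1 1
    · exact tildeComul_isFactorizationComul.coassoc x
  counit_left := counit_left_of_generates cstarGenerates_tildeGen <| by
    rintro _ (rfl | ⟨x, rfl⟩)
    · have h2 : tildeComul 1 = tmul 1 1 := tildeComul_one
      rw [h2, map_tmul, tildeCounit_one]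
      rfl
    · exact tildeComul_isFactorizationComul.counit_left tildeCounit_gen_one
        tildeCounit_gen_ne_one x
  counit_right := counit_right_of_generates cstarGenerates_tildeGen <| by
    rintro _ (rfl | ⟨x, rfl⟩)
    · have h2 : tildeComul 1 = tmul 1 1 := tildeComul_one
      rw [h2, map_tmul, tildeCounit_one]
      rfl
    · exact tildeComul_isFactorizationComul.counit_right tildeCounit_gen_one
        tildeCounit_gen_ne_one x

theorem dense_ckAlgebraic : Dense (ckAlgebraic : Set CKTilde) := fun a => by
  have hone : (1 : CKTilde) ∈ ckAlgebraic := one_mem _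
  have h := cstarGenerates_tildeGen.mem_of_isClosed
    ckAlgebraic.topologicalClosure.toNonUnitalStarSubalgebra
    (StarSubalgebra.isClosed_topologicalClosure ckAlgebraic) ?_ a
  · exact h
  · rintro _ (rfl | ⟨x, rfl⟩)
    · exact subset_closure hone
    · exact subset_closure (StarAlgebra.subset_adjoin ℂ _ ⟨x, rfl⟩)

/-- The character at infinity vanishes on the direct sum, and the comultiplication maps the direct
sum to its tensor square; hence this character is absorbing. -/
theorem tildeInfinity_absorbing (a : CKTilde) :
    map (NonUnitalStarAlgHom.id ℂ CKTilde) tildeInfinity (tildeComul a) =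
      tmul (tildeInfinity a • 1) 1 := by
  have hz : ∀ z : MinTensor CKStar CKStar,
      map (NonUnitalStarAlgHom.id ℂ CKTilde) tildeInfinity (map toCKTilde toCKTilde z) = 0 :=
    fun z => MinTensor.hom_ext (g := (0 : MinTensor CKStar CKStar →⋆ₙₐ[ℂ] MinTensor CKTilde ℂ))
      (f := (map (NonUnitalStarAlgHom.id ℂ CKTilde) tildeInfinity).comp
        (map toCKTilde toCKTilde)) (fun a b => by
        rw [NonUnitalStarAlgHom.comp_apply, map_tmul, map_tmul, tildeInfinity_toCKTilde, tmul_zero]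
        rfl) z
  let tmulOne : ℂ →⋆ₙₐ[ℂ] MinTensor CKTilde ℂ :=
    { toFun := fun c => tmul (c • 1) 1
      map_smul' := fun c d => by rw [smul_assoc, smul_tmul]; rfl
      map_zero' := by rw [zero_smul, zero_tmul]
      map_add' := fun c d => by rw [add_smul, add_tmul]
      map_mul' := fun c d => by rw [tmul_mul_tmul, smul_mul_smul_comm, one_mul, one_mul]
      map_star' := fun c => by rw [star_tmul, star_smul, star_one, star_one] }
  refine cstarGenerates_tildeGen.hom_ext
    (f := (map (NonUnitalStarAlgHom.id ℂ CKTilde) tildeInfinity).comp tildeComul)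
    (g := tmulOne.comp tildeInfinity) ?_ a
  rintro _ (rfl | ⟨x, rfl⟩)
  · have h2 : tildeComul 1 = tmul 1 1 := tildeComul_one
    rw [NonUnitalStarAlgHom.comp_apply, NonUnitalStarAlgHom.comp_apply, h2, map_tmul,
      tildeInfinity_one]
    change tmul (1 : CKTilde) (1 : ℂ) = tmul ((1 : ℂ) • 1) 1
    rw [one_smul]
  · have h3 : tildeInfinity (tildeGen x) = 0 := tildeInfinity_toCKTilde _
    rw [NonUnitalStarAlgHom.comp_apply, NonUnitalStarAlgHom.comp_apply, h3, map_zero]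
    refine Eq.trans ?_ (hz (ckComul (ckStarGen x)))
    exact congrArg _ (tildeComul_intertwines (ckStarGen x))

end Tilde

theorem theorem1p2 :
    ∃ (Δ : CKTilde →⋆ₙₐ[ℂ] MinTensor CKTilde CKTilde) (ε : CKTilde →⋆ₙₐ[ℂ] ℂ),
      -- (i) a unital counital strictly proper C*-bialgebra, which extends the given one
      (IsCounitalCStarBialgebra Δ ε ∧ Δ 1 = 1 ∧ ε 1 = 1 ∧
        Intertwines toCKTilde ckComul Δ ∧ (∀ x, ε (toCKTilde x) = ckCounit x)) ∧
      -- (ii) the dense algebraic `*`-subbialgebra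
      (Dense (ckAlgebraic : Set CKTilde) ∧
        ∃ _ : Coalgebra ℂ ckAlgebraic,
          IsSubbialgebra Δ ε (ckAlgebraic.toSubalgebra.val : ckAlgebraic →ₐ[ℂ] CKTilde) ∧
          (∀ x : ckAlgebraic, Coalgebra.comul (R := ℂ) (star x) =
            star (Coalgebra.comul (R := ℂ) x)) ∧
          ∀ x : ckAlgebraic, Coalgebra.counit (R := ℂ) (star x) =
            star (Coalgebra.counit (R := ℂ) x)) ∧
      -- (iii) no dense subbialgebra has an antipode
      (∀ 𝔅 : Subalgebra ℂ CKTilde, Dense (𝔅 : Set CKTilde) → ∀ _ : Coalgebra ℂ 𝔅,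
        IsSubbialgebra Δ ε 𝔅.val → ¬ ∃ S : 𝔅 →ₗ[ℂ] 𝔅, IsAntipode S) ∧
      -- (iv) the C*-subbialgebra of the Cuntz summands
      ∃ ΔC : CuntzPart →⋆ₙₐ[ℂ] MinTensor CuntzPart CuntzPart,
        Intertwines CuntzPart.incl ΔC ckComul ∧
        IsCounitalCStarBialgebra ΔC (ckCounit.comp CuntzPart.incl) ∧
        ∃ e : CuntzPart ≃⋆ₐ[ℂ] CuntzStar,
          Intertwines (e : CuntzPart →⋆ₙₐ[ℂ] CuntzStar) ΔC cuntzComul ∧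
          ∀ x, cuntzCounit (e x) = ckCounit (CuntzPart.incl x) := by
  refine ⟨tildeComul, tildeCounit, ⟨tildeComul_isCounitalCStarBialgebra, tildeComul_one,
    tildeCounit_one, tildeComul_intertwines, tildeCounit_toCKTilde⟩, ⟨dense_ckAlgebraic,
    (tildeComul_isFactorizationComul.bialgebra tildeComul_one tildeCounit_one tildeCounit_gen_one
      tildeCounit_gen_ne_one).toCoalgebra,
    tildeComul_isFactorizationComul.isSubbialgebra tildeComul_one tildeCounit_one
      tildeCounit_gen_one tildeCounit_gen_ne_one,
    tildeComul_isFactorizationComul.algComul_star tildeComul_one,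
    fun x => map_star tildeCounit (x : CKTilde)⟩, ?_,
    partComul, incl_intertwines, partComul_isCounitalCStarBialgebra, cuntzPartEquiv,
    cuntzPartEquiv_intertwines, cuntzCounit_cuntzPartEquiv⟩
  rintro K hK _ hsub ⟨S, hS⟩
  have h := eq_counit_of_antipode tildeInfinity_one tildeInfinity_absorbing K hK hsub S hS
    (tildeGen 1)
  rw [tildeCounit_gen_one, tildeGen, tildeInfinity_toCKTilde] at h
  exact zero_ne_one h
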